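/- Let $(K,d)$ be a non-empty compact metric space, let $N\ge 2$, $\Sigma=\{1,\dots,N\}$, and let $\gamma=(\gamma_1,\dots,\gamma_N)$ be a self-similar map on $K$: each $\gamma_j:K\to K$ satisfies $c'_jd(x,y)\le d(\gamma_j(x),\gamma_j(y))\le c_jd(x,y)$ for all $x,y$, with constants $0<c'_j\le c_j<1$, and $K=\bigcup_j\gamma_j(K)$. Put $$B_\gamma=\{b: b=\gamma_i(a)=\gamma_j(a)\text{ for some }a\in K,\ i\ne j\},\qquad P_\gamma=\{a:\gamma_{j_1}\circ\cdots\circ\gamma_{j_k}(a)\in B_\gamma\text{ for some }k\ge1,\ j_1,\dots,j_k\in\Sigma\},$$ $$O_{b,k}=\{\gamma_{j_1}\circ\cdots\circ\gamma_{j_k}(b): j_1,\dots,j_k\in\Sigma\},\qquad O_{b,0}=\{b\}.$$ Assume Assumption B: (1) there is a continuous $h:K\to K$ with $h(\gamma_j(y))=y$ for all $j$ and $y$; (2) $B_\gamma$ is finite; (3) $B_\gamma\cap P_\gamma=\emptyset$. Let $A=C(K)$ and let $X_\gamma=C(\mathcal C_\gamma)$, $\mathcal C_\gamma=\{(\gamma_j(y),y):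 j\in\Sigma,\ y\in K\}$, be the C*-correspondence over $A$ with $(a\cdot\xi\cdot a')(x,y)=a(x)\xi(x,y)a'(y)$ and $(\xi|\eta)_A(y)=\sum_j\overline{\xi(\gamma_j(y),y)}\,\eta(\gamma_j(y),y)$; write $\phi(a)\xi=a\cdot\xi$ and $\theta_{\xi,\eta}(\zeta)=\xi\cdot(\eta|\zeta)_A$, and let $\mathcal K(X_\gamma)$ be the closed linear span of the $\theta_{\xi,\eta}$. Let $\mathcal O_\gamma$ be its Cuntz–Pimsner algebra, the universal C*-algebra generated by a copy of $A$ and elements $S_\xi$ $(\xi\in X_\gamma)$, linear in $\xi$, with $aS_\xi=S_{a\cdot\xi}$, $S_\xi a=S_{\xi\cdot a}$, $S_\xi^*S_\eta=(\xi|\eta)_A$, and $a=i_K(\phi(a))$ whenever $\phi(a)\in\mathcal K(X_\gamma)$, where $i_K(\theta_{\xi,\eta})=S_\xi S_\eta^*$. The core $\mathcal F^{(\infty)}$ is the fixed point algebra of the gauge action $\beta_z(a)=a$, $\beta_z(S_\xi)=zS_\xi$ $(|z|=1)$ on $\mathcal O_\gamma$. For $r\ge0$ identify $\mathcal K(X_\gamma^{\otimes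 r})$ with the closed linear span in $\mathcal O_\gamma$ of the elements $S_{\xi_1}\cdots S_{\xi_r}\,a\,S_{\eta_r}^*\cdots S_{\eta_1}^*$ (for $r=0$ this is $A$), and put $\mathcal F^{(n)}=A+\mathcal K(X_\gamma)+\cdots+\mathcal K(X_\gamma^{\otimes n})\subset\mathcal F^{(\infty)}$. Let $\Pi^{(n)}:\mathcal F^{(n)}\to M_{N^n}(A)$ be the matrix representation: the bounded linear map sending $S_{\xi_1}\cdots S_{\xi_r}aS_{\eta_r}^*\cdots S_{\eta_1}^*$, $r\le n$, to the matrix function with entry, for $p,q\in\Sigma^n$, $$\delta_{(p_{r+1},\dots,p_n),(q_{r+1},\dots,q_n)}\ \Big(\prod_{k=1}^r\xi_k(x^p_{k-1},x^p_k)\Big)\,a(x^p_r)\,\overline{\prod_{k=1}^r\eta_k(x^q_{k-1},x^q_k)},\qquad x^p_k=\gamma_{p_{k+1}}\circ\cdots\circ\gamma_{p_n}(x),$$ at $x\in K$. For $b\in B_\gamma$ and $n\ge0$ let $J^{(b,n,n)}=\{T\in\mathcal F^{(n)}:\Pi^{(n)}(T)(b)=0\}$, $J^{(b,n,m)}=J^{(b,n,n)}+\mathcal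 K(X_\gamma^{\otimes(n+1)})+\cdots+\mathcal K(X_\gamma^{\otimes m})$ for $m>n$, and let $\overline J^{(b,n)}$ be the norm closure of $\bigcup_{m>n}J^{(b,n,m)}$. For a closed two-sided ideal $I$ of $\mathcal F^{(\infty)}$ let $F_0^I=\{x\in K: a(x)=0\text{ for all }a\in I\cap C(K)\}$. Then: 1. Every closed two-sided ideal $I$ of $\mathcal F^{(\infty)}$ is determined by $I\cap C(K)$, that is, by $F_0^I$: if $I\cap C(K)=I'\cap C(K)$, or if $F_0^I=F_0^{I'}$, then $I=I'$. 2. The sets $F_0^I$, for $I$ a closed two-sided ideal of $\mathcal F^{(\infty)}$, are exactly $\emptyset$, $K$, and the finite unions $\bigcup_{(b,r)\in s}O_{b,r}$ with $s\subset B_\gamma\times\{0,1,2,\dots\}$ finite. 3. For a closed two-sided ideal $I$: $F_0^I=\emptyset$ if and only if $I=\mathcal F^{(\infty)}$; $F_0^I=K$ if and only if $I=0$; and, for every finite $s\subset B_\gamma\times\{0,1,2,\dots\}$, $F_0^I=\bigcup_{(b,r)\in s}O_{b,r}$ if and only if $I=\bigcap_{(b,r)\in s}\overline J^{(b,r)}$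 (the empty intersection being $\mathcal F^{(\infty)}$). -/

import Mathlib

open scoped ENNReal

universe u

noncomputable section

namespace SelfSimilarCore

/-! ### Self-similar maps, branch points and orbits -/

section Dynamics

variable {K : Type u} [MetricSpace K] {N : ℕ}

/-- A proper contraction: `c' d(x,y) ≤ d(f x, f y) ≤ c d(x,y)` with `0 < c' ≤ c < 1`. -/
def IsProperContraction (f : K → K) : Prop :=
  ∃ c' c : ℝ, 0 < c' ∧ c' ≤ c ∧ c < 1 ∧
    ∀ x y : K, c' * dist x y ≤ dist (f x) (f y) ∧ dist (f x) (f y) ≤ c * dist x y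

/-- `γ = (γ_1, …, γ_N)` is a self-similar map on `K`: each `γ_j` is a proper contraction and
`K = ⋃ j, γ_j(K)`. -/
structure IsSelfSimilarMap (γ : Fin N → C(K, K)) : Prop where
  contraction : ∀ j, IsProperContraction (γ j)
  cover : (⋃ j, Set.range (γ j)) = Set.univ

/-- The branch set `B_γ`. -/
def branchSet (γ : Fin N → C(K, K)) : Set K :=
  {b | ∃ (a : K) (i j : Fin N), i ≠ j ∧ b = γ i a ∧ b = γ j a}

/-- For a word `w = [j₁, …, jₖ]`, the point `γ_{j₁}(γ_{j₂}(⋯ γ_{jₖ}(x)))`. -/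
def wordMap (γ : Fin N → C(K, K)) (w : List (Fin N)) (x : K) : K :=
  w.foldr (fun j y => γ j y) x

theorem continuous_wordMap (γ : Fin N → C(K, K)) (w : List (Fin N)) :
    Continuous (wordMap γ w) := by
  induction w with
  | nil => exact continuous_id
  | cons j w ih => exact (γ j).continuous.comp ih

/-- The postcritical set `P_γ`. -/
def postcriticalSet (γ : Fin N → C(K, K)) : Set K :=
  {a | ∃ w : List (Fin N), 1 ≤ w.length ∧ wordMap γ w a ∈ branchSet γ}

/-- The `k`-th orbit `O_{b,k} = {γ_{j₁} ∘ ⋯ ∘ γ_{jₖ} (b)}`; in particular `O_{b,0} = {b}`. -/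
def orbit (γ : Fin N → C(K, K)) (b : K) (k : ℕ) : Set K :=
  {x | ∃ w : List (Fin N), w.length = k ∧ wordMap γ w b = x}

/-- For `p = (p₁, …, pₙ)`, the point `γ_{p_{k+1}} ∘ ⋯ ∘ γ_{p_n} (x)`. -/
def tailPt (γ : Fin N → C(K, K)) {n : ℕ} (p : Fin n → Fin N) (k : ℕ) (x : K) : K :=
  wordMap γ ((List.ofFn p).drop k) x

theorem continuous_tailPt (γ : Fin N → C(K, K)) {n : ℕ} (p : Fin n → Fin N) (k : ℕ) :
    Continuous (tailPt γ p k) := continuous_wordMap γ _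

/-- Assumption B. -/
structure AssumptionB (γ : Fin N → C(K, K)) : Prop where
  exists_inverse : ∃ h : C(K, K), ∀ j y, h (γ j y) = y
  finite_branchSet : (branchSet γ).Finite
  disjoint_postcritical : branchSet γ ∩ postcriticalSet γ = ∅

end Dynamics

/-! ### The correspondence `X_γ` over `C(K)` -/

section Correspondence

variable {K : Type u} [MetricSpace K] [CompactSpace K] {N : ℕ}

/-- The cograph `𝒞_γ = {(γ_j(y), y)}`. -/
def cograph (γ : Fin N → C(K, K)) : Set (K × K) :=
  {p | ∃ (j : Fin N) (y : K), p = (γ j y, y)}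

instance (γ : Fin N → C(K, K)) : CompactSpace (cograph γ) := by
  have h : cograph γ = ⋃ j, Set.range (fun y => (γ j y, y)) := by
    ext p
    simp only [cograph, Set.mem_ofPred_eq, Set.mem_iUnion, Set.mem_range, eq_comm]
  rw [← isCompact_iff_compactSpace, h]
  exact isCompact_iUnion fun j => isCompact_range (by fun_prop)

/-- The continuous map `y ↦ (γ_j(y), y)` into the cograph. -/
def cographPt (γ : Fin N → C(K, K)) (j : Fin N) : C(K, cograph γ) :=
  ⟨fun y => ⟨(γ j y, y), j, y, rfl⟩, by fun_prop⟩

/-- The space `X_γ = C(𝒞_γ)`. Its norm as a Lean type is the supremum norm, which is equivalent to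
the Hilbert module norm `‖(ξ|ξ)_A‖^(1/2)`. -/
abbrev Corr (γ : Fin N → C(K, K)) : Type u := C(cograph γ, ℂ)

/-- The function `(x, y) ↦ a(x)` on the cograph. -/
def fstPull (γ : Fin N → C(K, K)) (a : C(K, ℂ)) : Corr γ :=
  a.comp ⟨fun p => p.1.1, by fun_prop⟩

/-- The function `(x, y) ↦ a(y)` on the cograph. -/
def sndPull (γ : Fin N → C(K, K)) (a : C(K, ℂ)) : Corr γ :=
  a.comp ⟨fun p => p.1.2, by fun_prop⟩

/-- The left action `φ(a) : ξ ↦ a · ξ`, `(a · ξ)(x, y) = a(x) ξ(x, y)`, as an operator on `X_γ`. -/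
def leftAct (γ : Fin N → C(K, K)) (a : C(K, ℂ)) : Corr γ →L[ℂ] Corr γ :=
  ContinuousLinearMap.mul ℂ (Corr γ) (fstPull γ a)

/-- The right action `(ξ · a)(x, y) = ξ(x, y) a(y)`. -/
def rightAct (γ : Fin N → C(K, K)) (ξ : Corr γ) (a : C(K, ℂ)) : Corr γ :=
  ξ * sndPull γ a

/-- The inner product `(ξ|η)_A(y) = ∑ j, conj(ξ(γ_j(y), y)) η(γ_j(y), y)`. -/
def innerA (γ : Fin N → C(K, K)) (ξ η : Corr γ) : C(K, ℂ) :=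
  ∑ j, star (ξ.comp (cographPt γ j)) * η.comp (cographPt γ j)

/-- The rank one operator `θ_{ξ,η}(ζ) = ξ · (η|ζ)_A`. -/
def rankOne (γ : Fin N → C(K, K)) (ξ η : Corr γ) : Corr γ →L[ℂ] Corr γ where
  toFun ζ := rightAct γ ξ (innerA γ η ζ)
  map_add' ζ ζ' := by
    ext p
    simp [rightAct, sndPull, innerA, mul_add, Finset.sum_add_distrib]
  map_smul' c ζ := by
    ext p
    simp only [rightAct, sndPull, innerA, ContinuousMap.mul_apply, ContinuousMap.comp_apply,
      ContinuousMap.sum_apply, ContinuousMap.smul_apply, smul_eq_mul, RingHom.id_apply,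
      Finset.mul_sum]
    exact Finset.sum_congr rfl fun j _ => by ring
  cont := by
    have h : Continuous fun ζ : Corr γ => innerA γ η ζ := by
      unfold innerA
      exact continuous_finsetSum _ fun j _ =>
        continuous_const.mul (ContinuousMap.continuous_precomp _)
    exact continuous_const.mul ((ContinuousMap.continuous_precomp _).comp h)

/-- The "compact" operators `𝒦(X_γ)`: the closed linear span of the rank one operators. (The
operator norm here is computed from an equivalent norm on `X_γ`, which gives the same closure.) -/
def compactOps (γ : Fin N → C(K, K)) : Submodule ℂ (Corr γ →L[ℂ] Corr γ) :=
  (Submodule.span ℂ {T | ∃ ξ η, T = rankOne γ ξ η}).topologicalClosure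

theorem rankOne_mem (γ : Fin N → C(K, K)) (ξ η : Corr γ) : rankOne γ ξ η ∈ compactOps γ :=
  Submodule.le_topologicalClosure _ (Submodule.subset_span ⟨ξ, η, rfl⟩)

end Correspondence

/-! ### The Cuntz–Pimsner algebra `𝒪_γ` and its gauge action -/

section CuntzPimsner

variable {K : Type u} [MetricSpace K] [CompactSpace K] {N : ℕ}

/-- A covariant representation `(i, S)` of the correspondence `X_γ` in a (nonzero, unital)
C*-algebra `B`. The last field says `i(a) = i_K(φ(a))` for `a ∈ J_X = φ⁻¹(𝒦(X_γ))`, where `i_K` is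
the bounded linear map on `𝒦(X_γ)` with `i_K(θ_{ξ,η}) = S_ξ S_η^*`. -/
structure CovRep (γ : Fin N → C(K, K)) : Type (u + 1) where
  B : Type u
  [cstar : CStarAlgebra B]
  [nontriv : Nontrivial B]
  i : C(K, ℂ) →⋆ₐ[ℂ] B
  S : Corr γ →ₗ[ℂ] B
  map_left : ∀ a ξ, i a * S ξ = S (leftAct γ a ξ)
  map_right : ∀ ξ a, S ξ * i a = S (rightAct γ ξ a)
  map_inner : ∀ ξ η, star (S ξ) * S η = i (innerA γ ξ η)
  covariant : ∃ iK : compactOps γ →L[ℂ] B,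
    (∀ ξ η, iK ⟨rankOne γ ξ η, rankOne_mem γ ξ η⟩ = S ξ * star (S η)) ∧
    ∀ (a : C(K, ℂ)) (ha : leftAct γ a ∈ compactOps γ), i a = iK ⟨leftAct γ a, ha⟩

attribute [instance] CovRep.cstar CovRep.nontriv

theorem mul_star_circle (z : Circle) : (z : ℂ) * star (z : ℂ) = 1 := by
  simp [Complex.mul_conj]

/-- The representation `(i, z S)`, for `z` in the unit circle. -/
abbrev CovRep.twist {γ : Fin N → C(K, K)} (ρ : CovRep γ) (z : Circle) : CovRep γ where
  B := ρ.B
  i := ρ.i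
  S := (z : ℂ) • ρ.S
  map_left a ξ := by
    rw [LinearMap.smul_apply, LinearMap.smul_apply, mul_smul_comm, ρ.map_left]
  map_right ξ a := by
    rw [LinearMap.smul_apply, LinearMap.smul_apply, smul_mul_assoc, ρ.map_right]
  map_inner ξ η := by
    rw [LinearMap.smul_apply, LinearMap.smul_apply, star_smul, smul_mul_smul_comm, ρ.map_inner,
      mul_comm, mul_star_circle, one_smul]
  covariant := by
    obtain ⟨iK, h1, h2⟩ := ρ.covariant
    refine ⟨iK, fun ξ η => ?_, h2⟩
    rw [LinearMap.smul_apply, LinearMap.smul_apply, star_smul, smul_mul_smul_comm, h1,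
      mul_star_circle, one_smul]

theorem CovRep.norm_S_le {γ : Fin N → C(K, K)} (ρ : CovRep γ) (ξ : Corr γ) :
    ‖ρ.S ξ‖ ≤ Real.sqrt ‖innerA γ ξ ξ‖ := by
  refine Real.le_sqrt_of_sq_le ?_
  rw [sq, ← CStarRing.norm_star_mul_self, ρ.map_inner]
  exact NonUnitalStarAlgHom.norm_apply_le ρ.i _

/-- The C*-algebra of all bounded families indexed by the covariant representations of `X_γ`. -/
abbrev RepProd (γ : Fin N → C(K, K)) : Type (u + 1) := lp (fun ρ : CovRep γ => ρ.B) ∞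

/-- The family `(i_ρ(a))_ρ`. -/
def univI (γ : Fin N → C(K, K)) (a : C(K, ℂ)) : RepProd γ :=
  ⟨fun ρ => ρ.i a, memℓp_infty ⟨‖a‖, by
    rintro _ ⟨ρ, rfl⟩
    exact NonUnitalStarAlgHom.norm_apply_le ρ.i a⟩⟩

/-- The family `(S_ρ(ξ))_ρ`. -/
def univS (γ : Fin N → C(K, K)) (ξ : Corr γ) : RepProd γ :=
  ⟨fun ρ => ρ.S ξ, memℓp_infty ⟨Real.sqrt ‖innerA γ ξ ξ‖, by
    rintro _ ⟨ρ, rfl⟩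
    exact ρ.norm_S_le ξ⟩⟩

/-- The generators of `𝒪_γ`. -/
def gens (γ : Fin N → C(K, K)) : Set (RepProd γ) := Set.range (univI γ) ∪ Set.range (univS γ)

/-- The Cuntz–Pimsner algebra `𝒪_γ`: the universal C*-algebra generated by a covariant
representation of `X_γ`, realized as the C*-algebra generated by the families `(i_ρ(a))_ρ` and
`(S_ρ(ξ))_ρ`, where `ρ` runs over all covariant representations. -/
def cuntzPimsner (γ : Fin N → C(K, K)) : StarSubalgebra ℂ (RepProd γ) :=
  (StarAlgebra.adjoin ℂ (gens γ)).topologicalClosure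

/-- The generator `i(a)` of `𝒪_γ`. -/
def opI (γ : Fin N → C(K, K)) (a : C(K, ℂ)) : cuntzPimsner γ :=
  ⟨univI γ a, StarSubalgebra.le_topologicalClosure _
    (StarAlgebra.subset_adjoin ℂ _ (Or.inl ⟨a, rfl⟩))⟩

/-- The generator `S_ξ` of `𝒪_γ`. -/
def opS (γ : Fin N → C(K, K)) (ξ : Corr γ) : cuntzPimsner γ :=
  ⟨univS γ ξ, StarSubalgebra.le_topologicalClosure _
    (StarAlgebra.subset_adjoin ℂ _ (Or.inr ⟨ξ, rfl⟩))⟩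

/-- Every covariant representation factors through `𝒪_γ`. -/
theorem exists_lift (γ : Fin N → C(K, K)) (ρ : CovRep γ) :
    ∃ π : cuntzPimsner γ →⋆ₐ[ℂ] ρ.B,
      (∀ a, π (opI γ a) = ρ.i a) ∧ ∀ ξ, π (opS γ ξ) = ρ.S ξ :=
  ⟨{ toFun := fun T => T.1 ρ
     map_one' := rfl
     map_mul' := fun _ _ => rfl
     map_zero' := rfl
     map_add' := fun _ _ => rfl
     commutes' := fun _ => rfl
     map_star' := fun _ => rfl }, fun _ => rfl, fun _ => rfl⟩

/-- Reindexing of families along `ρ ↦ ρ.twist z`. -/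
def twistProd (γ : Fin N → C(K, K)) (z : Circle) : RepProd γ →⋆ₐ[ℂ] RepProd γ where
  toFun T := ⟨fun ρ => T (ρ.twist z), memℓp_infty ⟨‖T‖, by
    rintro _ ⟨ρ, rfl⟩
    exact lp.norm_apply_le_norm ENNReal.top_ne_zero T (ρ.twist z)⟩⟩
  map_one' := rfl
  map_mul' _ _ := rfl
  map_zero' := rfl
  map_add' _ _ := rfl
  commutes' _ := rfl
  map_star' _ := rfl

theorem twistProd_univI (γ : Fin N → C(K, K)) (z : Circle) (a : C(K, ℂ)) :
    twistProd γ z (univI γ a) = univI γ a := rfl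

theorem twistProd_univS (γ : Fin N → C(K, K)) (z : Circle) (ξ : Corr γ) :
    twistProd γ z (univS γ ξ) = (z : ℂ) • univS γ ξ := rfl

theorem continuous_twistProd (γ : Fin N → C(K, K)) (z : Circle) : Continuous (twistProd γ z) := by
  refine AddMonoidHomClass.continuous_of_bound (twistProd γ z) 1 fun T => ?_
  rw [one_mul]
  refine lp.norm_le_of_forall_le (norm_nonneg T) fun ρ => ?_
  exact lp.norm_apply_le_norm ENNReal.top_ne_zero T (ρ.twist z)

theorem twistProd_mem (γ : Fin N → C(K, K)) (z : Circle) {T : RepProd γ}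
    (hT : T ∈ cuntzPimsner γ) : twistProd γ z T ∈ cuntzPimsner γ := by
  have h : StarAlgebra.adjoin ℂ (gens γ) ≤
      (StarAlgebra.adjoin ℂ (gens γ)).comap (twistProd γ z) := by
    refine StarAlgebra.adjoin_le ?_
    rintro _ (⟨a, rfl⟩ | ⟨ξ, rfl⟩)
    · exact StarAlgebra.subset_adjoin ℂ _ (Or.inl ⟨a, rfl⟩)
    · change twistProd γ z (univS γ ξ) ∈ StarAlgebra.adjoin ℂ (gens γ)
      rw [twistProd_univS]
      exact SMulMemClass.smul_mem _ (StarAlgebra.subset_adjoin ℂ _ (Or.inr ⟨ξ, rfl⟩))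
  exact map_mem_closure (continuous_twistProd γ z) hT fun x hx => h hx

/-- The gauge action on `𝒪_γ`: `β_z(i(a)) = i(a)` and `β_z(S_ξ) = z S_ξ` for `z` in the unit
circle. -/
def gauge (γ : Fin N → C(K, K)) (z : Circle) : cuntzPimsner γ →⋆ₐ[ℂ] cuntzPimsner γ where
  toFun T := ⟨twistProd γ z T, twistProd_mem γ z T.2⟩
  map_one' := rfl
  map_mul' _ _ := rfl
  map_zero' := rfl
  map_add' _ _ := rfl
  commutes' _ := rfl
  map_star' _ := rfl

theorem gauge_opI (γ : Fin N → C(K, K)) (z : Circle) (a : C(K, ℂ)) :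
    gauge γ z (opI γ a) = opI γ a := rfl

theorem gauge_opS (γ : Fin N → C(K, K)) (z : Circle) (ξ : Corr γ) :
    gauge γ z (opS γ ξ) = (z : ℂ) • opS γ ξ := rfl

/-- The core `ℱ^(∞)`: the fixed point algebra of the gauge action on `𝒪_γ`. -/
def core (γ : Fin N → C(K, K)) : StarSubalgebra ℂ (cuntzPimsner γ) where
  carrier := {T | ∀ z : Circle, gauge γ z T = T}
  mul_mem' ha hb z := by rw [map_mul, ha z, hb z]
  one_mem' z := map_one _
  add_mem' ha hb z := by rw [map_add, ha z, hb z]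
  zero_mem' z := map_zero _
  algebraMap_mem' c z := AlgHomClass.commutes _ c
  star_mem' ha z := by rw [map_star, ha z]

/-- The inclusion of the coefficient algebra `C(K)` in the core. -/
def coreI (γ : Fin N → C(K, K)) (a : C(K, ℂ)) : core γ := ⟨opI γ a, fun z => gauge_opI γ z a⟩

/-- The product `S_{ξ₁} S_{ξ₂} ⋯ S_{ξ_r}`, that is, `S_ξ` for `ξ = ξ₁ ⊗ ⋯ ⊗ ξ_r ∈ X_γ^{⊗ r}`. -/
def opWord (γ : Fin N → C(K, K)) {r : ℕ} (ξ : Fin r → Corr γ) : cuntzPimsner γ :=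
  (List.ofFn fun k => opS γ (ξ k)).prod

/-- The element `S_{ξ₁} ⋯ S_{ξ_r} i(a) S_{η_r}^* ⋯ S_{η₁}^*` of `𝒪_γ`, which is identified with the
rank one operator `θ_{ξ·a, η}` on `X_γ^{⊗ r}` (with `i(a)` if `r = 0`). -/
def elemOp (γ : Fin N → C(K, K)) {r : ℕ} (ξ η : Fin r → Corr γ) (a : C(K, ℂ)) : cuntzPimsner γ :=
  opWord γ ξ * opI γ a * star (opWord γ η)

/-- `𝒦(X_γ^{⊗ r})` as a subspace of `𝒪_γ`; for `r = 0` it is the coefficient algebra. -/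
def compactLevel (γ : Fin N → C(K, K)) (r : ℕ) : Submodule ℂ (cuntzPimsner γ) :=
  (Submodule.span ℂ {T | ∃ ξ η a, T = elemOp γ (r := r) ξ η a}).topologicalClosure

end CuntzPimsner

/-! ### The matrix representation `Π^(n)` and the model ideals -/

section Model

variable {K : Type u} [MetricSpace K] [CompactSpace K] {N : ℕ}

/-- With `x_k = γ_{p_{k+1}} ∘ ⋯ ∘ γ_{p_n}(x)`, the value
`ξ₁(x₀, x₁) ξ₂(x₁, x₂) ⋯ ξ_r(x_{r-1}, x_r)`: the component with index `(p₁, …, p_r)` of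
`ξ₁ ⊗ ⋯ ⊗ ξ_r`, regarded as an element of `C(K, ℂ^(N^r))`, at the point `x_r`. -/
def tensorCoord (γ : Fin N → C(K, K)) {n r : ℕ} (h : r ≤ n) (ξ : Fin r → Corr γ)
    (p : Fin n → Fin N) (x : K) : ℂ :=
  ∏ k : Fin r, ξ k (cographPt γ (p (Fin.castLE h k)) (tailPt γ p (k + 1) x))

theorem continuous_tensorCoord (γ : Fin N → C(K, K)) {n r : ℕ} (h : r ≤ n) (ξ : Fin r → Corr γ)
    (p : Fin n → Fin N) : Continuous (tensorCoord γ h ξ p) := by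
  unfold tensorCoord
  exact continuous_finsetProd _ fun k _ =>
    (ξ k).continuous.comp ((cographPt γ _).continuous.comp (continuous_tailPt γ p _))

/-- The matrix function `Ω^{(n,r)}(θ_{ξ·a, η}) = θ_{ξ·a, η} ⊗ I_{n-r}` in `M_{N^n}(C(K))`, with rows
and columns indexed by `Σ^n`: it is block diagonal, the block with index `(p_{r+1}, …, p_n)` at `x`
being the matrix of `θ_{ξ·a, η}` at the point `γ_{p_{r+1}} ∘ ⋯ ∘ γ_{p_n}(x)`. -/
def matrixOf (γ : Fin N → C(K, K)) {n r : ℕ} (h : r ≤ n) (ξ η : Fin r → Corr γ) (a : C(K, ℂ)) :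
    C(K, Matrix (Fin n → Fin N) (Fin n → Fin N) ℂ) where
  toFun x := Matrix.of fun p q =>
    if ∀ k : Fin n, r ≤ k.val → p k = q k then
      tensorCoord γ h ξ p x * a (tailPt γ p r x) * star (tensorCoord γ h η q x)
    else 0
  continuous_toFun := by
    refine continuous_matrix fun p q => ?_
    simp only [Matrix.of_apply]
    split_ifs
    · exact ((continuous_tensorCoord γ h ξ p).mul
        (a.continuous.comp (continuous_tailPt γ p r))).mul (continuous_tensorCoord γ h η q).star
    · exact continuous_const

/-- The graph of the matrix representation `Π^(n) : ℱ^(n) → M_{N^n}(C(K))`, where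
`ℱ^(n) = C(K) + 𝒦(X_γ) + ⋯ + 𝒦(X_γ^{⊗ n})`: the closed subspace spanned by the pairs
`(θ_{ξ·a, η}, Ω^{(n,r)}(θ_{ξ·a, η}))` with `0 ≤ r ≤ n`. -/
def matrixGraph (γ : Fin N → C(K, K)) (n : ℕ) :
    Submodule ℂ (cuntzPimsner γ × C(K, Matrix (Fin n → Fin N) (Fin n → Fin N) ℂ)) :=
  (Submodule.span ℂ {P | ∃ (r : ℕ) (h : r ≤ n) (ξ η : Fin r → Corr γ) (a : C(K, ℂ)),
    P = (elemOp γ ξ η a, matrixOf γ h ξ η a)}).topologicalClosure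

/-- `J^{(b,n,n)} = {T ∈ ℱ^(n) | Π^(n)(T)(b) = 0}`. -/
def modelBase (γ : Fin N → C(K, K)) (b : K) (n : ℕ) : Submodule ℂ (cuntzPimsner γ) where
  carrier := {T | ∃ M, (T, M) ∈ matrixGraph γ n ∧ M b = 0}
  add_mem' := by
    rintro T T' ⟨M, hM, h⟩ ⟨M', hM', h'⟩
    exact ⟨M + M', add_mem hM hM', by simp [h, h']⟩
  zero_mem' := ⟨0, zero_mem _, rfl⟩
  smul_mem' := by
    rintro c T ⟨M, hM, h⟩
    exact ⟨c • M, Submodule.smul_mem _ c hM, by simp [h]⟩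

/-- `J^{(b,n,m)} = J^{(b,n,n)} + 𝒦(X_γ^{⊗ (n+1)}) + ⋯ + 𝒦(X_γ^{⊗ m})`. -/
def modelLevel (γ : Fin N → C(K, K)) (b : K) (n m : ℕ) : Submodule ℂ (cuntzPimsner γ) :=
  modelBase γ b n ⊔ ⨆ k ∈ Finset.Ioc n m, compactLevel γ k

/-- The model ideal `J̄^{(b,n)}`, the norm closure of `⋃_{m > n} J^{(b,n,m)}`. -/
def modelIdeal (γ : Fin N → C(K, K)) (b : K) (n : ℕ) : Set (cuntzPimsner γ) :=
  closure (⋃ m > n, (modelLevel γ b n m : Set (cuntzPimsner γ)))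

/-- The closed subset `F_0^I = {x ∈ K | a(x) = 0 for all a ∈ I ∩ C(K)}` of `K`. -/
def zeroSet (γ : Fin N → C(K, K)) (I : TwoSidedIdeal (core γ)) : Set K :=
  {x | ∀ a : C(K, ℂ), coreI γ a ∈ I → a x = 0}

end Model

end SelfSimilarCore

end

open SelfSimilarCore

noncomputable section

set_option linter.unusedSectionVars false

namespace SelfSimilarCore

/-! ### General facts on C*-algebras -/

section CStar

variable {A : Type*} [CStarAlgebra A]

open scoped CStarAlgebra

attribute [local instance] CStarAlgebra.spectralOrder CStarAlgebra.spectralOrderedRing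

/-! The branch points are treated as roots of forward trees. By Assumption B(3) no image of a tree
point is a branch point, so on the union of the trees (`goodSet`) the maps γ_j have disjoint images,
words act freely, and the finite sets O_{b,r} are pairwise disjoint. The formula S_ξ δ_y = Σ_j
ξ(γ_j(y), y) δ_{γ_j(y)} defines a representation on ℓ²(`goodSet`). It is covariant: all S_ξ^* kill
the root vectors, and if φ(a) is compact then a vanishes at the branch points. The core is the
closed span of the monomials e f* with e and f words of equal length, so it preserves each
finite-dimensional space ℓ²(O_{b,r}); the kernel of this action is a closed ideal with zero set
O_{b,r}. The heart of the theorem is that every nonzero closed ideal is a finite intersection of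
such kernels. (Without branch points `goodSet` is all of K, there are no levels, and the only closed
ideals are the trivial ones.)

Climbing one level. A function vanishing on the branch set is a limit of functions acting by compact
operators, so a core element killing all roots is a limit of monomials of positive length
(`IsAdmissible.exists_posSpan_near`). Such an element lies in a closed ideal I as soon as its
compressions S_ξ^* T S_η, carried back into the core by a fixed isometry v of degree one, lie in I
(`IsAdmissible.mem_ambient_of_compress`). Level r + 1 of T is governed by level r of these
compressions (`IsAdmissible.kills_succ_iff`). If v^M v^{*M} ∈ I, then the ideal {R : v R v* ∈ I}
contains v^{M-1} v^{*(M-1)}, and induction on M gives I as the intersection of the level kernels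
containing it (`IsAdmissible.mem_ambient_of_forall_kills`). Only levels r < M can occur.

Starting the induction. A nonzero ideal contains some v^M v^{*M}
(`IsAdmissible.exists_isom_pow_mem`). Compressions separate core elements: a branch point γ_i(c) =
γ_j(c) is approached by pairs γ_i(y), γ_j(y) of tree points, on which compressions see a root value
(`IsAdmissible.eq_zero_of_compress`). A spectral cutoff then yields a word vector compressing an
element of the ideal close to a function a that is large at some point x₀. Since the maps contract,
a further word isometry u makes u* a u nearly the scalar a(x₀), and a Neumann series inverts the
result.

Zero sets are then finite unions of disjoint orbits in the infinite space K, hence determine the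
index set and differ from K. Finally, the matrix Π^{(n)}(T)(b) is the matrix of T on ℓ²(O_{b,n}),
and longer compact operators vanish there; so the model ideals consist, inside the core, of the
elements vanishing on the level (`IsAdmissible.mem_modelIdeal_iff`). -/

/-- A closed two-sided ideal containing `x* x` contains `x`. -/
theorem mem_of_star_mul_self_mem (I : TwoSidedIdeal A) (hI : IsClosed (I : Set A)) {x : A}
    (hx : star x * x ∈ I) : x ∈ I := by
  set h : A := star x * x with hh
  have h0 : 0 ≤ h := star_mul_self_nonneg x
  have hsa : IsSelfAdjoint h := .of_nonneg h0
  -- The approximant is x·h(h + ε)⁻¹. The squared error is the norm of the functional calculus of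
  -- ε²t/(t + ε)², which is at most ε.
  have key : ∀ ε : ℝ, 0 < ε → ∃ y ∈ I, ‖x - y‖ ^ 2 ≤ ε := by
    intro ε hε
    have hpos : ∀ t ∈ spectrum ℝ h, 0 ≤ t := fun t ht => spectrum_nonneg_of_nonneg h0 ht
    have hc1 : ContinuousOn (fun t : ℝ => (t + ε)⁻¹) (spectrum ℝ h) :=
      ContinuousOn.inv₀ (by fun_prop) fun t ht => by have := hpos t ht; positivity
    have hc2 : ContinuousOn (fun t : ℝ => ε * (t + ε)⁻¹) (spectrum ℝ h) :=
      continuousOn_const.mul hc1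
    set r : A := cfc (fun t : ℝ => (t + ε)⁻¹) h with hr
    set e : A := cfc (fun t : ℝ => ε * (t + ε)⁻¹) h with he
    have hesa : star e = e := (cfc_predicate (R := ℝ) (fun t : ℝ => ε * (t + ε)⁻¹) h).star_eq
    have h1 : 1 - h * r = e := by
      have : h * r = cfc (fun t : ℝ => t * (t + ε)⁻¹) h := by
        rw [hr, cfc_mul (fun t : ℝ => t) _ h (by fun_prop) hc1, cfc_id' ℝ h]
      rw [this, ← cfc_one ℝ h, ← cfc_sub _ _ h (by fun_prop) (by fun_prop), he]
      refine cfc_congr fun t ht => ?_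
      have : t + ε ≠ 0 := by have := hpos t ht; positivity
      simp only [Pi.one_apply]
      field_simp
      ring
    refine ⟨x * (h * r), I.mul_mem_left _ _ (I.mul_mem_right _ _ hx), ?_⟩
    have h2 : x - x * (h * r) = x * e := by rw [← h1, mul_sub, mul_one]
    rw [h2, sq, ← CStarRing.norm_star_mul_self, star_mul, hesa, mul_assoc, ← mul_assoc (star x),
      ← hh]
    have h3 : e * (h * e) = cfc (fun t : ℝ => ε * (t + ε)⁻¹ * (t * (ε * (t + ε)⁻¹))) h := by
      rw [cfc_mul _ _ h hc2 (by fun_prop), cfc_mul (fun t : ℝ => t) _ h (by fun_prop) hc2,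
        cfc_id' ℝ h]
    rw [h3]
    refine norm_cfc_le hε.le fun t ht => ?_
    have ht0 := hpos t ht
    have h4 : 0 < t + ε := by positivity
    rw [Real.norm_of_nonneg (by positivity)]
    have h5 : t * (t + ε)⁻¹ ≤ 1 := by
      rw [← div_eq_mul_inv, div_le_one h4]; linarith
    have h6 : ε * (t + ε)⁻¹ ≤ 1 := by
      rw [← div_eq_mul_inv, div_le_one h4]; linarith
    calc ε * (t + ε)⁻¹ * (t * (ε * (t + ε)⁻¹)) = ε * ((ε * (t + ε)⁻¹) * (t * (t + ε)⁻¹)) := by ring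
      _ ≤ ε * (1 * 1) := by gcongr
      _ = ε := by ring
  have : x ∈ closure (I : Set A) := by
    refine Metric.mem_closure_iff.2 fun ε hε => ?_
    obtain ⟨y, hy, hxy⟩ := key ((ε / 2) ^ 2) (by positivity)
    refine ⟨y, hy, ?_⟩
    rw [dist_eq_norm]
    have := abs_le_of_sq_le_sq hxy (by positivity)
    have := (le_abs_self _).trans this
    linarith
  rwa [hI.closure_eq] at this

/-- For `S = s* s` and `c < ‖S‖` there is a nonzero spectral cutoff `R` of `S` on whose range `S`
is bounded below by `c`. -/
theorem exists_spectral_cutoff [Nontrivial A] (s : A) {c : ℝ} (hc0 : 0 ≤ c)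
    (hc : c < ‖star s * s‖) :
    ∃ R ∈ StarAlgebra.elemental ℝ (star s * s), R ≠ 0 ∧
      ∀ w : A, c * ‖R * w‖ ≤ ‖star s * s * (R * w)‖ := by
  set h : A := star s * s with hh
  have h0 : 0 ≤ h := star_mul_self_nonneg s
  have hsa : IsSelfAdjoint h := .of_nonneg h0
  have hcont : Continuous (fun t : ℝ => max 0 (t - c)) := by fun_prop
  refine ⟨cfc (fun t : ℝ => max 0 (t - c)) h, cfc_mem_elemental _ _, ?_, fun w => ?_⟩
  · intro hzero
    have := norm_apply_le_norm_cfc (fun t : ℝ => max 0 (t - c)) h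
      (CStarAlgebra.norm_mem_spectrum_of_nonneg h0) hcont.continuousOn hsa
    rw [hzero, norm_zero, norm_le_zero_iff] at this
    rw [max_eq_right (by linarith)] at this
    linarith
  · set R : A := cfc (fun t : ℝ => max 0 (t - c)) h with hR
    have hRsa : star R = R := (cfc_predicate (R := ℝ) (fun t : ℝ => max 0 (t - c)) h).star_eq
    have hhR : h * R = cfc (fun t : ℝ => t * max 0 (t - c)) h := by
      rw [hR, cfc_mul (fun t : ℝ => t) _ h (by fun_prop) (by fun_prop), cfc_id' ℝ h]
    have hhsa : star (h * R) = h * R := by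
      rw [hhR]; exact (cfc_predicate (R := ℝ) (fun t : ℝ => t * max 0 (t - c)) h).star_eq
    -- The cutoff max(0, t - c) vanishes for t ≤ c, so (c·R)² ≤ (h·R)² holds pointwise on the
    -- spectrum.
    have hle : (c • R) * (c • R) ≤ (h * R) * (h * R) := by
      rw [hhR, hR, ← cfc_smul c _ h (by fun_prop), ← cfc_mul _ _ h (by fun_prop) (by fun_prop),
        ← cfc_mul _ _ h (by fun_prop) (by fun_prop)]
      refine cfc_mono fun t ht => ?_
      have ht0 : 0 ≤ t := spectrum_nonneg_of_nonneg h0 ht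
      simp only [smul_eq_mul]
      rcases le_total t c with h1 | h1
      · simp [max_eq_left (sub_nonpos.2 h1)]
      · have h2 : 0 ≤ max 0 (t - c) := le_max_left _ _
        gcongr
    have hle2 := star_left_conjugate_le_conjugate hle w
    have e1 : star w * ((c • R) * (c • R)) * w = star (c • (R * w)) * (c • (R * w)) := by
      rw [star_smul, star_mul, hRsa, star_trivial c]
      simp only [mul_assoc, smul_mul_assoc, mul_smul_comm]
    have e2 : star w * ((h * R) * (h * R)) * w = star (h * (R * w)) * (h * (R * w)) := by
      rw [← mul_assoc h R w, star_mul, hhsa]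
      simp only [mul_assoc]
    rw [e1, e2] at hle2
    have h3 := CStarAlgebra.norm_le_norm_of_nonneg_of_le (star_mul_self_nonneg _) hle2
    rw [CStarRing.norm_star_mul_self, CStarRing.norm_star_mul_self, ← sq, ← sq] at h3
    have h4 := abs_le_of_sq_le_sq h3 (norm_nonneg _)
    rwa [abs_norm, norm_smul, Real.norm_of_nonneg hc0] at h4

end CStar

/-! ### C*-algebra structures -/

section Instances

variable {K : Type u} [MetricSpace K] [CompactSpace K] {N : ℕ} (γ : Fin N → C(K, K))

instance : CStarAlgebra (RepProd γ) where

instance : IsClosed (cuntzPimsner γ : Set (RepProd γ)) :=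
  StarSubalgebra.isClosed_topologicalClosure _

instance : CStarAlgebra (cuntzPimsner γ) := StarSubalgebra.cstarAlgebra (cuntzPimsner γ)

theorem continuous_gauge (z : Circle) : Continuous (gauge γ z) :=
  Continuous.subtype_mk ((continuous_twistProd γ z).comp continuous_subtype_val) _

instance isClosed_core : IsClosed (core γ : Set (cuntzPimsner γ)) := by
  have : (core γ : Set (cuntzPimsner γ)) = ⋂ z : Circle, {T | gauge γ z T = T} := by
    ext T
    rw [Set.mem_iInter]
    exact Iff.rfl
  rw [this]
  exact isClosed_iInter fun z => isClosed_eq (continuous_gauge γ z) continuous_id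

instance : CStarAlgebra (core γ) := StarSubalgebra.cstarAlgebra (core γ)

end Instances

/-! ### Interpolation -/

section Interpolation

variable {K : Type u} [MetricSpace K]

theorem exists_bump {F : Set K} (hF : F.Finite) (x : K) :
    ∃ f : C(K, ℂ), f x = 1 ∧ (∀ y ∈ F, y ≠ x → f y = 0) ∧ ∀ y, ‖f y‖ ≤ 1 := by
  obtain ⟨f, h0, h1, hf⟩ := exists_continuous_zero_one_of_isClosed
    (s := F \ {x}) (t := {x}) (hF.sdiff).isClosed isClosed_singleton (by simp)
  refine ⟨⟨fun y => (f y : ℂ), by fun_prop⟩, ?_, fun y hy hyx => ?_, fun y => ?_⟩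
  · simpa using h1 (Set.mem_singleton x)
  · simpa using h0 ⟨hy, hyx⟩
  · simpa [abs_of_nonneg (hf y).1] using (hf y).2

theorem exists_interpolation {F : Set K} (hF : F.Finite) (φ : K → ℂ) :
    ∃ f : C(K, ℂ), ∀ x ∈ F, f x = φ x := by
  choose f h1 h0 _ using fun x : K => exists_bump hF x
  refine ⟨∑ x ∈ hF.toFinset, φ x • f x, fun y hy => ?_⟩
  rw [ContinuousMap.sum_apply, Finset.sum_eq_single_of_mem y (hF.mem_toFinset.2 hy)]
  · simp [h1]
  · intro x _ hxy
    simp [h0 x y hy hxy.symm]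

end Interpolation

/-! ### The dynamics -/

section Dynamics

variable {K : Type u} [MetricSpace K] {N : ℕ} {γ : Fin N → C(K, K)}

@[simp] theorem wordMap_nil (x : K) : wordMap γ [] x = x := rfl

@[simp] theorem wordMap_cons (j : Fin N) (w : List (Fin N)) (x : K) :
    wordMap γ (j :: w) x = γ j (wordMap γ w x) := rfl

/-- A common left inverse of the maps `γ_j`, the remaining parts of Assumption B, and the covering
property. -/
structure HasInverse (γ : Fin N → C(K, K)) (h : C(K, K)) : Prop where
  left_inv : ∀ j y, h (γ j y) = y
  finite : (branchSet γ).Finite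
  disj : branchSet γ ∩ postcriticalSet γ = ∅
  cover : ∀ x, ∃ j, γ j (h x) = x

theorem AssumptionB.hasInverse (hB : AssumptionB γ) (hγ : IsSelfSimilarMap γ) :
    ∃ h, HasInverse γ h := by
  obtain ⟨h, hh⟩ := hB.exists_inverse
  refine ⟨h, hh, hB.finite_branchSet, hB.disjoint_postcritical, fun x => ?_⟩
  have hx : x ∈ ⋃ j, Set.range (γ j) := hγ.cover ▸ Set.mem_univ x
  obtain ⟨j, y, rfl⟩ := Set.mem_iUnion.1 hx
  exact ⟨j, by rw [hh]⟩

/-- The union of the forward trees of the branch points, or the whole space if there are no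
branch points. -/
def goodSet (γ : Fin N → C(K, K)) : Set K :=
  {x | branchSet γ = ∅ ∨ ∃ b ∈ branchSet γ, ∃ w : List (Fin N), x = wordMap γ w b}

theorem branchSet_subset_goodSet : branchSet γ ⊆ goodSet γ :=
  fun b hb => Or.inr ⟨b, hb, [], rfl⟩

theorem map_mem_goodSet {x : K} (hx : x ∈ goodSet γ) (j : Fin N) : γ j x ∈ goodSet γ := by
  rcases hx with h | ⟨b, hb, w, rfl⟩
  · exact Or.inl h
  · exact Or.inr ⟨b, hb, j :: w, rfl⟩

theorem orbit_zero (b : K) : orbit γ b 0 = {b} := by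
  ext x
  constructor
  · rintro ⟨w, hw, rfl⟩
    rw [List.length_eq_zero_iff] at hw
    simp [hw]
  · rintro rfl
    exact ⟨[], rfl, rfl⟩

theorem mem_orbit_succ {b x : K} {r : ℕ} :
    x ∈ orbit γ b (r + 1) ↔ ∃ j, ∃ y ∈ orbit γ b r, γ j y = x := by
  constructor
  · rintro ⟨w, hw, rfl⟩
    cases w with
    | nil => simp at hw
    | cons j w => exact ⟨j, _, ⟨w, by simpa using hw, rfl⟩, rfl⟩
  · rintro ⟨j, _, ⟨w, hw, rfl⟩, rfl⟩
    exact ⟨j :: w, by simp [hw], rfl⟩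

theorem finite_orbit (b : K) (r : ℕ) : (orbit γ b r).Finite := by
  have : orbit γ b r = (fun w => wordMap γ w b) '' {w : List (Fin N) | w.length = r} := by
    ext x
    rfl
  rw [this]
  exact (List.finite_length_eq _ _).image _

theorem nonempty_orbit [NeZero N] (b : K) (r : ℕ) : (orbit γ b r).Nonempty :=
  ⟨_, List.replicate r 0, List.length_replicate, rfl⟩

theorem orbit_subset_goodSet {b : K} (hb : b ∈ branchSet γ) (r : ℕ) :
    orbit γ b r ⊆ goodSet γ := by
  rintro _ ⟨w, _, rfl⟩
  exact Or.inr ⟨b, hb, w, rfl⟩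

namespace HasInverse

variable {h : C(K, K)} (H : HasInverse γ h)

include H

/-- Otherwise the root of the tree containing x would be both a branch point and postcritical. -/
theorem map_notMem {x : K} (hx : x ∈ goodSet γ) (j : Fin N) : γ j x ∉ branchSet γ := by
  rcases hx with h | ⟨b, hb, w, rfl⟩
  · simp [h]
  · intro hmem
    have : b ∈ branchSet γ ∩ postcriticalSet γ := ⟨hb, j :: w, by simp, hmem⟩
    rw [H.disj] at this
    exact this

/-- Two different indices with the same image would make that image a branch point, which
`map_notMem` forbids. -/
theorem index_injective {x : K} (hx : x ∈ goodSet γ) {i j : Fin N} (hij : γ i x = γ j x) :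
    i = j := by
  by_contra hne
  exact H.map_notMem hx i ⟨x, i, j, hne, rfl, hij⟩

theorem map_injective {x y : K} {i j : Fin N} (hij : γ i x = γ j y) : x = y := by
  rw [← H.left_inv i x, hij, H.left_inv]

theorem inv_mem_goodSet {x : K} (hx : x ∈ goodSet γ) (hxB : x ∉ branchSet γ) :
    h x ∈ goodSet γ := by
  rcases hx with h0 | ⟨b, hb, w, rfl⟩
  · exact Or.inl h0
  · cases w with
    | nil => exact absurd hb hxB
    | cons j w => exact Or.inr ⟨b, hb, w, H.left_inv _ _⟩

/-- The common left inverse strips letters from both words simultaneously; neither can reach its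
root first, since roots are not images of tree points. -/
theorem orbit_disjoint {b b' x : K} (hb : b ∈ branchSet γ) (hb' : b' ∈ branchSet γ) {r r' : ℕ}
    (hx : x ∈ orbit γ b r) (hx' : x ∈ orbit γ b' r') : b = b' ∧ r = r' := by
  induction r generalizing x r' with
  | zero =>
    rw [orbit_zero] at hx
    obtain rfl : x = b := hx
    cases r' with
    | zero =>
      rw [orbit_zero] at hx'
      exact ⟨hx', rfl⟩
    | succ r' =>
      obtain ⟨j, y, hy, rfl⟩ := mem_orbit_succ.1 hx'
      exact absurd hb (H.map_notMem (orbit_subset_goodSet hb' _ hy) j)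
  | succ r ih =>
    obtain ⟨j, y, hy, rfl⟩ := mem_orbit_succ.1 hx
    cases r' with
    | zero =>
      rw [orbit_zero] at hx'
      obtain rfl : γ j y = b' := hx'
      exact absurd hb' (H.map_notMem (orbit_subset_goodSet hb _ hy) j)
    | succ r' =>
      obtain ⟨i, y', hy', he⟩ := mem_orbit_succ.1 hx'
      obtain rfl := H.map_injective he
      obtain ⟨h1, h2⟩ := ih hy hy'
      exact ⟨h1, by rw [h2]⟩

theorem exists_wordMap (k : ℕ) (x : K) :
    ∃ (w : List (Fin N)) (y : K), w.length = k ∧ wordMap γ w y = x := by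
  induction k generalizing x with
  | zero => exact ⟨[], x, rfl, rfl⟩
  | succ k ih =>
    obtain ⟨j, hj⟩ := H.cover x
    obtain ⟨w, y, hw, hy⟩ := ih (h x)
    exact ⟨j :: w, y, by simp [hw], by rw [wordMap_cons, hy, hj]⟩

theorem wordMap_injective {w w' : List (Fin N)} {x : K} (hx : x ∈ goodSet γ)
    (hl : w.length = w'.length) (hw : wordMap γ w x = wordMap γ w' x) : w = w' := by
  induction w generalizing w' with
  | nil => exact (List.length_eq_zero_iff.1 hl.symm).symm
  | cons j w ih =>
    cases w' with
    | nil => simp at hl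
    | cons i w' =>
      have h1 : wordMap γ w x = wordMap γ w' x := H.map_injective hw
      obtain rfl := ih (by simpa using hl) h1
      have h2 : wordMap γ w x ∈ goodSet γ := by
        clear hw h1 hl ih
        induction w with
        | nil => exact hx
        | cons k w ih => exact map_mem_goodSet ih k
      rw [H.index_injective h2 hw]

/-- On a finite space the injective maps γ_j are bijective, and the common left inverse makes any
two of them agree. Every point is then a branch point, hence also postcritical. -/
theorem infinite [Nonempty K] (hN : 2 ≤ N) : Infinite K := by
  by_contra hfin
  rw [not_infinite_iff_finite] at hfin
  have hinj : ∀ j, Function.Injective (γ j) := fun j x y hxy => H.map_injective hxy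
  have hsurj : ∀ j, Function.Surjective (γ j) := fun j => Finite.surjective_of_injective (hinj j)
  have hB : ∀ x, x ∈ branchSet γ := fun x => by
    obtain ⟨a, ha⟩ := hsurj ⟨0, by omega⟩ x
    obtain ⟨a', ha'⟩ := hsurj ⟨1, by omega⟩ x
    obtain rfl : a = a' := H.map_injective (ha.trans ha'.symm)
    exact ⟨a, _, _, by simp, ha.symm, ha'.symm⟩
  have x : K := Classical.arbitrary K
  have : x ∈ branchSet γ ∩ postcriticalSet γ :=
    ⟨hB x, [⟨0, by omega⟩], by simp, hB _⟩
  rw [H.disj] at this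
  exact this

end HasInverse

theorem IsSelfSimilarMap.exists_contraction [NeZero N] (hγ : IsSelfSimilarMap γ) :
    ∃ c : ℝ, 0 ≤ c ∧ c < 1 ∧ ∀ j x y, dist (γ j x) (γ j y) ≤ c * dist x y := by
  choose c' c h0 h1 h2 h3 using hγ.contraction
  refine ⟨Finset.univ.sup' Finset.univ_nonempty c, ?_, ?_, fun j x y => ?_⟩
  · exact ((h0 0).le.trans (h1 0)).trans (Finset.le_sup' c (Finset.mem_univ 0))
  · exact (Finset.sup'_lt_iff _).2 fun j _ => h2 j
  · refine (h3 j x y).2.trans ?_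
    gcongr
    exact Finset.le_sup' c (Finset.mem_univ j)

theorem dist_wordMap_le {c : ℝ} (hc : 0 ≤ c)
    (hγc : ∀ j x y, dist (γ j x) (γ j y) ≤ c * dist x y) (w : List (Fin N)) (x y : K) :
    dist (wordMap γ w x) (wordMap γ w y) ≤ c ^ w.length * dist x y := by
  induction w with
  | nil => simp
  | cons j w ih =>
    rw [wordMap_cons, wordMap_cons, List.length_cons, pow_succ', mul_assoc]
    exact (hγc _ _ _).trans (by gcongr)

/-- Every neighbourhood contains the image of `K` under some word. -/
theorem exists_wordMap_subset_ball [CompactSpace K] [NeZero N] (hγ : IsSelfSimilarMap γ)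
    {h : C(K, K)} (H : HasInverse γ h) (x : K) {ε : ℝ} (hε : 0 < ε) :
    ∃ w : List (Fin N), ∀ y, dist (wordMap γ w y) x < ε := by
  obtain ⟨c, hc0, hc1, hc⟩ := hγ.exists_contraction
  obtain ⟨D, hD⟩ := (Metric.isBounded_iff.1 (isCompact_univ (X := K)).isBounded)
  have hlim : Filter.Tendsto (fun k : ℕ => c ^ k * D) Filter.atTop (nhds (0 * D)) :=
    (tendsto_pow_atTop_nhds_zero_of_lt_one hc0 hc1).mul_const D
  rw [zero_mul] at hlim
  obtain ⟨k, hk⟩ := (hlim.eventually_lt_const hε).exists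
  obtain ⟨w, y, hw, rfl⟩ := H.exists_wordMap k x
  refine ⟨w, fun z => lt_of_le_of_lt (dist_wordMap_le hc0 hc w z y) (lt_of_le_of_lt ?_ hk)⟩
  rw [hw]
  have := hD (Set.mem_univ z) (Set.mem_univ y)
  gcongr

/-- The images of K under long words shrink and cover, so the tree of a single branch point already
meets every ball. -/
theorem dense_goodSet [CompactSpace K] [NeZero N] (hγ : IsSelfSimilarMap γ)
    {h : C(K, K)} (H : HasInverse γ h) : Dense (goodSet γ) := by
  rcases (branchSet γ).eq_empty_or_nonempty with h0 | ⟨b, hb⟩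
  · have : goodSet γ = Set.univ := Set.eq_univ_of_forall fun x => Or.inl h0
    rw [this]
    exact dense_univ
  · refine Metric.dense_iff.2 fun x ε hε => ?_
    obtain ⟨w, hw⟩ := exists_wordMap_subset_ball hγ H x hε
    exact ⟨wordMap γ w b, hw b, Or.inr ⟨b, hb, w, rfl⟩⟩

end Dynamics

/-! ### Diagonal and composition operators on `ℓ²` -/

section SequenceSpace

variable {Y : Type u}

/-- The Hilbert space `ℓ²(Y)`. -/
abbrev L2 (Y : Type u) : Type u := lp (fun _ : Y => ℂ) 2

/-- The linear map on `ℓ²(Y)` given by `(g y)_y ↦ (f y * g (σ y))_y`, for a bounded family `f` and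
an injective map `σ`. -/
theorem sum_weighted_le {f : Y → ℂ} {C : ℝ} (hf : ∀ y, ‖f y‖ ≤ C) {σ : Y → Y}
    (hσ : Function.Injective σ) (g : L2 Y) (s : Finset Y) :
    ∑ y ∈ s, ‖f y * g (σ y)‖ ^ (2 : ℝ≥0∞).toReal ≤ (C * ‖g‖) ^ (2 : ℝ≥0∞).toReal := by
  classical
  have hp : 0 < (2 : ℝ≥0∞).toReal := by norm_num
  rcases s.eq_empty_or_nonempty with rfl | ⟨y0, _⟩
  · simp only [Finset.sum_empty]
    have : 0 ≤ (C * ‖g‖) ^ 2 := sq_nonneg _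
    simpa using this
  have hC : 0 ≤ C := (norm_nonneg _).trans (hf y0)
  calc ∑ y ∈ s, ‖f y * g (σ y)‖ ^ (2 : ℝ≥0∞).toReal
      ≤ ∑ y ∈ s, C ^ (2 : ℝ≥0∞).toReal * ‖g (σ y)‖ ^ (2 : ℝ≥0∞).toReal := by
        refine Finset.sum_le_sum fun y _ => ?_
        rw [norm_mul, Real.mul_rpow (norm_nonneg _) (norm_nonneg _)]
        gcongr
        exact hf y
    _ = C ^ (2 : ℝ≥0∞).toReal * ∑ y ∈ s.image σ, ‖g y‖ ^ (2 : ℝ≥0∞).toReal := by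
        rw [Finset.sum_image fun _ _ _ _ h => hσ h, Finset.mul_sum]
    _ ≤ C ^ (2 : ℝ≥0∞).toReal * ‖g‖ ^ (2 : ℝ≥0∞).toReal := by
        gcongr
        exact lp.sum_rpow_le_norm_rpow hp g _
    _ = (C * ‖g‖) ^ (2 : ℝ≥0∞).toReal := (Real.mul_rpow hC (norm_nonneg _)).symm

open Classical in
/-- The operator on `ℓ²(Y)` given by `(g y)_y ↦ (f y * g (σ y))_y`, for a bounded family `f` and
an injective map `σ` (and zero otherwise). -/
def weighted (f : Y → ℂ) (σ : Y → Y) : L2 Y →L[ℂ] L2 Y :=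
  if h : (∃ C, 0 ≤ C ∧ ∀ y, ‖f y‖ ≤ C) ∧ Function.Injective σ then
    LinearMap.mkContinuous
      { toFun := fun g => ⟨fun y => f y * g (σ y),
          memℓp_gen' (sum_weighted_le h.1.choose_spec.2 h.2 g)⟩
        map_add' := fun g g' => by
          ext y
          exact mul_add _ _ _
        map_smul' := fun c g => by
          ext y
          exact mul_left_comm _ _ _ }
      h.1.choose
      (fun g => lp.norm_le_of_forall_sum_le (by norm_num)
        (mul_nonneg h.1.choose_spec.1 (norm_nonneg _))
        (sum_weighted_le h.1.choose_spec.2 h.2 g))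
  else 0

theorem weighted_apply {f : Y → ℂ} {C : ℝ} (hf : ∀ y, ‖f y‖ ≤ C) {σ : Y → Y}
    (hσ : Function.Injective σ) (g : L2 Y) (y : Y) : weighted f σ g y = f y * g (σ y) := by
  have h : (∃ C, 0 ≤ C ∧ ∀ y, ‖f y‖ ≤ C) ∧ Function.Injective σ :=
    ⟨⟨C, (norm_nonneg _).trans (hf y), hf⟩, hσ⟩
  unfold weighted
  rw [dif_pos h]
  rfl

theorem norm_weighted_le {f : Y → ℂ} {C : ℝ} (hC : 0 ≤ C) (hf : ∀ y, ‖f y‖ ≤ C) {σ : Y → Y}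
    (hσ : Function.Injective σ) : ‖weighted f σ‖ ≤ C := by
  refine ContinuousLinearMap.opNorm_le_bound _ hC fun g => ?_
  refine lp.norm_le_of_forall_sum_le (by norm_num) (by positivity) fun s => ?_
  simp only [weighted_apply hf hσ]
  exact sum_weighted_le hf hσ g s

/-- Multiplication by a bounded family. -/
def diag (f : Y → ℂ) : L2 Y →L[ℂ] L2 Y := weighted f id

/-- Composition with an injective map. -/
def pull (σ : Y → Y) : L2 Y →L[ℂ] L2 Y := weighted 1 σ

theorem diag_apply {f : Y → ℂ} {C : ℝ} (hf : ∀ y, ‖f y‖ ≤ C) (g : L2 Y) (y : Y) :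
    diag f g y = f y * g y := weighted_apply hf Function.injective_id g y

theorem pull_apply {σ : Y → Y} (hσ : Function.Injective σ) (g : L2 Y) (y : Y) :
    pull σ g y = g (σ y) := by
  rw [pull, weighted_apply (C := 1) (by simp) hσ]
  simp

theorem norm_diag_le {f : Y → ℂ} {C : ℝ} (hC : 0 ≤ C) (hf : ∀ y, ‖f y‖ ≤ C) : ‖diag f‖ ≤ C :=
  norm_weighted_le hC hf Function.injective_id

theorem norm_pull_le {σ : Y → Y} (hσ : Function.Injective σ) : ‖pull σ‖ ≤ 1 :=
  norm_weighted_le zero_le_one (by simp) hσ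

theorem inner_diag {f : Y → ℂ} {C : ℝ} (hf : ∀ y, ‖f y‖ ≤ C) (g g' : L2 Y) :
    inner ℂ (diag f g) g' = inner ℂ g (diag (fun y => star (f y)) g') := by
  rw [lp.inner_eq_tsum, lp.inner_eq_tsum]
  refine tsum_congr fun y => ?_
  rw [diag_apply hf, diag_apply (C := C) (by simpa using hf)]
  simp only [RCLike.inner_apply, map_mul, RCLike.star_def]
  ring

theorem star_diag {f : Y → ℂ} {C : ℝ} (hf : ∀ y, ‖f y‖ ≤ C) :
    star (diag f) = diag fun y => star (f y) := by
  rw [ContinuousLinearMap.star_eq_adjoint, eq_comm, ContinuousLinearMap.eq_adjoint_iff]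
  intro g g'
  rw [inner_diag (C := C) (by simpa using hf)]
  simp

open Classical in
theorem star_pull_apply {σ : Y → Y} (hσ : Function.Injective σ) (g : L2 Y) (y : Y) :
    star (pull σ) g (σ y) = g y := by
  have h1 := lp.inner_single_left (𝕜 := ℂ) (σ y) (1 : ℂ) (star (pull σ) g)
  rw [ContinuousLinearMap.star_eq_adjoint, ContinuousLinearMap.adjoint_inner_right] at h1
  have h2 : pull σ (lp.single 2 (σ y) (1 : ℂ)) = lp.single 2 y (1 : ℂ) := by
    ext z
    rw [pull_apply hσ, lp.single_apply, lp.single_apply]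
    simp [Pi.single_apply, hσ.eq_iff]
  rw [h2, lp.inner_single_left] at h1
  rw [ContinuousLinearMap.star_eq_adjoint]
  simpa using h1.symm

open Classical in
theorem star_pull_apply_of_notMem {σ : Y → Y} (hσ : Function.Injective σ) (g : L2 Y) {x : Y}
    (hx : x ∉ Set.range σ) : star (pull σ) g x = 0 := by
  have h1 := lp.inner_single_left (𝕜 := ℂ) x (1 : ℂ) (star (pull σ) g)
  rw [ContinuousLinearMap.star_eq_adjoint, ContinuousLinearMap.adjoint_inner_right] at h1
  have h2 : pull σ (lp.single 2 x (1 : ℂ)) = 0 := by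
    ext z
    rw [pull_apply hσ, lp.single_apply]
    simp only [Pi.single_apply, lp.coeFn_zero, Pi.zero_apply, ite_eq_right_iff, one_ne_zero,
      imp_false]
    exact fun h => hx ⟨z, h⟩
  rw [h2, inner_zero_left] at h1
  rw [ContinuousLinearMap.star_eq_adjoint]
  simpa using h1.symm

end SequenceSpace

/-! ### The covariant representation on `ℓ²` of the good set -/

section Rep

variable {K : Type u} [MetricSpace K] [CompactSpace K] {N : ℕ} {γ : Fin N → C(K, K)}

theorem fstPull_cographPt (a : C(K, ℂ)) (j : Fin N) (y : K) :
    fstPull γ a (cographPt γ j y) = a (γ j y) := rfl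

theorem innerA_apply (ξ η : Corr γ) (y : K) :
    innerA γ ξ η y = ∑ j, star (ξ (cographPt γ j y)) * η (cographPt γ j y) := by
  simp [innerA, ContinuousMap.sum_apply]

theorem rankOne_apply (ξ η ζ : Corr γ) (i : Fin N) (y : K) :
    rankOne γ ξ η ζ (cographPt γ i y) =
      ξ (cographPt γ i y) * ∑ j, star (η (cographPt γ j y)) * ζ (cographPt γ j y) := by
  rw [← innerA_apply]
  rfl

theorem leftAct_apply (a : C(K, ℂ)) (ξ : Corr γ) (i : Fin N) (y : K) :
    leftAct γ a ξ (cographPt γ i y) = a (γ i y) * ξ (cographPt γ i y) := rfl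

theorem rightAct_apply (a : C(K, ℂ)) (ξ : Corr γ) (i : Fin N) (y : K) :
    rightAct γ ξ a (cographPt γ i y) = ξ (cographPt γ i y) * a y := rfl

theorem cographPt_congr {i j : Fin N} {y : K} (h : γ i y = γ j y) :
    cographPt γ i y = cographPt γ j y := Subtype.ext (Prod.ext h rfl)

/-- A function on the cograph which is `1` at `(γ_j(y), y)` and vanishes at the other points
`(γ_i(y), y)`. -/
def fiberBump (γ : Fin N → C(K, K)) (y : K) (j : Fin N) : Corr γ :=
  fstPull γ (exists_bump (Set.finite_range fun i => γ i y) (γ j y)).choose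

theorem fiberBump_self (y : K) (j : Fin N) : fiberBump γ y j (cographPt γ j y) = 1 :=
  (exists_bump (Set.finite_range fun i => γ i y) (γ j y)).choose_spec.1

theorem fiberBump_ne {y : K} {i j : Fin N} (h : γ i y ≠ γ j y) :
    fiberBump γ y j (cographPt γ i y) = 0 :=
  (exists_bump (Set.finite_range fun i => γ i y) (γ j y)).choose_spec.2.1 _ ⟨i, rfl⟩ h

theorem norm_fiberBump_le (y : K) (j : Fin N) : ‖fiberBump γ y j‖ ≤ 1 :=
  (ContinuousMap.norm_le _ zero_le_one).2 fun _ =>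
    (exists_bump (Set.finite_range fun i => γ i y) (γ j y)).choose_spec.2.2 _

/-- The matrix coefficients of an operator on `X_γ` in the fibre over `y`. -/
def fiberCoeff (i j : Fin N) (T : Corr γ →L[ℂ] Corr γ) (y : K) : ℂ :=
  T (fiberBump γ y j) (cographPt γ i y)

theorem norm_fiberCoeff_le (i j : Fin N) (T : Corr γ →L[ℂ] Corr γ) (y : K) :
    ‖fiberCoeff i j T y‖ ≤ ‖T‖ :=
  (ContinuousMap.norm_coe_le_norm _ _).trans <| (T.le_opNorm _).trans <|
    mul_le_of_le_one_right (norm_nonneg _) (norm_fiberBump_le y j)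

variable {h : C(K, K)} (H : HasInverse γ h)

include H

theorem HasInverse.fiberBump_apply {y : K} (hy : y ∈ goodSet γ) (i j : Fin N) :
    fiberBump γ y j (cographPt γ i y) = if i = j then 1 else 0 := by
  split_ifs with hij
  · rw [hij, fiberBump_self]
  · exact fiberBump_ne fun h => hij (H.index_injective hy h)

theorem HasInverse.fiberCoeff_rankOne {y : K} (hy : y ∈ goodSet γ) (i j : Fin N) (ξ η : Corr γ) :
    fiberCoeff i j (rankOne γ ξ η) y =
      ξ (cographPt γ i y) * star (η (cographPt γ j y)) := by
  rw [fiberCoeff, rankOne_apply, Finset.sum_eq_single j]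
  · rw [fiberBump_self, mul_one]
  · intro k _ hk
    rw [H.fiberBump_apply hy, if_neg hk, mul_zero]
  · simp

theorem HasInverse.fiberCoeff_leftAct {y : K} (hy : y ∈ goodSet γ) (i j : Fin N) (a : C(K, ℂ)) :
    fiberCoeff i j (leftAct γ a) y = if i = j then a (γ i y) else 0 := by
  rw [fiberCoeff, leftAct_apply, H.fiberBump_apply hy]
  split_ifs <;> simp

/-- For θ_{ξ,η} the coefficients are ξ_i conj(η_i) and ξ_i conj(η_j), and η_i, η_j agree at c
because the two points of the cograph over c coincide. Uniform bounds on the coefficients carry this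
to norm limits. -/
theorem HasInverse.tendsto_fiberCoeff_sub {T : Corr γ →L[ℂ] Corr γ} (hT : T ∈ compactOps γ)
    {c : K} {i j : Fin N} (hc : γ i c = γ j c) :
    Filter.Tendsto (fun y => fiberCoeff i i T y - fiberCoeff i j T y)
      (nhdsWithin c (goodSet γ)) (nhds 0) := by
  have hspan : ∀ T ∈ Submodule.span ℂ {T | ∃ ξ η, T = rankOne γ ξ η},
      Filter.Tendsto (fun y => fiberCoeff i i T y - fiberCoeff i j T y)
        (nhdsWithin c (goodSet γ)) (nhds 0) := by
    intro T hT
    induction hT using Submodule.span_induction with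
    | mem T hT =>
      obtain ⟨ξ, η, rfl⟩ := hT
      have hcont : Continuous fun y => ξ (cographPt γ i y) * star (η (cographPt γ i y)) -
          ξ (cographPt γ i y) * star (η (cographPt γ j y)) := by fun_prop
      have := (hcont.tendsto c).mono_left (nhdsWithin_le_nhds (s := goodSet γ))
      rw [cographPt_congr hc, sub_self] at this
      refine this.congr' ?_
      filter_upwards [self_mem_nhdsWithin] with y hy
      rw [H.fiberCoeff_rankOne hy, H.fiberCoeff_rankOne hy]
    | zero => simp [fiberCoeff, tendsto_const_nhds]
    | add T T' _ _ h1 h2 =>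
      have := h1.add h2
      rw [add_zero] at this
      refine this.congr fun y => ?_
      simp only [fiberCoeff, add_apply, ContinuousMap.add_apply]
      ring
    | smul k T _ h1 =>
      have := h1.const_mul k
      rw [mul_zero] at this
      refine this.congr fun y => ?_
      simp only [fiberCoeff, smul_apply, ContinuousMap.smul_apply, smul_eq_mul]
      ring
  rw [Metric.tendsto_nhds]
  intro ε hε
  obtain ⟨T', hT', hTT'⟩ := Metric.mem_closure_iff.1 hT (ε / 4) (by positivity)
  filter_upwards [Metric.tendsto_nhds.1 (hspan T' hT') (ε / 2) (by positivity)] with y hy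
  rw [dist_zero_right] at hy ⊢
  have e : ∀ k : Fin N, fiberCoeff i k T y = fiberCoeff i k T' y + fiberCoeff i k (T - T') y := by
    intro k
    simp only [fiberCoeff, sub_apply, ContinuousMap.sub_apply]
    ring
  have h3 : ∀ k : Fin N, ‖fiberCoeff i k (T - T') y‖ < ε / 4 := fun k =>
    (norm_fiberCoeff_le i k _ y).trans_lt (by rwa [← dist_eq_norm])
  have h4 : fiberCoeff i i T y - fiberCoeff i j T y = (fiberCoeff i i T' y - fiberCoeff i j T' y) +
      (fiberCoeff i i (T - T') y - fiberCoeff i j (T - T') y) := by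
    rw [e i, e j]
    ring
  rw [h4]
  calc _ ≤ ‖fiberCoeff i i T' y - fiberCoeff i j T' y‖ +
        (‖fiberCoeff i i (T - T') y‖ + ‖fiberCoeff i j (T - T') y‖) :=
        (norm_add_le _ _).trans (by gcongr; exact norm_sub_le _ _)
    _ < ε := by linarith [h3 i, h3 j]

/-- If `a` acts on `X_γ` by a compact operator, then `a` vanishes on the branch set. -/
theorem HasInverse.apply_eq_zero_of_leftAct_mem (hd : Dense (goodSet γ)) {a : C(K, ℂ)}
    (ha : leftAct γ a ∈ compactOps γ) {b : K} (hb : b ∈ branchSet γ) : a b = 0 := by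
  obtain ⟨c, i, j, hij, rfl, hc⟩ := hb
  have h1 := H.tendsto_fiberCoeff_sub ha hc
  -- Over the good set φ(a) is diagonal, so the same difference is a(γ_i(y)), with limit a(b);
  -- density of the good set makes the two limits equal.
  have h2 : Filter.Tendsto (fun y => fiberCoeff i i (leftAct γ a) y -
      fiberCoeff i j (leftAct γ a) y) (nhdsWithin c (goodSet γ)) (nhds (a (γ i c))) := by
    have hcont : Continuous fun y => a (γ i y) := by fun_prop
    refine ((hcont.tendsto c).mono_left (nhdsWithin_le_nhds (s := goodSet γ))).congr' ?_
    filter_upwards [self_mem_nhdsWithin] with y hy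
    rw [H.fiberCoeff_leftAct hy, H.fiberCoeff_leftAct hy, if_pos rfl, if_neg hij, sub_zero]
  have : (nhdsWithin c (goodSet γ)).NeBot := mem_closure_iff_nhdsWithin_neBot.1 (hd c)
  exact tendsto_nhds_unique h2 h1

omit H

/-- The Hilbert space of the representation. -/
abbrev GoodL2 (γ : Fin N → C(K, K)) : Type u := L2 (goodSet γ)

/-- The map `γ_j` on the good set. -/
def goodMap (γ : Fin N → C(K, K)) (j : Fin N) (y : goodSet γ) : goodSet γ :=
  ⟨γ j y, map_mem_goodSet y.2 j⟩

/-- The operator `δ_{γ_j(y)} ↦ δ_y`. -/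
def pullOp (γ : Fin N → C(K, K)) (j : Fin N) : GoodL2 γ →L[ℂ] GoodL2 γ := pull (goodMap γ j)

/-- Multiplication by a function on `K`. -/
def diagOp (f : K → ℂ) : GoodL2 γ →L[ℂ] GoodL2 γ := diag fun y => f y

theorem diagOp_apply {f : K → ℂ} {C : ℝ} (hf : ∀ y, ‖f y‖ ≤ C) (g : GoodL2 γ) (y : goodSet γ) :
    diagOp f g y = f y * g y := diag_apply (f := fun y : goodSet γ => f y) (C := C) (fun y => hf y) g y

theorem diagOp_continuousMap_apply (f : C(K, ℂ)) (g : GoodL2 γ) (y : goodSet γ) :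
    diagOp f g y = f y * g y := diagOp_apply (fun y => f.norm_coe_le_norm y) g y

include H

theorem HasInverse.goodMap_injective (j : Fin N) : Function.Injective (goodMap γ j) :=
  fun _ _ hxy => Subtype.ext (H.map_injective (congrArg Subtype.val hxy))

theorem HasInverse.pullOp_apply (j : Fin N) (g : GoodL2 γ) (y : goodSet γ) :
    pullOp γ j g y = g (goodMap γ j y) := pull_apply (H.goodMap_injective j) g y

theorem HasInverse.star_pullOp_apply (i j : Fin N) (g : GoodL2 γ) (y : goodSet γ) :
    star (pullOp γ j) g (goodMap γ i y) = if i = j then g y else 0 := by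
  split_ifs with hij
  · rw [hij]
    exact star_pull_apply (H.goodMap_injective j) g y
  · refine star_pull_apply_of_notMem (H.goodMap_injective j) g ?_
    rintro ⟨z, hz⟩
    have hz' : γ j z = γ i y := congrArg Subtype.val hz
    have h1 : (z : K) = y := H.map_injective hz'
    rw [h1] at hz'
    exact hij (H.index_injective y.2 hz').symm

theorem HasInverse.star_pullOp_apply_of_mem (j : Fin N) (g : GoodL2 γ) {x : goodSet γ}
    (hx : (x : K) ∈ branchSet γ) : star (pullOp γ j) g x = 0 := by
  refine star_pull_apply_of_notMem (H.goodMap_injective j) g ?_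
  rintro ⟨z, rfl⟩
  exact H.map_notMem z.2 j hx

theorem HasInverse.eq_goodMap_or_mem (x : goodSet γ) :
    (x : K) ∈ branchSet γ ∨ ∃ j y, x = goodMap γ j y := by
  by_cases hx : (x : K) ∈ branchSet γ
  · exact Or.inl hx
  · obtain ⟨j, hj⟩ := H.cover x
    exact Or.inr ⟨j, ⟨h x, H.inv_mem_goodSet x.2 hx⟩, Subtype.ext hj.symm⟩

omit H

/-- The operator `(S_ξ g)(γ_j(y)) = ξ(γ_j(y), y) g(y)`. -/
def repS (ξ : Corr γ) : GoodL2 γ →L[ℂ] GoodL2 γ :=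
  ∑ j, star (pullOp γ j) * diagOp (ξ.comp (cographPt γ j))

theorem sum_lp_apply {Y ι : Type*} (s : Finset ι) (f : ι → L2 Y →L[ℂ] L2 Y) (g : L2 Y) (y : Y) :
    (∑ i ∈ s, f i) g y = ∑ i ∈ s, f i g y := by
  rw [sum_apply, lp.coeFn_sum, Finset.sum_apply]

theorem star_repS (ξ : Corr γ) :
    star (repS ξ) = ∑ j, diagOp (star (ξ.comp (cographPt γ j)) : C(K, ℂ)) * pullOp γ j := by
  rw [repS, star_sum]
  refine Finset.sum_congr rfl fun j _ => ?_
  rw [star_mul, star_star, diagOp,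
    star_diag (C := ‖ξ.comp (cographPt γ j)‖) fun y => ContinuousMap.norm_coe_le_norm _ _]
  rfl

include H

theorem HasInverse.repS_apply (ξ : Corr γ) (g : GoodL2 γ) (j : Fin N) (y : goodSet γ) :
    repS ξ g (goodMap γ j y) = ξ (cographPt γ j y) * g y := by
  rw [repS, sum_lp_apply, Finset.sum_eq_single j]
  · rw [mul_apply_eq_comp, H.star_pullOp_apply, if_pos rfl, diagOp_continuousMap_apply]
    rfl
  · intro i _ hi
    rw [mul_apply_eq_comp, H.star_pullOp_apply, if_neg hi.symm]
  · simp

theorem HasInverse.repS_apply_of_mem (ξ : Corr γ) (g : GoodL2 γ) {x : goodSet γ}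
    (hx : (x : K) ∈ branchSet γ) : repS ξ g x = 0 := by
  rw [repS, sum_lp_apply]
  exact Finset.sum_eq_zero fun j _ => H.star_pullOp_apply_of_mem j _ hx

theorem HasInverse.star_repS_apply (ξ : Corr γ) (g : GoodL2 γ) (y : goodSet γ) :
    star (repS ξ) g y = ∑ j, star (ξ (cographPt γ j y)) * g (goodMap γ j y) := by
  rw [star_repS, sum_lp_apply]
  refine Finset.sum_congr rfl fun j _ => ?_
  rw [mul_apply_eq_comp, diagOp_continuousMap_apply, H.pullOp_apply]
  rfl

omit H

/-- Multiplication operators as a representation of `C(K)`. -/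
def repI (γ : Fin N → C(K, K)) : C(K, ℂ) →⋆ₐ[ℂ] (GoodL2 γ →L[ℂ] GoodL2 γ) where
  toFun a := diagOp a
  map_one' := by ext g y; rw [diagOp_continuousMap_apply]; simp
  map_mul' a a' := by
    ext g y
    rw [mul_apply_eq_comp]
    simp only [diagOp_continuousMap_apply, ContinuousMap.mul_apply, mul_assoc]
  map_zero' := by ext g y; rw [diagOp_continuousMap_apply]; simp
  map_add' a a' := by
    ext g y
    rw [add_apply, lp.coeFn_add, Pi.add_apply]
    simp only [diagOp_continuousMap_apply, ContinuousMap.add_apply, add_mul]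
  commutes' c := by
    ext g y
    rw [diagOp_continuousMap_apply]
    simp [Algebra.algebraMap_eq_smul_one]
  map_star' a := by
    rw [diagOp, diagOp, star_diag (C := ‖a‖) fun y => ContinuousMap.norm_coe_le_norm _ _]
    rfl

theorem repI_apply (a : C(K, ℂ)) (g : GoodL2 γ) (y : goodSet γ) : repI γ a g y = a y * g y :=
  diagOp_continuousMap_apply a g y

/-- The operator with the given matrix coefficients along the fibres. -/
def repK (T : Corr γ →L[ℂ] Corr γ) : GoodL2 γ →L[ℂ] GoodL2 γ :=
  ∑ i, ∑ j, star (pullOp γ i) * diagOp (fiberCoeff i j T) * pullOp γ j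

include H

theorem HasInverse.repK_apply (T : Corr γ →L[ℂ] Corr γ) (g : GoodL2 γ) (i : Fin N)
    (y : goodSet γ) :
    repK T g (goodMap γ i y) = ∑ j, fiberCoeff i j T y * g (goodMap γ j y) := by
  rw [repK, sum_lp_apply, Finset.sum_eq_single i]
  · rw [sum_lp_apply]
    refine Finset.sum_congr rfl fun j _ => ?_
    rw [mul_assoc, mul_apply_eq_comp, H.star_pullOp_apply, if_pos rfl,
      mul_apply_eq_comp, diagOp_apply (norm_fiberCoeff_le i j T), H.pullOp_apply]
  · intro k _ hk
    rw [sum_lp_apply]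
    refine Finset.sum_eq_zero fun j _ => ?_
    rw [mul_assoc, mul_apply_eq_comp, H.star_pullOp_apply, if_neg hk.symm]
  · simp

theorem HasInverse.repK_apply_of_mem (T : Corr γ →L[ℂ] Corr γ) (g : GoodL2 γ) {x : goodSet γ}
    (hx : (x : K) ∈ branchSet γ) : repK T g x = 0 := by
  rw [repK, sum_lp_apply]
  refine Finset.sum_eq_zero fun i _ => ?_
  rw [sum_lp_apply]
  refine Finset.sum_eq_zero fun j _ => ?_
  rw [mul_assoc, mul_apply_eq_comp, H.star_pullOp_apply_of_mem _ _ hx]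

/-- Operators on `ℓ²` of the good set are equal if they agree on branch points and on image
points. -/
theorem HasInverse.op_ext {T T' : GoodL2 γ →L[ℂ] GoodL2 γ}
    (h1 : ∀ g (x : goodSet γ), (x : K) ∈ branchSet γ → T g x = T' g x)
    (h2 : ∀ g i (y : goodSet γ), T g (goodMap γ i y) = T' g (goodMap γ i y)) : T = T' := by
  ext g x
  rcases H.eq_goodMap_or_mem x with hx | ⟨i, y, rfl⟩
  · exact h1 g x hx
  · exact h2 g i y

omit H in
theorem norm_repK_le (H : HasInverse γ h) (T : Corr γ →L[ℂ] Corr γ) :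
    ‖repK T‖ ≤ (N * N : ℝ) * ‖T‖ := by
  have h1 : ∀ i j : Fin N,
      ‖star (pullOp γ i) * diagOp (fiberCoeff i j T) * pullOp γ j‖ ≤ ‖T‖ := by
    intro i j
    have hp : ∀ k, ‖pullOp γ k‖ ≤ 1 := fun k => norm_pull_le (H.goodMap_injective k)
    have hd : ‖(diagOp (fiberCoeff i j T) : GoodL2 γ →L[ℂ] GoodL2 γ)‖ ≤ ‖T‖ :=
      norm_diag_le (norm_nonneg _) fun y => norm_fiberCoeff_le i j T y
    calc _ ≤ ‖star (pullOp γ i)‖ * ‖(diagOp (fiberCoeff i j T) : GoodL2 γ →L[ℂ] GoodL2 γ)‖ *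
          ‖pullOp γ j‖ := (norm_mul_le _ _).trans (by gcongr; exact norm_mul_le _ _)
      _ ≤ 1 * ‖T‖ * 1 := by
        gcongr
        · exact (norm_star (pullOp γ i)).trans_le (hp i)
        · exact hp j
      _ = ‖T‖ := by ring
  calc ‖repK T‖ ≤ ∑ i : Fin N, ∑ j : Fin N, ‖T‖ :=
        norm_sum_le_of_le _ fun i _ => norm_sum_le_of_le _ fun j _ => h1 i j
    _ = (N * N : ℝ) * ‖T‖ := by simp [mul_assoc]

/-- The linear map `ξ ↦ S_ξ`. -/
def HasInverse.repSLin : Corr γ →ₗ[ℂ] (GoodL2 γ →L[ℂ] GoodL2 γ) where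
  toFun := repS
  map_add' ξ η := by
    refine H.op_ext (fun g x hx => ?_) fun g i y => ?_
    · rw [add_apply, lp.coeFn_add, Pi.add_apply]
      simp [H.repS_apply_of_mem _ _ hx]
    · rw [add_apply, lp.coeFn_add, Pi.add_apply]
      simp [H.repS_apply, add_mul]
  map_smul' c ξ := by
    refine H.op_ext (fun g x hx => ?_) fun g i y => ?_
    · rw [smul_apply, lp.coeFn_smul, Pi.smul_apply]
      simp [H.repS_apply_of_mem _ _ hx]
    · rw [smul_apply, lp.coeFn_smul, Pi.smul_apply]
      simp [H.repS_apply, mul_assoc]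

theorem HasInverse.repI_mul_repS (a : C(K, ℂ)) (ξ : Corr γ) :
    repI γ a * repS ξ = repS (leftAct γ a ξ) := by
  refine H.op_ext (fun g x hx => ?_) fun g i y => ?_
  · rw [mul_apply_eq_comp, repI_apply, H.repS_apply_of_mem _ _ hx, H.repS_apply_of_mem _ _ hx,
      mul_zero]
  · rw [mul_apply_eq_comp, repI_apply, H.repS_apply, H.repS_apply, leftAct_apply, mul_assoc]
    rfl

theorem HasInverse.repS_mul_repI (ξ : Corr γ) (a : C(K, ℂ)) :
    repS ξ * repI γ a = repS (rightAct γ ξ a) := by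
  refine H.op_ext (fun g x hx => ?_) fun g i y => ?_
  · rw [mul_apply_eq_comp, H.repS_apply_of_mem _ _ hx, H.repS_apply_of_mem _ _ hx]
  · rw [mul_apply_eq_comp, H.repS_apply, H.repS_apply, repI_apply, rightAct_apply, mul_assoc]

theorem HasInverse.star_repS_mul_repS (ξ η : Corr γ) :
    star (repS ξ) * repS η = repI γ (innerA γ ξ η) := by
  ext g y
  rw [mul_apply_eq_comp, H.star_repS_apply, repI_apply, innerA_apply, Finset.sum_mul]
  exact Finset.sum_congr rfl fun j _ => by rw [H.repS_apply, mul_assoc]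

/-- The linear map `repK`. -/
def HasInverse.repKLin : (Corr γ →L[ℂ] Corr γ) →ₗ[ℂ] (GoodL2 γ →L[ℂ] GoodL2 γ) where
  toFun := repK
  map_add' T T' := by
    refine H.op_ext (fun g x hx => ?_) fun g i y => ?_
    · rw [add_apply, lp.coeFn_add, Pi.add_apply]
      simp [H.repK_apply_of_mem _ _ hx]
    · rw [add_apply, lp.coeFn_add, Pi.add_apply]
      simp only [H.repK_apply, ← Finset.sum_add_distrib, ← add_mul]
      rfl
  map_smul' c T := by
    refine H.op_ext (fun g x hx => ?_) fun g i y => ?_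
    · rw [smul_apply, lp.coeFn_smul, Pi.smul_apply]
      simp [H.repK_apply_of_mem _ _ hx]
    · rw [smul_apply, lp.coeFn_smul, Pi.smul_apply]
      simp only [H.repK_apply, smul_eq_mul, Finset.mul_sum, ← mul_assoc, RingHom.id_apply]
      rfl

/-- The continuous linear map `repK`. -/
def HasInverse.repKCLM : (Corr γ →L[ℂ] Corr γ) →L[ℂ] (GoodL2 γ →L[ℂ] GoodL2 γ) :=
  H.repKLin.mkContinuous (N * N : ℝ) (norm_repK_le H)

theorem HasInverse.repK_rankOne (ξ η : Corr γ) :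
    repK (rankOne γ ξ η) = repS ξ * star (repS η) := by
  refine H.op_ext (fun g x hx => ?_) fun g i y => ?_
  · rw [mul_apply_eq_comp, H.repS_apply_of_mem _ _ hx, H.repK_apply_of_mem _ _ hx]
  · rw [mul_apply_eq_comp, H.repS_apply, H.repK_apply, H.star_repS_apply, Finset.mul_sum]
    refine Finset.sum_congr rfl fun j _ => ?_
    rw [H.fiberCoeff_rankOne y.2, mul_assoc]

/-- At branch points both sides vanish, the left one because compactness of φ(a) forces a to vanish
there. At image points the fibre matrix of φ(a) is diagonal. -/
theorem HasInverse.repI_eq_repK (hd : Dense (goodSet γ)) {a : C(K, ℂ)}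
    (ha : leftAct γ a ∈ compactOps γ) : repI γ a = repK (leftAct γ a) := by
  refine H.op_ext (fun g x hx => ?_) fun g i y => ?_
  · rw [repI_apply, H.repK_apply_of_mem _ _ hx, H.apply_eq_zero_of_leftAct_mem hd ha hx, zero_mul]
  · rw [repI_apply, H.repK_apply, Finset.sum_eq_single i]
    · rw [H.fiberCoeff_leftAct y.2, if_pos rfl]
      rfl
    · intro j _ hj
      rw [H.fiberCoeff_leftAct y.2, if_neg hj.symm, zero_mul]
    · simp

omit H in
theorem nontrivial_goodL2 [Nonempty K] (hd : Dense (goodSet γ)) : Nontrivial (GoodL2 γ) := by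
  classical
  obtain ⟨y, hy⟩ := hd.nonempty
  refine ⟨⟨lp.single 2 ⟨y, hy⟩ 1, 0, fun h0 => ?_⟩⟩
  have := congrArg (fun g : GoodL2 γ => g ⟨y, hy⟩) h0
  simp [lp.single_apply] at this

/-- The covariant representation on `ℓ²` of the good set. -/
def HasInverse.rep [Nonempty K] (hd : Dense (goodSet γ)) : CovRep γ where
  B := GoodL2 γ →L[ℂ] GoodL2 γ
  nontriv := by
    have := nontrivial_goodL2 hd
    infer_instance
  i := repI γ
  S := H.repSLin
  map_left := H.repI_mul_repS
  map_right := H.repS_mul_repI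
  map_inner := H.star_repS_mul_repS
  covariant := ⟨H.repKCLM.comp (compactOps γ).subtypeL, H.repK_rankOne, fun _ ha => H.repI_eq_repK hd ha⟩

end Rep

/-! ### Words and monomials in the Cuntz–Pimsner algebra -/

section Algebra

variable {K : Type u} [MetricSpace K] [CompactSpace K] {N : ℕ} {γ : Fin N → C(K, K)}

/-- The embedding of `C(K)` as a homomorphism. -/
def opIHom (γ : Fin N → C(K, K)) : C(K, ℂ) →⋆ₐ[ℂ] cuntzPimsner γ where
  toFun := opI γ
  map_one' := Subtype.ext <| lp.ext <| funext fun ρ => map_one ρ.i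
  map_mul' a a' := Subtype.ext <| lp.ext <| funext fun ρ => map_mul ρ.i a a'
  map_zero' := Subtype.ext <| lp.ext <| funext fun ρ => map_zero ρ.i
  map_add' a a' := Subtype.ext <| lp.ext <| funext fun ρ => map_add ρ.i a a'
  commutes' c := Subtype.ext <| lp.ext <| funext fun ρ => AlgHomClass.commutes ρ.i c
  map_star' a := Subtype.ext <| lp.ext <| funext fun ρ => map_star ρ.i a

theorem opI_mul (a a' : C(K, ℂ)) : opI γ (a * a') = opI γ a * opI γ a' := map_mul (opIHom γ) a a'
theorem opI_add (a a' : C(K, ℂ)) : opI γ (a + a') = opI γ a + opI γ a' := map_add (opIHom γ) a a'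
theorem opI_sub (a a' : C(K, ℂ)) : opI γ (a - a') = opI γ a - opI γ a' := map_sub (opIHom γ) a a'
theorem opI_one : opI γ 1 = 1 := map_one (opIHom γ)
theorem opI_zero : opI γ 0 = 0 := map_zero (opIHom γ)
theorem opI_star (a : C(K, ℂ)) : opI γ (star a) = star (opI γ a) := map_star (opIHom γ) a
theorem opI_smul (c : ℂ) (a : C(K, ℂ)) : opI γ (c • a) = c • opI γ a := map_smul (opIHom γ) c a

theorem norm_opI_le (a : C(K, ℂ)) : ‖opI γ a‖ ≤ ‖a‖ :=
  NonUnitalStarAlgHom.norm_apply_le (opIHom γ) a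

theorem opI_mul_opS (a : C(K, ℂ)) (ξ : Corr γ) : opI γ a * opS γ ξ = opS γ (leftAct γ a ξ) :=
  Subtype.ext <| lp.ext <| funext fun ρ => ρ.map_left a ξ

theorem star_opS_mul_opS (ξ η : Corr γ) : star (opS γ ξ) * opS γ η = opI γ (innerA γ ξ η) :=
  Subtype.ext <| lp.ext <| funext fun ρ => ρ.map_inner ξ η

theorem opWord_zero (ξ : Fin 0 → Corr γ) : opWord γ ξ = 1 := by simp [opWord]

theorem opWord_succ {n : ℕ} (ξ : Fin (n + 1) → Corr γ) :
    opWord γ ξ = opS γ (ξ 0) * opWord γ (Fin.tail ξ) := by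
  rw [opWord, List.ofFn_succ, List.prod_cons]
  rfl

/-- The span of the elements `S_{ξ₁} ⋯ S_{ξ_n} a`. -/
def wordSpan (γ : Fin N → C(K, K)) (n : ℕ) : Submodule ℂ (cuntzPimsner γ) :=
  Submodule.span ℂ {T | ∃ (ξ : Fin n → Corr γ) (a : C(K, ℂ)), T = opWord γ ξ * opI γ a}

theorem opWord_mul_opI_mem {n : ℕ} (ξ : Fin n → Corr γ) (a : C(K, ℂ)) :
    opWord γ ξ * opI γ a ∈ wordSpan γ n := Submodule.subset_span ⟨ξ, a, rfl⟩

theorem opWord_mem {n : ℕ} (ξ : Fin n → Corr γ) : opWord γ ξ ∈ wordSpan γ n := by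
  simpa [opI_one] using opWord_mul_opI_mem ξ 1

theorem mem_wordSpan_zero {T : cuntzPimsner γ} : T ∈ wordSpan γ 0 ↔ ∃ a, T = opI γ a := by
  constructor
  · intro hT
    induction hT using Submodule.span_induction with
    | mem T hT =>
      obtain ⟨ξ, a, rfl⟩ := hT
      exact ⟨a, by rw [opWord_zero, one_mul]⟩
    | zero => exact ⟨0, opI_zero.symm⟩
    | add T T' _ _ h h' =>
      obtain ⟨a, rfl⟩ := h
      obtain ⟨a', rfl⟩ := h'
      exact ⟨a + a', (opI_add _ _).symm⟩
    | smul c T _ h =>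
      obtain ⟨a, rfl⟩ := h
      exact ⟨c • a, (opI_smul _ _).symm⟩
  · rintro ⟨a, rfl⟩
    simpa [opWord_zero] using opWord_mul_opI_mem (γ := γ) (n := 0) Fin.elim0 a

theorem opI_mem_wordSpan (a : C(K, ℂ)) : opI γ a ∈ wordSpan γ 0 := mem_wordSpan_zero.2 ⟨a, rfl⟩

theorem opS_mul_mem {n : ℕ} (ξ : Corr γ) {e : cuntzPimsner γ} (he : e ∈ wordSpan γ n) :
    opS γ ξ * e ∈ wordSpan γ (n + 1) := by
  induction he using Submodule.span_induction with
  | mem e he =>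
    obtain ⟨ζ, a, rfl⟩ := he
    rw [← mul_assoc]
    have := opWord_mul_opI_mem (γ := γ) (Fin.cons ξ ζ : Fin (n + 1) → Corr γ) a
    rwa [opWord_succ, Fin.cons_zero, Fin.tail_cons] at this
  | zero => rw [mul_zero]; exact zero_mem _
  | add e f _ _ h h' => rw [mul_add]; exact add_mem h h'
  | smul c e _ h => rw [mul_smul_comm]; exact Submodule.smul_mem _ _ h

/-- To check a linear condition on words of length `n + 1`, it suffices to check it on products
of a generator and a word of length `n`. -/
theorem wordSpan_succ_le {n : ℕ} {P : Submodule ℂ (cuntzPimsner γ)}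
    (h : ∀ ξ, ∀ e ∈ wordSpan γ n, opS γ ξ * e ∈ P) : wordSpan γ (n + 1) ≤ P := by
  refine Submodule.span_le.2 ?_
  rintro _ ⟨ξ, a, rfl⟩
  rw [opWord_succ, mul_assoc]
  exact h _ _ (opWord_mul_opI_mem _ _)

theorem opI_mul_mem {n : ℕ} (a : C(K, ℂ)) {e : cuntzPimsner γ} (he : e ∈ wordSpan γ n) :
    opI γ a * e ∈ wordSpan γ n := by
  cases n with
  | zero =>
    obtain ⟨a', rfl⟩ := mem_wordSpan_zero.1 he
    rw [← opI_mul]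
    exact opI_mem_wordSpan _
  | succ n =>
    refine wordSpan_succ_le (P := (wordSpan γ (n + 1)).comap (LinearMap.mulLeft ℂ (opI γ a)))
      (fun ξ f hf => ?_) he
    rw [Submodule.mem_comap, LinearMap.mulLeft_apply, ← mul_assoc, opI_mul_opS]
    exact opS_mul_mem _ hf

theorem mul_opI_mem {n : ℕ} (a : C(K, ℂ)) {e : cuntzPimsner γ} (he : e ∈ wordSpan γ n) :
    e * opI γ a ∈ wordSpan γ n := by
  induction he using Submodule.span_induction with
  | mem e he =>
    obtain ⟨ζ, a', rfl⟩ := he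
    rw [mul_assoc, ← opI_mul]
    exact opWord_mul_opI_mem _ _
  | zero => rw [zero_mul]; exact zero_mem _
  | add e f _ _ h h' => rw [add_mul]; exact add_mem h h'
  | smul c e _ h => rw [smul_mul_assoc]; exact Submodule.smul_mem _ _ h

theorem star_opS_mul_mem {n : ℕ} (ξ : Corr γ) {e : cuntzPimsner γ}
    (he : e ∈ wordSpan γ (n + 1)) : star (opS γ ξ) * e ∈ wordSpan γ n := by
  refine wordSpan_succ_le (P := (wordSpan γ n).comap (LinearMap.mulLeft ℂ (star (opS γ ξ))))
    (fun η f hf => ?_) he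
  rw [Submodule.mem_comap, LinearMap.mulLeft_apply, ← mul_assoc, star_opS_mul_opS]
  exact opI_mul_mem _ hf

theorem mul_mem_wordSpan {m n : ℕ} {e f : cuntzPimsner γ} (he : e ∈ wordSpan γ m)
    (hf : f ∈ wordSpan γ n) : e * f ∈ wordSpan γ (m + n) := by
  induction m generalizing e with
  | zero =>
    obtain ⟨a, rfl⟩ := mem_wordSpan_zero.1 he
    rw [zero_add]
    exact opI_mul_mem a hf
  | succ m ih =>
    refine wordSpan_succ_le (P := (wordSpan γ (m + 1 + n)).comap (LinearMap.mulRight ℂ f))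
      (fun η g hg => ?_) he
    rw [Submodule.mem_comap, LinearMap.mulRight_apply, mul_assoc, add_right_comm]
    exact opS_mul_mem _ (ih hg)

theorem star_mul_mem {m n : ℕ} {e f : cuntzPimsner γ} (he : e ∈ wordSpan γ m)
    (hf : f ∈ wordSpan γ (m + n)) : star e * f ∈ wordSpan γ n := by
  induction m generalizing e f with
  | zero =>
    obtain ⟨a, rfl⟩ := mem_wordSpan_zero.1 he
    rw [zero_add] at hf
    rw [← opI_star]
    exact opI_mul_mem _ hf
  | succ m ih =>
    have key : wordSpan γ (m + 1) ≤
        { carrier := {e | star e * f ∈ wordSpan γ n}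
          add_mem' := fun {a b} ha hb => by
            rw [Set.mem_ofPred_eq, star_add, add_mul]
            exact add_mem ha hb
          zero_mem' := by simp
          smul_mem' := fun c a ha => by
            rw [Set.mem_ofPred_eq, star_smul, smul_mul_assoc]
            exact Submodule.smul_mem _ _ ha } := by
      refine wordSpan_succ_le fun ξ g hg => ?_
      change star (opS γ ξ * g) * f ∈ wordSpan γ n
      rw [star_mul, mul_assoc]
      rw [add_right_comm] at hf
      exact ih hg (star_opS_mul_mem ξ hf)
    exact key he

theorem gauge_wordSpan {n : ℕ} {e : cuntzPimsner γ} (he : e ∈ wordSpan γ n) (z : Circle) :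
    gauge γ z e = (z : ℂ) ^ n • e := by
  induction n generalizing e with
  | zero =>
    obtain ⟨a, rfl⟩ := mem_wordSpan_zero.1 he
    rw [gauge_opI, pow_zero, one_smul]
  | succ n ih =>
    have := wordSpan_succ_le (n := n) (P := LinearMap.eqLocus (gauge γ z).toAlgHom.toLinearMap
      ((z : ℂ) ^ (n + 1) • LinearMap.id)) (fun ξ f hf => ?_) he
    · exact this
    · change gauge γ z (opS γ ξ * f) = (z : ℂ) ^ (n + 1) • (opS γ ξ * f)
      rw [map_mul, gauge_opS, ih hf, smul_mul_smul_comm, pow_succ']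

/-- `e f*` is in the core when `e` and `f` are words of the same length. -/
theorem mul_star_mem_core {n : ℕ} {e f : cuntzPimsner γ} (he : e ∈ wordSpan γ n)
    (hf : f ∈ wordSpan γ n) : e * star f ∈ core γ := by
  intro z
  rw [map_mul, map_star, gauge_wordSpan he, gauge_wordSpan hf, star_smul, smul_mul_smul_comm,
    star_pow, ← mul_pow, mul_star_circle, one_pow, one_smul]

/-- `e* T f` is in the core when `T` is and `e` and `f` are words of the same length. -/
theorem star_mul_mul_mem_core {n : ℕ} {e f T : cuntzPimsner γ} (he : e ∈ wordSpan γ n)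
    (hT : T ∈ core γ) (hf : f ∈ wordSpan γ n) : star e * T * f ∈ core γ := by
  intro z
  rw [map_mul, map_mul, map_star, gauge_wordSpan he, gauge_wordSpan hf, hT z, star_smul,
    smul_mul_assoc, smul_mul_smul_comm, star_pow, ← mul_pow, mul_comm (star _), mul_star_circle,
    one_pow, one_smul]

theorem mul_mul_star_mem_core {n : ℕ} {e f T : cuntzPimsner γ} (he : e ∈ wordSpan γ n)
    (hT : T ∈ core γ) (hf : f ∈ wordSpan γ n) : e * T * star f ∈ core γ := by
  intro z
  rw [map_mul, map_mul, map_star, gauge_wordSpan he, gauge_wordSpan hf, hT z, star_smul,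
    smul_mul_assoc, smul_mul_smul_comm, star_pow, ← mul_pow, mul_star_circle, one_pow, one_smul]

/-- The span of the monomials `e f*` with `e` a word of length `n` and `f` a word of length `m`. -/
def monomials (γ : Fin N → C(K, K)) (n m : ℕ) : Set (cuntzPimsner γ) :=
  {T | ∃ e ∈ wordSpan γ n, ∃ f ∈ wordSpan γ m, T = e * star f}

/-- The span of all monomials. -/
def monomialSpan (γ : Fin N → C(K, K)) : Submodule ℂ (cuntzPimsner γ) :=
  Submodule.span ℂ (⋃ p : ℕ × ℕ, monomials γ p.1 p.2)

/-- The algebraic part of the core. -/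
def coreSpan (γ : Fin N → C(K, K)) : Submodule ℂ (cuntzPimsner γ) :=
  Submodule.span ℂ (⋃ n : ℕ, monomials γ n n)

theorem monomials_subset {n m : ℕ} : monomials γ n m ⊆ monomialSpan γ :=
  fun _ hT => Submodule.subset_span (Set.mem_iUnion.2 ⟨(n, m), hT⟩)

/-- The relation S_ξ^* S_η = (ξ|η)_A shortens a word on its left; this is the induction step showing
that the monomials span a dense subspace of the algebra. -/
theorem star_gens_mul_mem {x : RepProd γ} (hx : x ∈ gens γ ∪ star (gens γ)) {T : cuntzPimsner γ}
    (hT : T ∈ monomialSpan γ) : ∃ T' ∈ monomialSpan γ, (T' : RepProd γ) = x * T := by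
  have key : ∀ g : cuntzPimsner γ,
      (∀ n m, ∀ e ∈ wordSpan γ n, ∀ f ∈ wordSpan γ m, g * (e * star f) ∈ monomialSpan γ) →
      ∃ T' ∈ monomialSpan γ, (T' : RepProd γ) = g * T := by
    intro g hg
    refine ⟨g * T, ?_, rfl⟩
    have : monomialSpan γ ≤ (monomialSpan γ).comap (LinearMap.mulLeft ℂ g) := by
      refine Submodule.span_le.2 ?_
      intro T hT
      obtain ⟨⟨n, m⟩, e, he, f, hf, rfl⟩ := Set.mem_iUnion.1 hT
      exact hg n m e he f hf
    exact this hT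
  have hI : ∀ a n m, ∀ e ∈ wordSpan γ n, ∀ f ∈ wordSpan γ m,
      opI γ a * (e * star f) ∈ monomialSpan γ := fun a n m e he f hf =>
    monomials_subset ⟨_, opI_mul_mem a he, f, hf, (mul_assoc _ _ _).symm⟩
  rcases hx with (⟨a, rfl⟩ | ⟨ξ, rfl⟩) | hx
  · exact key (opI γ a) (hI a)
  · exact key (opS γ ξ) fun n m e he f hf =>
      monomials_subset ⟨_, opS_mul_mem ξ he, f, hf, (mul_assoc _ _ _).symm⟩
  · rcases hx with ⟨a, ha⟩ | ⟨ξ, hξ⟩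
    · have hx : x = (opI γ (star a) : cuntzPimsner γ) := by
        rw [← star_star x, ← ha, opI_star]
        rfl
      rw [hx]
      exact key _ (hI _)
    · have hx : x = (star (opS γ ξ) : cuntzPimsner γ) := by
        rw [← star_star x, ← hξ]
        rfl
      rw [hx]
      refine key _ fun n m e he f hf => ?_
      cases n with
      | zero =>
        obtain ⟨a, rfl⟩ := mem_wordSpan_zero.1 he
        -- With no letter left to cancel, S_ξ^* is absorbed on the right: S_ξ^* a f* = 1·(f a*
        -- S_ξ)*.
        refine monomials_subset (n := 0) (m := m + 1) ⟨opI γ 1, opI_mem_wordSpan _,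
          f * (opI γ (star a) * opS γ ξ), mul_mem_wordSpan hf ?_, ?_⟩
        · rw [opI_mul_opS]
          simpa [opI_one] using opS_mul_mem (n := 0) (leftAct γ (star a) ξ) (opI_mem_wordSpan 1)
        · rw [star_mul, star_mul, opI_star, star_star, opI_one, one_mul, mul_assoc]
      | succ n =>
        exact monomials_subset ⟨_, star_opS_mul_mem ξ he, f, hf, (mul_assoc _ _ _).symm⟩

theorem adjoin_subset_monomialSpan {x : RepProd γ} (hx : x ∈ StarAlgebra.adjoin ℂ (gens γ)) :
    ∃ T ∈ monomialSpan γ, (T : RepProd γ) = x := by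
  have hx' : x ∈ Algebra.adjoin ℂ (gens γ ∪ star (gens γ)) := hx
  rw [← Subalgebra.mem_toSubmodule, Algebra.adjoin_eq_span] at hx'
  have hspan : Submodule.span ℂ (Submonoid.closure (gens γ ∪ star (gens γ)) : Set (RepProd γ)) ≤
      (monomialSpan γ).map (cuntzPimsner γ).toSubalgebra.val.toLinearMap := by
    refine Submodule.span_le.2 fun y hy => ?_
    induction hy using Submonoid.closure_induction_left with
    | one =>
      refine ⟨1, monomials_subset (n := 0) (m := 0) ⟨opI γ 1, opI_mem_wordSpan _, opI γ 1,
        opI_mem_wordSpan _, by simp [opI_one]⟩, rfl⟩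
    | mul_left g hg y _ ih =>
      obtain ⟨T, hT, rfl⟩ := ih
      obtain ⟨T', hT', h⟩ := star_gens_mul_mem hg hT
      exact ⟨T', hT', h⟩
  obtain ⟨T, hT, h⟩ := hspan hx'
  exact ⟨T, hT, h⟩

theorem norm_gauge_le (z : Circle) (T : cuntzPimsner γ) : ‖gauge γ z T‖ ≤ ‖T‖ :=
  NonUnitalStarAlgHom.norm_apply_le (gauge γ z) T

/-- A primitive root of unity on the circle. -/
theorem exists_circle_primitiveRoot {D : ℕ} (hD : D ≠ 0) :
    ∃ z : Circle, IsPrimitiveRoot (z : ℂ) D := by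
  have h := Complex.isPrimitiveRoot_exp D hD
  exact ⟨⟨_, mem_sphere_zero_iff_norm.2 (h.norm'_eq_one hD)⟩, h⟩

/-- The average of an element over the gauge action of a finite cyclic group. -/
def gaugeAverage (γ : Fin N → C(K, K)) (z : Circle) (D : ℕ) :
    cuntzPimsner γ →ₗ[ℂ] cuntzPimsner γ :=
  (D : ℂ)⁻¹ • ∑ k ∈ Finset.range D, (gauge γ (z ^ k)).toAlgHom.toLinearMap

theorem gaugeAverage_apply (z : Circle) (D : ℕ) (T : cuntzPimsner γ) :
    gaugeAverage γ z D T = (D : ℂ)⁻¹ • ∑ k ∈ Finset.range D, gauge γ (z ^ k) T := by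
  simp [gaugeAverage]

theorem norm_gaugeAverage_le (z : Circle) (D : ℕ) (T : cuntzPimsner γ) :
    ‖gaugeAverage γ z D T‖ ≤ ‖T‖ := by
  rw [gaugeAverage_apply, norm_smul, norm_inv, Complex.norm_natCast]
  have : ‖∑ k ∈ Finset.range D, gauge γ (z ^ k) T‖ ≤ D * ‖T‖ := by
    simpa using norm_sum_le_of_le (Finset.range D) fun k _ => norm_gauge_le (γ := γ) (z ^ k) T
  rcases Nat.eq_zero_or_pos D with rfl | hD
  · simp
  · rw [inv_mul_le_iff₀ (by positivity)]
    exact this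

theorem gaugeAverage_of_mem_core (z : Circle) {D : ℕ} (hD : D ≠ 0) {T : cuntzPimsner γ}
    (hT : T ∈ core γ) : gaugeAverage γ z D T = T := by
  rw [gaugeAverage_apply, Finset.sum_congr rfl fun k _ => hT (z ^ k), Finset.sum_const,
    Finset.card_range, ← Nat.cast_smul_eq_nsmul ℂ, smul_smul, inv_mul_cancel₀, one_smul]
  exact Nat.cast_ne_zero.2 hD

/-- On e f* the gauge action is multiplication by z^{n-m}. For distinct n, m < D this is a
nontrivial D-th root of unity, so the geometric sum over the cyclic group vanishes. -/
theorem gaugeAverage_monomial {z : Circle} {D : ℕ} (hz : IsPrimitiveRoot (z : ℂ) D) {n m : ℕ}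
    (hn : n < D) (hm : m < D) (hnm : n ≠ m) {T : cuntzPimsner γ} (hT : T ∈ monomials γ n m) :
    gaugeAverage γ z D T = 0 := by
  obtain ⟨e, he, f, hf, rfl⟩ := hT
  have h1 : ∀ k, gauge γ (z ^ k) (e * star f) =
      (((z : ℂ) ^ n * star ((z : ℂ) ^ m)) ^ k) • (e * star f) := by
    intro k
    rw [map_mul, map_star, gauge_wordSpan he, gauge_wordSpan hf, star_smul, smul_mul_smul_comm]
    congr 1
    rw [Circle.coe_pow, mul_pow, ← star_pow, ← pow_mul, ← pow_mul, ← pow_mul, ← pow_mul,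
      mul_comm k n, mul_comm k m]
  rw [gaugeAverage_apply, Finset.sum_congr rfl fun k _ => h1 k, ← Finset.sum_smul]
  set w : ℂ := (z : ℂ) ^ n * star ((z : ℂ) ^ m) with hw
  have hwD : w ^ D = 1 := by
    rw [hw, mul_pow, ← star_pow, ← pow_mul, ← pow_mul, mul_comm n, mul_comm m, pow_mul, pow_mul,
      hz.pow_eq_one]
    simp
  have hw1 : w ≠ 1 := by
    intro h
    refine hnm (hz.pow_inj hn hm ?_)
    have h2 : star ((z : ℂ) ^ m) * (z : ℂ) ^ m = 1 := by
      rw [star_pow, ← mul_pow, mul_comm, mul_star_circle, one_pow]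
    calc (z : ℂ) ^ n = (z : ℂ) ^ n * (star ((z : ℂ) ^ m) * (z : ℂ) ^ m) := by rw [h2, mul_one]
      _ = w * (z : ℂ) ^ m := by rw [hw, mul_assoc]
      _ = (z : ℂ) ^ m := by rw [h, one_mul]
  have hsum : ∑ k ∈ Finset.range D, w ^ k = 0 := by
    rw [geom_sum_eq hw1, hwD, sub_self, zero_div]
  rw [hsum, zero_smul, smul_zero]

/-- Only finitely many word lengths occur, so a sufficiently large cyclic group removes all
unbalanced monomials and fixes the balanced ones. -/
theorem exists_gaugeAverage_mem {T : cuntzPimsner γ} (hT : T ∈ monomialSpan γ) :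
    ∃ D₀ : ℕ, ∀ D > D₀, ∀ z : Circle, IsPrimitiveRoot (z : ℂ) D →
      gaugeAverage γ z D T ∈ coreSpan γ := by
  induction hT using Submodule.span_induction with
  | mem T hT =>
    obtain ⟨⟨n, m⟩, hT⟩ := Set.mem_iUnion.1 hT
    refine ⟨max n m, fun D hD z hz => ?_⟩
    by_cases hnm : n = m
    · subst hnm
      have hT' := hT
      obtain ⟨e, he, f, hf, rfl⟩ := hT
      rw [gaugeAverage_of_mem_core z (by omega) (mul_star_mem_core he hf)]
      exact Submodule.subset_span (Set.mem_iUnion.2 ⟨n, hT'⟩)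
    · rw [gaugeAverage_monomial hz (lt_of_le_of_lt (le_max_left _ _) hD)
        (lt_of_le_of_lt (le_max_right _ _) hD) hnm hT]
      exact zero_mem _
  | zero => exact ⟨0, fun D _ z _ => by rw [map_zero]; exact zero_mem _⟩
  | add T T' _ _ h h' =>
    obtain ⟨D₁, h₁⟩ := h
    obtain ⟨D₂, h₂⟩ := h'
    refine ⟨max D₁ D₂, fun D hD z hz => ?_⟩
    rw [map_add]
    exact add_mem (h₁ D (lt_of_le_of_lt (le_max_left _ _) hD) z hz)
      (h₂ D (lt_of_le_of_lt (le_max_right _ _) hD) z hz)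
  | smul c T _ h =>
    obtain ⟨D₁, h₁⟩ := h
    refine ⟨D₁, fun D hD z hz => ?_⟩
    rw [map_smul]
    exact Submodule.smul_mem _ _ (h₁ D hD z hz)

/-- The core is the closure of its algebraic part. -/
theorem exists_coreSpan_near {T : cuntzPimsner γ} (hT : T ∈ core γ) {ε : ℝ} (hε : 0 < ε) :
    ∃ p ∈ coreSpan γ, ‖T - p‖ < ε := by
  obtain ⟨x, hx, hTx⟩ := Metric.mem_closure_iff.1 T.2 ε hε
  obtain ⟨p, hp, rfl⟩ := adjoin_subset_monomialSpan hx
  obtain ⟨D₀, hD₀⟩ := exists_gaugeAverage_mem hp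
  obtain ⟨z, hz⟩ := exists_circle_primitiveRoot (Nat.succ_ne_zero D₀)
  refine ⟨_, hD₀ _ (Nat.lt_succ_self _) z hz, ?_⟩
  -- Averaging fixes the core and does not increase norms, so it turns an approximation by monomials
  -- into one by balanced monomials.
  have h1 : T - gaugeAverage γ z (D₀ + 1) p = gaugeAverage γ z (D₀ + 1) (T - p) := by
    rw [map_sub, gaugeAverage_of_mem_core z (Nat.succ_ne_zero _) hT]
  rw [h1]
  refine (norm_gaugeAverage_le _ _ _).trans_lt ?_
  rwa [dist_eq_norm] at hTx

theorem coreSpan_le_core {T : cuntzPimsner γ} (hT : T ∈ coreSpan γ) : T ∈ core γ := by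
  have : coreSpan γ ≤ (core γ).toSubalgebra.toSubmodule := by
    refine Submodule.span_le.2 fun T hT => ?_
    obtain ⟨n, e, he, f, hf, rfl⟩ := Set.mem_iUnion.1 hT
    exact mul_star_mem_core he hf
  exact this hT

end Algebra

/-! ### The core acting on the levels of the forward trees -/

section Levels

variable {K : Type u} [MetricSpace K] [CompactSpace K] {N : ℕ} {γ : Fin N → C(K, K)}

/-- The standing assumptions, together with the density of the good set. -/
structure IsAdmissible (γ : Fin N → C(K, K)) (h : C(K, K)) : Prop extends HasInverse γ h where
  dense : Dense (goodSet γ)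
  selfSimilar : IsSelfSimilarMap γ
  two_le : 2 ≤ N

/-- Induction over words. -/
theorem wordSpan_induction {P : ℕ → cuntzPimsner γ → Prop} (zero : ∀ n, P n 0)
    (add : ∀ n e f, P n e → P n f → P n (e + f)) (base : ∀ a, P 0 (opI γ a))
    (step : ∀ n ξ, ∀ e ∈ wordSpan γ n, P n e → P (n + 1) (opS γ ξ * e)) {n : ℕ}
    {e : cuntzPimsner γ} (he : e ∈ wordSpan γ n) : P n e := by
  have key : ∀ n (ξ : Fin n → Corr γ) (a : C(K, ℂ)), P n (opWord γ ξ * opI γ a) := by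
    intro n
    induction n with
    | zero => intro ξ a; rw [opWord_zero, one_mul]; exact base a
    | succ n ih =>
      intro ξ a
      rw [opWord_succ, mul_assoc]
      exact step n _ _ (opWord_mul_opI_mem _ _) (ih _ _)
  induction he using Submodule.closure_induction with
  | zero => exact zero n
  | add e f _ _ h h' => exact add n e f h h'
  | smul_mem c e he =>
    obtain ⟨ξ, a, rfl⟩ := he
    rw [← mul_smul_comm, ← opI_smul]
    exact key _ _ _

variable [Nonempty K] {h : C(K, K)} (H : IsAdmissible γ h)

/-- The Cuntz–Pimsner algebra acting on `ℓ²` of the good set. -/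
def IsAdmissible.eval : cuntzPimsner γ →⋆ₐ[ℂ] (GoodL2 γ →L[ℂ] GoodL2 γ) where
  toFun T := T.1 (H.rep H.dense)
  map_one' := rfl
  map_mul' _ _ := rfl
  map_zero' := rfl
  map_add' _ _ := rfl
  commutes' _ := rfl
  map_star' _ := rfl

theorem IsAdmissible.eval_opI (a : C(K, ℂ)) : H.eval (opI γ a) = repI γ a := rfl

theorem IsAdmissible.eval_opS (ξ : Corr γ) : H.eval (opS γ ξ) = repS ξ := rfl

theorem IsAdmissible.norm_eval_le (T : cuntzPimsner γ) : ‖H.eval T‖ ≤ ‖T‖ :=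
  NonUnitalStarAlgHom.norm_apply_le H.eval T

theorem IsAdmissible.norm_eval_apply_le (T : cuntzPimsner γ) (g : GoodL2 γ) (y : goodSet γ) :
    ‖H.eval T g y‖ ≤ ‖T‖ * ‖g‖ :=
  (lp.norm_apply_le_norm (by norm_num) _ y).trans <| ((H.eval T).le_opNorm g).trans <| by
    gcongr
    exact H.norm_eval_le T

theorem IsAdmissible.eval_mul_apply (T T' : cuntzPimsner γ) (g : GoodL2 γ) :
    H.eval (T * T') g = H.eval T (H.eval T' g) := by
  rw [map_mul]
  rfl

theorem IsAdmissible.eval_add_apply (T T' : cuntzPimsner γ) (g : GoodL2 γ) :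
    H.eval (T + T') g = H.eval T g + H.eval T' g := by
  rw [map_add]
  rfl

theorem IsAdmissible.eval_sub_apply (T T' : cuntzPimsner γ) (g : GoodL2 γ) :
    H.eval (T - T') g = H.eval T g - H.eval T' g := by
  rw [map_sub]
  rfl

theorem IsAdmissible.eval_smul_apply (c : ℂ) (T : cuntzPimsner γ) (g : GoodL2 γ) :
    H.eval (c • T) g = c • H.eval T g := by
  rw [map_smul]
  rfl

theorem IsAdmissible.eval_star_opS_apply (ξ : Corr γ) (g : GoodL2 γ) (y : goodSet γ) :
    H.eval (star (opS γ ξ)) g y = ∑ j, star (ξ (cographPt γ j y)) * g (goodMap γ j y) := by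
  rw [map_star]
  exact H.star_repS_apply ξ g y

omit [Nonempty K] in
/-- The subspace of `ℓ²` of the families supported on `O_{b,r}`. -/
def level (γ : Fin N → C(K, K)) (b : K) (r : ℕ) : Submodule ℂ (GoodL2 γ) where
  carrier := {g | ∀ y : goodSet γ, (y : K) ∉ orbit γ b r → g y = 0}
  add_mem' {g g'} hg hg' y hy := by
    rw [lp.coeFn_add, Pi.add_apply, hg y hy, hg' y hy, add_zero]
  zero_mem' _ _ := rfl
  smul_mem' c g hg y hy := by
    rw [lp.coeFn_smul, Pi.smul_apply, hg y hy, smul_zero]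

theorem isClosed_level (b : K) (r : ℕ) : IsClosed (level γ b r : Set (GoodL2 γ)) := by
  have : (level γ b r : Set (GoodL2 γ)) =
      ⋂ y : goodSet γ, ⋂ _ : (y : K) ∉ orbit γ b r, {g : GoodL2 γ | g y = 0} := by
    ext g
    simp only [Set.mem_iInter]
    exact Iff.rfl
  rw [this]
  refine isClosed_iInter fun y => isClosed_iInter fun _ => ?_
  have hc : Continuous fun g : GoodL2 γ => g y :=
    (continuous_apply y).comp lp.uniformContinuous_coe.continuous
  exact isClosed_eq hc continuous_const

include H

theorem IsAdmissible.opS_mem_level {b : K} {r : ℕ} (ξ : Corr γ)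
    {g : GoodL2 γ} (hg : g ∈ level γ b r) : H.eval (opS γ ξ) g ∈ level γ b (r + 1) := by
  intro x hx
  rw [H.eval_opS]
  rcases H.eq_goodMap_or_mem x with hxB | ⟨j, y, rfl⟩
  · exact H.repS_apply_of_mem _ _ hxB
  · rw [H.repS_apply, hg y fun hy => hx (mem_orbit_succ.2 ⟨j, y, hy, rfl⟩), mul_zero]

theorem IsAdmissible.star_opS_mem_level {b : K} {r : ℕ} (ξ : Corr γ)
    {g : GoodL2 γ} (hg : g ∈ level γ b (r + 1)) : H.eval (star (opS γ ξ)) g ∈ level γ b r := by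
  intro y hy
  rw [H.eval_star_opS_apply]
  refine Finset.sum_eq_zero fun j _ => ?_
  rw [hg (goodMap γ j y), mul_zero]
  intro hm
  obtain ⟨i, z, hz, he⟩ := mem_orbit_succ.1 hm
  rw [H.map_injective he] at hz
  exact hy hz

/-- S_ξ^* reads a vector only at image points γ_j(y), and the root is never such a point. -/
theorem IsAdmissible.star_opS_level_zero {b : K} (hb : b ∈ branchSet γ) (ξ : Corr γ)
    {g : GoodL2 γ} (hg : g ∈ level γ b 0) : H.eval (star (opS γ ξ)) g = 0 := by
  ext y
  rw [H.eval_star_opS_apply]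
  refine Finset.sum_eq_zero fun j _ => ?_
  rw [hg (goodMap γ j y), mul_zero]
  intro hm
  rw [orbit_zero] at hm
  exact H.map_notMem y.2 j (by rw [show γ j y = b from hm]; exact hb)

theorem IsAdmissible.opI_mem_level {b : K} {r : ℕ} (a : C(K, ℂ))
    {g : GoodL2 γ} (hg : g ∈ level γ b r) : H.eval (opI γ a) g ∈ level γ b r := by
  intro y hy
  rw [H.eval_opI, repI_apply, hg y hy, mul_zero]

theorem IsAdmissible.word_mem_level {b : K} {n r : ℕ} {e : cuntzPimsner γ}
    (he : e ∈ wordSpan γ n) {g : GoodL2 γ} (hg : g ∈ level γ b r) :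
    H.eval e g ∈ level γ b (r + n) := by
  refine wordSpan_induction (P := fun n e => H.eval e g ∈ level γ b (r + n)) (fun n => ?_)
    (fun n e f he hf => ?_) (fun a => H.opI_mem_level a hg) (fun n ξ e _ he => ?_) he
  · rw [map_zero]
    exact zero_mem _
  · rw [H.eval_add_apply]
    exact add_mem he hf
  · rw [H.eval_mul_apply]
    exact H.opS_mem_level ξ he

theorem IsAdmissible.star_word_mem_level {b : K} {n r : ℕ}
    {e : cuntzPimsner γ} (he : e ∈ wordSpan γ n) {g : GoodL2 γ} (hg : g ∈ level γ b (r + n)) :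
    H.eval (star e) g ∈ level γ b r := by
  refine wordSpan_induction
    (P := fun n e => ∀ g ∈ level γ b (r + n), H.eval (star e) g ∈ level γ b r) (fun n g _ => ?_)
    (fun n e f he hf g hg => ?_) (fun a g hg => ?_) (fun n ξ e _ he g hg => ?_) he g hg
  · rw [star_zero, map_zero]
    exact zero_mem _
  · rw [star_add, H.eval_add_apply]
    exact add_mem (he g hg) (hf g hg)
  · rw [← opI_star]
    exact H.opI_mem_level _ hg
  · rw [star_mul, H.eval_mul_apply]
    exact he _ (H.star_opS_mem_level ξ hg)

/-- The first r adjoints bring the vector down to the root, and the next one annihilates it. -/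
theorem IsAdmissible.star_word_level_eq_zero {b : K} (hb : b ∈ branchSet γ) {n r : ℕ}
    {e : cuntzPimsner γ} (he : e ∈ wordSpan γ n) (hr : r < n) {g : GoodL2 γ}
    (hg : g ∈ level γ b r) : H.eval (star e) g = 0 := by
  refine wordSpan_induction
    (P := fun n e => ∀ r < n, ∀ g ∈ level γ b r, H.eval (star e) g = 0) (fun n r _ g _ => ?_)
    (fun n e f he hf r hr g hg => ?_) (fun a r hr => ?_) (fun n ξ e _ he r hr g hg => ?_)
    he r hr g hg
  · rw [star_zero, map_zero]
    rfl
  · rw [star_add, H.eval_add_apply, he r hr g hg, hf r hr g hg, add_zero]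
  · omega
  · rw [star_mul, H.eval_mul_apply]
    cases r with
    | zero => rw [H.star_opS_level_zero hb ξ hg, map_zero]
    | succ r => exact he r (by omega) _ (H.star_opS_mem_level ξ hg)

theorem IsAdmissible.continuous_eval_apply (g : GoodL2 γ) :
    Continuous fun T : cuntzPimsner γ => H.eval T g := by
  have : Continuous H.eval := AddMonoidHomClass.continuous_of_bound H.eval 1 fun T => by
    rw [one_mul]; exact H.norm_eval_le T
  exact (ContinuousLinearMap.apply ℂ (GoodL2 γ) g).continuous.comp this

/-- A balanced monomial e f* descends n levels and climbs back n levels, or gives zero when n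
exceeds the depth. The level is closed, so limits preserve it. -/
theorem IsAdmissible.core_mem_level {b : K} (hb : b ∈ branchSet γ) {r : ℕ} {T : cuntzPimsner γ}
    (hT : T ∈ core γ) {g : GoodL2 γ} (hg : g ∈ level γ b r) : H.eval T g ∈ level γ b r := by
  have hspan : ∀ p ∈ coreSpan γ, H.eval p g ∈ level γ b r := by
    intro p hp
    induction hp using Submodule.span_induction with
    | mem p hp =>
      obtain ⟨n, e, he, f, hf, rfl⟩ := Set.mem_iUnion.1 hp
      rw [H.eval_mul_apply]
      rcases lt_or_ge r n with hrn | hrn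
      · rw [H.star_word_level_eq_zero hb hf hrn hg, map_zero]
        exact zero_mem _
      · obtain ⟨k, rfl⟩ := Nat.exists_eq_add_of_le' hrn
        exact H.word_mem_level he (H.star_word_mem_level hf hg)
    | zero => rw [map_zero]; exact zero_mem _
    | add p q _ _ h h' => rw [H.eval_add_apply]; exact add_mem h h'
    | smul c p _ h => rw [H.eval_smul_apply]; exact Submodule.smul_mem _ _ h
  have hcl : T ∈ closure (coreSpan γ : Set (cuntzPimsner γ)) := by
    refine Metric.mem_closure_iff.2 fun ε hε => ?_
    obtain ⟨p, hp, hTp⟩ := exists_coreSpan_near hT hε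
    exact ⟨p, hp, by rwa [dist_eq_norm]⟩
  have := map_mem_closure (H.continuous_eval_apply g) hcl (t := level γ b r) fun p hp => hspan p hp
  rwa [(isClosed_level b r).closure_eq] at this

omit H in
/-- The operators which vanish on a level. -/
def IsAdmissible.Kills (H : IsAdmissible γ h) (b : K) (r : ℕ) (T : cuntzPimsner γ) : Prop :=
  ∀ g ∈ level γ b r, H.eval T g = 0

/-- The ideal of the elements of the core which vanish on a level. -/
def IsAdmissible.levelIdeal {b : K} (hb : b ∈ branchSet γ) (r : ℕ) : TwoSidedIdeal (core γ) :=
  TwoSidedIdeal.mk' {T : core γ | H.Kills b r T}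
    (fun g _ => by
      change H.eval 0 g = 0
      rw [map_zero]
      rfl)
    (fun {T T'} hT hT' g hg => by
      change H.eval (T.1 + T'.1) g = 0
      rw [H.eval_add_apply, hT g hg, hT' g hg, add_zero])
    (fun {T} hT g hg => by
      change H.eval (-T.1) g = 0
      rw [map_neg]
      change -(H.eval T.1 g) = 0
      rw [hT g hg, neg_zero])
    (fun {R T} hT g hg => by
      change H.eval (R.1 * T.1) g = 0
      rw [H.eval_mul_apply, hT g hg, map_zero])
    (fun {T R} hT g hg => by
      change H.eval (T.1 * R.1) g = 0
      rw [H.eval_mul_apply]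
      exact hT _ (H.core_mem_level hb R.2 hg))

theorem IsAdmissible.mem_levelIdeal {b : K} (hb : b ∈ branchSet γ) {r : ℕ} {T : core γ} :
    T ∈ H.levelIdeal hb r ↔ H.Kills b r T := TwoSidedIdeal.mem_mk' _ _ _ _ _ _ _

theorem IsAdmissible.isClosed_kills (b : K) (r : ℕ) :
    IsClosed {T : cuntzPimsner γ | H.Kills b r T} := by
  have : {T : cuntzPimsner γ | H.Kills b r T} =
      ⋂ g : level γ b r, {T | H.eval T g = 0} := by
    ext T
    simp only [Set.mem_iInter]
    exact ⟨fun hT g => hT g.1 g.2, fun hT g hg => hT ⟨g, hg⟩⟩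
  rw [this]
  exact isClosed_iInter fun g => isClosed_eq (H.continuous_eval_apply g) continuous_const

theorem IsAdmissible.isClosed_levelIdeal {b : K} (hb : b ∈ branchSet γ) (r : ℕ) :
    IsClosed (H.levelIdeal hb r : Set (core γ)) := by
  have : (H.levelIdeal hb r : Set (core γ)) = Subtype.val ⁻¹' {T | H.Kills b r T} := by
    ext T
    exact H.mem_levelIdeal hb
  rw [this]
  exact (H.isClosed_kills b r).preimage continuous_subtype_val

omit H in
/-- On the next level, the identity is a sum of rank one operators. -/
theorem IsAdmissible.exists_frame (H : IsAdmissible γ h) {b : K} (hb : b ∈ branchSet γ) (r : ℕ) :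
    ∃ η : Fin N → Corr γ, ∀ g ∈ level γ b (r + 1),
      g = ∑ j, H.eval (opS γ (η j)) (H.eval (star (opS γ (η j))) g) := by
  classical
  -- On the finite orbit O_{b,r+1}, f_j interpolates the indicator of γ_j(O_{b,r}); these pieces are
  -- disjoint, so the pulled-back f_j form an orthonormal frame over O_{b,r}.
  choose f hf using fun j : Fin N => exists_interpolation (finite_orbit (γ := γ) b (r + 1))
    fun x => if x ∈ γ j '' orbit γ b r then 1 else 0
  have hfij : ∀ i j, ∀ y ∈ orbit γ b r, f j (γ i y) = if i = j then 1 else 0 := by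
    intro i j y hy
    rw [hf j _ (mem_orbit_succ.2 ⟨i, y, hy, rfl⟩)]
    congr 1
    rw [eq_iff_iff]
    constructor
    · rintro ⟨z, _, hzy⟩
      have := H.map_injective hzy
      subst this
      exact (H.index_injective (orbit_subset_goodSet hb _ hy) hzy).symm
    · rintro rfl
      exact ⟨y, hy, rfl⟩
  refine ⟨fun j => fstPull γ (f j), fun g hg => ?_⟩
  ext x
  rw [lp.coeFn_sum, Finset.sum_apply]
  rcases H.eq_goodMap_or_mem x with hxB | ⟨i, y, rfl⟩
  · rw [hg x, eq_comm]
    · exact Finset.sum_eq_zero fun j _ => H.repS_apply_of_mem _ _ hxB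
    · intro hx
      obtain ⟨j, y, hy, hjy⟩ := mem_orbit_succ.1 hx
      exact H.map_notMem (orbit_subset_goodSet hb _ hy) j (by rwa [hjy])
  · simp only [H.eval_opS, H.repS_apply, H.eval_star_opS_apply, fstPull_cographPt]
    by_cases hy : (y : K) ∈ orbit γ b r
    · simp only [hfij _ _ _ hy]
      simp
    · have hz : ∀ k, g (goodMap γ k y) = 0 := fun k => hg _ fun hm => by
        obtain ⟨i, z, hz, he⟩ := mem_orbit_succ.1 hm
        rw [H.map_injective he] at hz
        exact hy hz
      simp [hz]

/-- An element of the core vanishes on the level `r + 1` if and only if all its compressions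
vanish on the level `r`. -/
theorem IsAdmissible.kills_succ_iff {b : K} (hb : b ∈ branchSet γ) {r : ℕ} {T : cuntzPimsner γ}
    (hT : T ∈ core γ) :
    H.Kills b (r + 1) T ↔ ∀ ξ η, H.Kills b r (star (opS γ ξ) * T * opS γ η) := by
  constructor
  · intro hk ξ η g hg
    rw [H.eval_mul_apply, H.eval_mul_apply, hk _ (H.opS_mem_level η hg), map_zero]
  · intro hk g hg
    obtain ⟨η, hη⟩ := H.exists_frame hb r
    -- Inserting the frame on both sides of T expresses T g through the compressions S_{η_i}^* T
    -- S_{η_j}.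
    rw [hη _ (H.core_mem_level hb hT hg)]
    refine Finset.sum_eq_zero fun i _ => ?_
    have : H.eval (star (opS γ (η i))) (H.eval T g) = 0 := by
      conv_lhs => rw [hη g hg]
      rw [map_sum, map_sum]
      refine Finset.sum_eq_zero fun j _ => ?_
      have := hk (η i) (η j) _ (H.star_opS_mem_level (η j) hg)
      rwa [H.eval_mul_apply, H.eval_mul_apply] at this
    rw [this, map_zero]

end Levels

/-! ### Covariance -/

section Covariance

variable {K : Type u} [MetricSpace K] [CompactSpace K] {N : ℕ} {γ : Fin N → C(K, K)}
  {h : C(K, K)}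

open Classical in
/-- A function vanishing on the branch set, cut off to the image of `γ_j`. -/
theorem HasInverse.exists_cutoff (H : HasInverse γ h) {g : C(K, ℂ)}
    (hg : ∀ b ∈ branchSet γ, g b = 0) (j : Fin N) :
    ∃ f : C(K, ℂ), ∀ x, f x = if x ∈ Set.range (γ j) then g x else 0 := by
  refine ⟨⟨fun x => if x ∈ Set.range (γ j) then g x else 0, ?_⟩, fun x => rfl⟩
  refine Continuous.if (fun x hx => hg x ?_) g.continuous continuous_const
  by_contra hxB
  have hclosed : ∀ i, IsClosed (Set.range (γ i)) := fun i =>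
    (isCompact_range (γ i).continuous).isClosed
  have hxj : x ∈ Set.range (γ j) := (hclosed j).frontier_subset hx
  -- The complement of the other images is open and, by covering, contained in the image of γ_j. A
  -- point of that image which is not a branch point lies in this complement, hence in the interior.
  have hsub : (⋃ i ∈ {i | i ≠ j}, Set.range (γ i))ᶜ ⊆ Set.range (γ j) := by
    intro z hz
    obtain ⟨i, hi⟩ := H.cover z
    by_cases hij : i = j
    · rw [← hij]
      exact ⟨_, hi⟩
    · refine absurd ?_ hz
      simp only [Set.mem_iUnion]
      exact ⟨i, hij, _, hi⟩
  have hopen : IsOpen (⋃ i ∈ {i | i ≠ j}, Set.range (γ i))ᶜ :=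
    ((Set.toFinite _).isClosed_biUnion fun i _ => hclosed i).isOpen_compl
  have hmem : x ∈ (⋃ i ∈ {i | i ≠ j}, Set.range (γ i))ᶜ := by
    simp only [Set.mem_compl_iff, Set.mem_iUnion, not_exists]
    rintro i hij ⟨y, rfl⟩
    obtain ⟨z, hz⟩ := hxj
    obtain rfl := H.map_injective hz
    exact hxB ⟨z, i, j, hij, rfl, hz.symm⟩
  have : x ∈ interior (Set.range (γ j)) := mem_interior.2 ⟨_, hsub, hopen, hmem⟩
  exact hx.2 this

/-- The covariance relation for functions of the form `a g g*`, where `g` vanishes on the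
branch set. -/
theorem HasInverse.exists_covariance (H : HasInverse γ h) (a : C(K, ℂ)) {g : C(K, ℂ)}
    (hg : ∀ b ∈ branchSet γ, g b = 0) :
    ∃ ξ η : Fin N → Corr γ, opI γ (a * (g * star g)) = ∑ j, opS γ (ξ j) * star (opS γ (η j)) := by
  classical
  choose f hf using H.exists_cutoff hg
  -- At a non-branch image point γ_i(y) only f_i is nonzero there, with value g, and f_i vanishes at
  -- the other points over y. The sum of rank one operators is therefore multiplication by a g g*;
  -- at branch points both sides vanish.
  have hsum : leftAct γ (a * (g * star g)) =
      ∑ j, rankOne γ (fstPull γ (a * f j)) (fstPull γ (f j)) := by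
    ext ζ ⟨_, i, y, rfl⟩
    change leftAct γ (a * (g * star g)) ζ (cographPt γ i y) = _
    rw [sum_apply, ContinuousMap.sum_apply]
    change _ = ∑ j, rankOne γ (fstPull γ (a * f j)) (fstPull γ (f j)) ζ (cographPt γ i y)
    simp only [rankOne_apply, leftAct_apply, fstPull_cographPt, ContinuousMap.mul_apply,
      ContinuousMap.star_apply]
    by_cases hB : γ i y ∈ branchSet γ
    · rw [hg _ hB]
      have : ∀ j, f j (γ i y) = 0 := fun j => by rw [hf, hg _ hB, ite_self]
      simp [this]
    · have h1 : ∀ k l, γ k y ∉ branchSet γ → f l (γ k y) = if k = l then g (γ k y) else 0 := by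
        intro k l hk
        rw [hf]
        congr 1
        rw [eq_iff_iff]
        constructor
        · rintro ⟨z, hz⟩
          obtain rfl := H.map_injective hz
          by_contra hne
          exact hk ⟨z, k, l, hne, rfl, hz.symm⟩
        · rintro rfl
          exact ⟨y, rfl⟩
      have h2 : ∀ k, k ≠ i → f i (γ k y) = 0 := by
        intro k hk
        by_cases hkB : γ k y ∈ branchSet γ
        · rw [hf, hg _ hkB, ite_self]
        · rw [h1 k i hkB, if_neg hk]
      rw [Finset.sum_eq_single i, Finset.sum_eq_single i, h1 i i hB, if_pos rfl]
      · ring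
      · intro k _ hk
        rw [h2 k hk, star_zero, zero_mul]
      · simp
      · intro j _ hj
        rw [h1 i j hB, if_neg hj.symm, mul_zero, zero_mul]
      · simp
  refine ⟨fun j => fstPull γ (a * f j), fun j => fstPull γ (f j), ?_⟩
  have hmem : leftAct γ (a * (g * star g)) ∈ compactOps γ := by
    rw [hsum]
    exact sum_mem fun j _ => rankOne_mem γ _ _
  have hρ : ∀ ρ : CovRep γ, ρ.i (a * (g * star g)) =
      ∑ j, ρ.S (fstPull γ (a * f j)) * star (ρ.S (fstPull γ (f j))) := by
    intro ρ
    obtain ⟨iK, h1, h2⟩ := ρ.covariant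
    rw [h2 _ hmem]
    have : (⟨_, hmem⟩ : compactOps γ) =
        ∑ j, ⟨rankOne γ (fstPull γ (a * f j)) (fstPull γ (f j)), rankOne_mem γ _ _⟩ := by
      refine Subtype.ext (hsum.trans ?_)
      simp
    rw [this]
    refine (map_sum iK.toLinearMap _ _).trans ?_
    exact Finset.sum_congr rfl fun j _ => h1 _ _
  refine Subtype.ext <| lp.ext <| funext fun ρ => ?_
  refine (hρ ρ).trans ?_
  rw [show ((∑ j, opS γ (fstPull γ (a * f j)) * star (opS γ (fstPull γ (f j))) :
      cuntzPimsner γ) : RepProd γ) = ∑ j, univS γ (fstPull γ (a * f j)) *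
      star (univS γ (fstPull γ (f j))) by rw [AddSubmonoidClass.coe_finsetSum]; rfl]
  rw [lp.coeFn_sum, Finset.sum_apply]
  rfl

/-- Take g = 0 on B and g = 1 where |a| ≥ ε, with values in [0, 1]. Then a(1 - g²) is nonzero only
where |a| < ε. -/
theorem exists_vanishing_near {B : Set K} (hB : B.Finite) (a : C(K, ℂ)) {ε : ℝ} (hε : 0 < ε)
    (ha : ∀ b ∈ B, ‖a b‖ < ε) :
    ∃ g : C(K, ℂ), (∀ b ∈ B, g b = 0) ∧ ‖a - a * (g * star g)‖ ≤ ε := by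
  have hclosed : IsClosed {x | ε ≤ ‖a x‖} := isClosed_le continuous_const (by fun_prop)
  obtain ⟨f, h0, h1, hf⟩ := exists_continuous_zero_one_of_isClosed hB.isClosed hclosed
    (Set.disjoint_left.2 fun b hb hb' => absurd (ha b hb) (not_lt.2 hb'))
  refine ⟨⟨fun y => (f y : ℂ), by fun_prop⟩, fun b hb => by simpa using h0 hb, ?_⟩
  refine (ContinuousMap.norm_le _ hε.le).2 fun x => ?_
  have e : (a - a * (⟨fun y => (f y : ℂ), by fun_prop⟩ * star ⟨fun y => (f y : ℂ), by fun_prop⟩) :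
      C(K, ℂ)) x = a x * ((1 - f x ^ 2 : ℝ) : ℂ) := by
    simp only [ContinuousMap.sub_apply, ContinuousMap.mul_apply, ContinuousMap.star_apply,
      ContinuousMap.coe_mk, RCLike.star_def, Complex.conj_ofReal]
    push_cast
    ring
  rw [e, norm_mul, Complex.norm_real]
  have hfx := hf x
  by_cases hx : ε ≤ ‖a x‖
  · have : f x = 1 := h1 hx
    simp [this, hε.le]
  · have h2 : ‖(1 - f x ^ 2 : ℝ)‖ ≤ 1 := by
      rw [Real.norm_eq_abs, abs_le]
      constructor <;> nlinarith [hfx.1, hfx.2]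
    exact (mul_le_of_le_one_right (norm_nonneg _) h2).trans (not_le.1 hx).le

/-- The span of the monomials `e f*` with `e` and `f` words of the same positive length. -/
def posSpan (γ : Fin N → C(K, K)) : Submodule ℂ (cuntzPimsner γ) :=
  Submodule.span ℂ (⋃ n : ℕ, monomials γ (n + 1) (n + 1))

theorem mem_posSpan {n : ℕ} (hn : 0 < n) {T : cuntzPimsner γ} (hT : T ∈ monomials γ n n) :
    T ∈ posSpan γ := by
  obtain ⟨n, rfl⟩ := Nat.exists_eq_succ_of_ne_zero hn.ne'
  exact Submodule.subset_span (Set.mem_iUnion.2 ⟨n, hT⟩)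

theorem opS_mem_wordSpan (ξ : Corr γ) : opS γ ξ ∈ wordSpan γ 1 := by
  simpa [opI_one] using opS_mul_mem (n := 0) ξ (opI_mem_wordSpan 1)

theorem exists_add_of_mem_coreSpan {p : cuntzPimsner γ} (hp : p ∈ coreSpan γ) :
    ∃ a, ∃ t ∈ posSpan γ, p = opI γ a + t := by
  induction hp using Submodule.span_induction with
  | mem p hp =>
    obtain ⟨n, hp⟩ := Set.mem_iUnion.1 hp
    rcases Nat.eq_zero_or_pos n with rfl | hn
    · obtain ⟨e, he, f, hf, rfl⟩ := hp
      obtain ⟨a, rfl⟩ := mem_wordSpan_zero.1 he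
      obtain ⟨a', rfl⟩ := mem_wordSpan_zero.1 hf
      exact ⟨a * star a', 0, zero_mem _, by rw [opI_mul, opI_star, add_zero]⟩
    · exact ⟨0, p, mem_posSpan hn hp, by rw [opI_zero, zero_add]⟩
  | zero => exact ⟨0, 0, zero_mem _, by rw [opI_zero, zero_add]⟩
  | add p q _ _ h h' =>
    obtain ⟨a, t, ht, rfl⟩ := h
    obtain ⟨a', t', ht', rfl⟩ := h'
    exact ⟨a + a', t + t', add_mem ht ht', by rw [opI_add]; abel⟩
  | smul c p _ h =>
    obtain ⟨a, t, ht, rfl⟩ := h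
    exact ⟨c • a, c • t, Submodule.smul_mem _ _ ht, by rw [opI_smul, smul_add]⟩

variable [Nonempty K] (H : IsAdmissible γ h)

include H

theorem IsAdmissible.posSpan_kills {b : K} (hb : b ∈ branchSet γ) {t : cuntzPimsner γ}
    (ht : t ∈ posSpan γ) : H.Kills b 0 t := by
  intro g hg
  induction ht using Submodule.span_induction with
  | mem p hp =>
    obtain ⟨n, e, he, f, hf, rfl⟩ := Set.mem_iUnion.1 hp
    rw [H.eval_mul_apply, H.star_word_level_eq_zero hb hf (Nat.succ_pos n) hg, map_zero]
  | zero => rw [map_zero]; rfl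
  | add p q _ _ h h' => rw [H.eval_add_apply, h, h', add_zero]
  | smul c p _ h => rw [H.eval_smul_apply, h, smul_zero]

open Classical in
omit H in
theorem single_mem_level {b : K} (hb : b ∈ branchSet γ) :
    (lp.single 2 ⟨b, branchSet_subset_goodSet hb⟩ 1 : GoodL2 γ) ∈ level γ b 0 := by
  intro y hy
  rw [orbit_zero] at hy
  rw [lp.single_apply, Pi.single_eq_of_ne]
  rintro rfl
  exact hy rfl

/-- At the root vector δ_b both T and t give zero, so the coefficient of the difference at b is
-a(b). -/
theorem IsAdmissible.norm_apply_le_of_kills {b : K} (hb : b ∈ branchSet γ) {T : cuntzPimsner γ}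
    (hT : H.Kills b 0 T) {a : C(K, ℂ)} {t : cuntzPimsner γ} (ht : t ∈ posSpan γ) :
    ‖a b‖ ≤ ‖T - (opI γ a + t)‖ := by
  classical
  have hs := single_mem_level hb
  set s : GoodL2 γ := lp.single 2 ⟨b, branchSet_subset_goodSet hb⟩ 1 with hsdef
  have h1 := H.norm_eval_apply_le (T - (opI γ a + t)) s ⟨b, branchSet_subset_goodSet hb⟩
  have hsn : ‖s‖ = 1 := by rw [hsdef, lp.norm_single (by norm_num)]; simp
  have hsb : s ⟨b, branchSet_subset_goodSet hb⟩ = 1 := by simp [hsdef, lp.single_apply]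
  have h2 : H.eval (T - (opI γ a + t)) s ⟨b, branchSet_subset_goodSet hb⟩ = - a b := by
    rw [H.eval_sub_apply, H.eval_add_apply, hT s hs, H.posSpan_kills hb ht s hs, add_zero,
      zero_sub, lp.coeFn_neg, Pi.neg_apply, H.eval_opI, repI_apply, hsb, mul_one]
  rw [h2, norm_neg, hsn, mul_one] at h1
  exact h1

/-- An element of the core which vanishes on all the roots can be approximated by monomials of
positive length. -/
theorem IsAdmissible.exists_posSpan_near {T : cuntzPimsner γ} (hT : T ∈ core γ)
    (hk : ∀ b ∈ branchSet γ, H.Kills b 0 T) {ε : ℝ} (hε : 0 < ε) :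
    ∃ t ∈ posSpan γ, ‖T - t‖ < ε := by
  obtain ⟨p, hp, hTp⟩ := exists_coreSpan_near hT (half_pos hε)
  obtain ⟨a, t, ht, rfl⟩ := exists_add_of_mem_coreSpan hp
  -- The coefficient function a is small on the branch set, so it can be replaced by a g g*, which
  -- covariance turns into monomials of length one.
  obtain ⟨g, hg, hag⟩ := exists_vanishing_near H.finite a (half_pos hε) fun b hb =>
    (H.norm_apply_le_of_kills hb (hk b hb) ht).trans_lt hTp
  obtain ⟨ξ, η, hξ⟩ := H.exists_covariance a hg
  refine ⟨opI γ (a * (g * star g)) + t, add_mem ?_ ht, ?_⟩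
  · rw [hξ]
    exact sum_mem fun j _ => mem_posSpan one_pos
      ⟨_, opS_mem_wordSpan _, _, opS_mem_wordSpan _, rfl⟩
  · have e : T - (opI γ (a * (g * star g)) + t) =
        (T - (opI γ a + t)) + opI γ (a - a * (g * star g)) := by
      rw [opI_sub]
      abel
    rw [e]
    calc _ ≤ ‖T - (opI γ a + t)‖ + ‖opI γ (a - a * (g * star g))‖ := norm_add_le _ _
      _ < ε / 2 + ε / 2 := add_lt_add_of_lt_of_le hTp ((norm_opI_le _).trans hag)
      _ = ε := by ring

end Covariance

/-! ### Ideals of the core and compressions -/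

section Compression

variable {K : Type u} [MetricSpace K] [CompactSpace K] {N : ℕ} {γ : Fin N → C(K, K)}
  {h : C(K, K)}

/-- The isometry `S_ξ` for `ξ` the constant function `N^(-1/2)`. -/
def isom (γ : Fin N → C(K, K)) : cuntzPimsner γ := opS γ ((Real.sqrt N : ℂ)⁻¹ • 1)

theorem star_isom_mul_isom (hN : N ≠ 0) : star (isom γ) * isom γ = 1 := by
  rw [isom, star_opS_mul_opS, ← opI_one]
  congr 1
  ext y
  rw [innerA_apply]
  have h2 : (Real.sqrt N : ℂ) * (Real.sqrt N : ℂ) = N := by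
    rw [← Complex.ofReal_mul, Real.mul_self_sqrt (Nat.cast_nonneg N), Complex.ofReal_natCast]
  have h1 : (N : ℂ) ≠ 0 := Nat.cast_ne_zero.2 hN
  simp [← mul_inv, h2, h1]

theorem isom_mem : isom γ ∈ wordSpan γ 1 := opS_mem_wordSpan _

theorem isom_pow_mem (n : ℕ) : isom γ ^ n ∈ wordSpan γ n := by
  induction n with
  | zero => simpa [opI_one] using opI_mem_wordSpan (γ := γ) 1
  | succ n ih => rw [pow_succ]; exact mul_mem_wordSpan ih isom_mem

theorem star_isom_pow_mul_isom_pow (hN : N ≠ 0) (n : ℕ) :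
    star (isom γ ^ n) * isom γ ^ n = 1 := by
  induction n with
  | zero => simp
  | succ n ih =>
    rw [pow_succ', star_mul, mul_assoc, ← mul_assoc (star (isom γ)), star_isom_mul_isom hN,
      one_mul, ih]

/-- An ideal of the core, regarded as a subspace of the Cuntz–Pimsner algebra. -/
def ambient (I : TwoSidedIdeal (core γ)) : Submodule ℂ (cuntzPimsner γ) where
  carrier := {T | ∃ hT : T ∈ core γ, (⟨T, hT⟩ : core γ) ∈ I}
  add_mem' := by
    rintro T T' ⟨hT, hI⟩ ⟨hT', hI'⟩
    exact ⟨add_mem hT hT', I.add_mem hI hI'⟩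
  zero_mem' := ⟨zero_mem _, I.zero_mem⟩
  smul_mem' := by
    rintro c T ⟨hT, hI⟩
    refine ⟨(core γ).smul_mem hT c, ?_⟩
    have := I.mul_mem_left (algebraMap ℂ (core γ) c) _ hI
    rwa [← Algebra.smul_def] at this

variable {I : TwoSidedIdeal (core γ)}

theorem coe_mem_ambient {T : core γ} : (T : cuntzPimsner γ) ∈ ambient I ↔ T ∈ I :=
  ⟨fun ⟨_, h⟩ => h, fun h => ⟨T.2, h⟩⟩

theorem ambient_le_core {T : cuntzPimsner γ} (hT : T ∈ ambient I) : T ∈ core γ := hT.1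

theorem mul_mem_ambient_left {R T : cuntzPimsner γ} (hR : R ∈ core γ) (hT : T ∈ ambient I) :
    R * T ∈ ambient I :=
  ⟨mul_mem hR hT.1, I.mul_mem_left ⟨R, hR⟩ _ hT.2⟩

theorem mul_mem_ambient_right {R T : cuntzPimsner γ} (hT : T ∈ ambient I) (hR : R ∈ core γ) :
    T * R ∈ ambient I :=
  ⟨mul_mem hT.1 hR, I.mul_mem_right _ ⟨R, hR⟩ hT.2⟩

theorem isClosed_ambient (hI : IsClosed (I : Set (core γ))) :
    IsClosed (ambient I : Set (cuntzPimsner γ)) := by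
  have : (ambient I : Set (cuntzPimsner γ)) = Subtype.val '' (I : Set (core γ)) := by
    ext T
    exact ⟨fun ⟨h, h'⟩ => ⟨⟨T, h⟩, h', rfl⟩, by rintro ⟨T, hT, rfl⟩; exact coe_mem_ambient.2 hT⟩
  rw [this]
  exact (isClosed_core γ).isClosedEmbedding_subtypeVal.isClosedMap _ hI

theorem mem_ambient_of_star_mul_self (hI : IsClosed (I : Set (core γ))) {T : cuntzPimsner γ}
    (hT : T ∈ core γ) (h : star T * T ∈ ambient I) : T ∈ ambient I :=
  ⟨hT, mem_of_star_mul_self_mem I hI (x := ⟨T, hT⟩) h.2⟩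

/-- Since v*v = 1, one has e (S_ξ g)* = (e (v g)*)·(v S_ξ^*), whose first factor is in the core: the
elements v S_ξ^* generate the positive monomials by left multiplication. The right-hand version is
the mirror image. -/
theorem posSpan_le_of_left (hN : N ≠ 0) {Q : Submodule ℂ (cuntzPimsner γ)}
    (hmul : ∀ R ∈ core γ, ∀ T ∈ Q, R * T ∈ Q) (hgen : ∀ ξ, isom γ * star (opS γ ξ) ∈ Q) :
    posSpan γ ≤ Q := by
  refine Submodule.span_le.2 fun T hT => ?_
  obtain ⟨n, e, he, f, hf, rfl⟩ := Set.mem_iUnion.1 hT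
  have key : wordSpan γ (n + 1) ≤
      { carrier := {f | e * star f ∈ Q}
        add_mem' := fun {a b} ha hb => by
          rw [Set.mem_ofPred_eq, star_add, mul_add]
          exact add_mem ha hb
        zero_mem' := by simp
        smul_mem' := fun c a ha => by
          rw [Set.mem_ofPred_eq, star_smul, mul_smul_comm]
          exact Submodule.smul_mem _ _ ha } := by
    refine wordSpan_succ_le fun ξ g hg => ?_
    change e * star (opS γ ξ * g) ∈ Q
    have e1 : e * star (opS γ ξ * g) = (e * star (isom γ * g)) * (isom γ * star (opS γ ξ)) := by
      rw [star_mul, star_mul]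
      simp only [mul_assoc]
      rw [← mul_assoc (star (isom γ)), star_isom_mul_isom hN, one_mul]
    rw [e1]
    exact hmul _ (mul_star_mem_core he (opS_mul_mem _ hg)) _ (hgen ξ)
  exact key hf

theorem posSpan_le_of_right (hN : N ≠ 0) {Q : Submodule ℂ (cuntzPimsner γ)}
    (hmul : ∀ R ∈ core γ, ∀ T ∈ Q, T * R ∈ Q) (hgen : ∀ ξ, opS γ ξ * star (isom γ) ∈ Q) :
    posSpan γ ≤ Q := by
  refine Submodule.span_le.2 fun T hT => ?_
  obtain ⟨n, e, he, f, hf, rfl⟩ := Set.mem_iUnion.1 hT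
  refine wordSpan_succ_le (P := Q.comap (LinearMap.mulRight ℂ (star f))) (fun ξ g hg => ?_) he
  rw [Submodule.mem_comap, LinearMap.mulRight_apply]
  have e1 : opS γ ξ * g * star f = (opS γ ξ * star (isom γ)) * ((isom γ * g) * star f) := by
    simp only [mul_assoc]
    rw [← mul_assoc (star (isom γ)), star_isom_mul_isom hN, one_mul]
  rw [e1]
  exact hmul _ (mul_star_mem_core (opS_mul_mem _ hg) hf) _ (hgen ξ)

theorem star_mem_posSpan {t : cuntzPimsner γ} (ht : t ∈ posSpan γ) : star t ∈ posSpan γ := by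
  induction ht using Submodule.span_induction with
  | mem p hp =>
    obtain ⟨n, e, he, f, hf, rfl⟩ := Set.mem_iUnion.1 hp
    refine mem_posSpan (Nat.succ_pos n) ⟨f, hf, e, he, ?_⟩
    rw [star_mul, star_star]
  | zero => rw [star_zero]; exact zero_mem _
  | add p q _ _ h h' => rw [star_add]; exact add_mem h h'
  | smul c p _ h => rw [star_smul]; exact Submodule.smul_mem _ _ h

variable [Nonempty K] (H : IsAdmissible γ h)

include H

theorem IsAdmissible.ne_zero : N ≠ 0 := by
  have := H.two_le
  omega

/-- An element of the core which vanishes at all the roots belongs to a closed ideal as soon as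
its compressions by words of length one do. -/
theorem IsAdmissible.mem_ambient_of_compress (hI : IsClosed (I : Set (core γ)))
    {T : cuntzPimsner γ} (hT : T ∈ core γ) (hk : ∀ b ∈ branchSet γ, H.Kills b 0 T)
    (hc : ∀ ξ η, isom γ * star (opS γ ξ) * T * (opS γ η * star (isom γ)) ∈ ambient I) :
    T ∈ ambient I := by
  have h1 : ∀ η, ∀ x ∈ posSpan γ, x * T * (opS γ η * star (isom γ)) ∈ ambient I := by
    intro η x hx
    have hle : posSpan γ ≤ (ambient I).comap
        (LinearMap.mulRight ℂ (T * (opS γ η * star (isom γ)))) := by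
      refine posSpan_le_of_left H.ne_zero (fun R hR X hX => ?_) (fun ξ => ?_)
      · rw [Submodule.mem_comap, LinearMap.mulRight_apply] at hX ⊢
        rw [mul_assoc]
        exact mul_mem_ambient_left hR hX
      · rw [Submodule.mem_comap, LinearMap.mulRight_apply, ← mul_assoc]
        exact hc ξ η
    have hx' := hle hx
    rwa [Submodule.mem_comap, LinearMap.mulRight_apply, ← mul_assoc] at hx'
  have h2 : ∀ x ∈ posSpan γ, ∀ y ∈ posSpan γ, x * T * y ∈ ambient I := by
    intro x hx
    refine posSpan_le_of_right H.ne_zero (Q := (ambient I).comap (LinearMap.mulLeft ℂ (x * T)))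
      (fun R hR X hX => ?_) (fun η => h1 η x hx)
    rw [Submodule.mem_comap, LinearMap.mulLeft_apply] at hX ⊢
    rw [← mul_assoc]
    exact mul_mem_ambient_right hX hR
  -- T is a limit of elements x of `posSpan`, and x* T x* ∈ I for each of them; the limit is T* T
  -- T*.
  have h3 : star T * T * star T ∈ ambient I := by
    have hcl : T ∈ closure (posSpan γ : Set (cuntzPimsner γ)) := by
      refine Metric.mem_closure_iff.2 fun ε hε => ?_
      obtain ⟨t, ht, hTt⟩ := H.exists_posSpan_near hT hk hε
      exact ⟨t, ht, by rwa [dist_eq_norm]⟩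
    have hcont : Continuous fun x : cuntzPimsner γ => star x * T * star x := by fun_prop
    have := map_mem_closure hcont hcl (t := ambient I) fun x hx =>
      h2 _ (star_mem_posSpan hx) _ (star_mem_posSpan hx)
    rwa [(isClosed_ambient hI).closure_eq] at this
  -- From T* T T* ∈ I follows (T*T)² ∈ I; taking square roots in the closed ideal twice gives T*T ∈
  -- I and then T ∈ I.
  refine mem_ambient_of_star_mul_self hI hT
    (mem_ambient_of_star_mul_self hI (mul_mem (star_mem hT) hT) ?_)
  rw [star_mul, star_star, ← mul_assoc]
  exact mul_mem_ambient_right h3 hT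

open Classical in
omit [Nonempty K] H in
/-- The vector `δ_{γ_i(y)} - δ_{γ_j(y)}`. -/
def pairVec (γ : Fin N → C(K, K)) (i j : Fin N) (y : goodSet γ) : GoodL2 γ :=
  lp.single 2 (goodMap γ i y) 1 - lp.single 2 (goodMap γ j y) 1

omit [Nonempty K] H in
theorem norm_pairVec_le (i j : Fin N) (y : goodSet γ) : ‖pairVec γ i j y‖ ≤ 2 := by
  classical
  refine (norm_sub_le _ _).trans ?_
  rw [lp.norm_single (by norm_num), lp.norm_single (by norm_num)]
  norm_num

open Classical in
omit [Nonempty K] in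
theorem IsAdmissible.pairVec_apply {i j : Fin N} (hij : i ≠ j) (y : goodSet γ) (k : Fin N)
    (z : goodSet γ) : pairVec γ i j y (goodMap γ k z) =
      if z = y then (if k = i then 1 else if k = j then -1 else 0) else 0 := by
  classical
  have key : ∀ l, goodMap γ k z = goodMap γ l y ↔ z = y ∧ k = l := by
    intro l
    constructor
    · intro h
      have h' : γ k z = γ l y := congrArg Subtype.val h
      have hz : z = y := Subtype.ext (H.map_injective h')
      subst hz
      exact ⟨rfl, H.index_injective z.2 h'⟩
    · rintro ⟨rfl, rfl⟩
      rfl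
  rw [pairVec, lp.coeFn_sub, Pi.sub_apply, lp.single_apply, lp.single_apply, Pi.single_apply,
    Pi.single_apply]
  simp only [key]
  by_cases hz : z = y
  · by_cases hki : k = i
    · have hkj : k ≠ j := hki ▸ hij
      simp [hz, hki, hij]
    · by_cases hkj : k = j
      · simp [hz, hkj, hij.symm]
      · simp [hz, hki, hkj]
  · simp [hz]

-- The adjoint sees only the difference of ξ at the two cograph points over y, which tends to zero
-- as y approaches a point where γ_i and γ_j agree.
open Classical in
theorem IsAdmissible.star_opS_pairVec {i j : Fin N} (hij : i ≠ j) (y : goodSet γ) (ξ : Corr γ) :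
    H.eval (star (opS γ ξ)) (pairVec γ i j y) =
      (star (ξ (cographPt γ i y)) - star (ξ (cographPt γ j y))) • lp.single 2 y (1 : ℂ) := by
  ext z
  rw [H.eval_star_opS_apply, lp.coeFn_smul, Pi.smul_apply, lp.single_apply, Pi.single_apply]
  simp only [H.pairVec_apply hij]
  by_cases hz : z = y
  · subst hz
    simp only [if_true, smul_eq_mul, mul_one]
    rw [Finset.sum_eq_add i j hij]
    · rw [if_pos rfl, if_neg hij.symm, if_pos rfl]
      ring
    · intro k _ hk
      rw [if_neg hk.1, if_neg hk.2, mul_zero]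
    · simp
    · simp
  · simp [hz]

/-- In a positive monomial e f*, the first adjoint applied is some S_ξ^*, which already makes the
pair vector small near c; the remaining factors are bounded. -/
theorem IsAdmissible.tendsto_posSpan_pairVec {i j : Fin N} (hij : i ≠ j) {c : K}
    (hc : γ i c = γ j c) {t : cuntzPimsner γ} (ht : t ∈ posSpan γ) :
    Filter.Tendsto (fun y : goodSet γ => H.eval t (pairVec γ i j y))
      (Filter.comap Subtype.val (nhds c)) (nhds 0) := by
  classical
  induction ht using Submodule.span_induction with
  | mem p hp =>
    obtain ⟨n, e, he, f, hf, rfl⟩ := Set.mem_iUnion.1 hp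
    have key : Filter.Tendsto (fun y : goodSet γ => H.eval (star f) (pairVec γ i j y))
        (Filter.comap Subtype.val (nhds c)) (nhds 0) := by
      clear he hp
      have hw : wordSpan γ (n + 1) ≤
          { carrier := {f | Filter.Tendsto (fun y : goodSet γ => H.eval (star f) (pairVec γ i j y))
              (Filter.comap Subtype.val (nhds c)) (nhds 0)}
            add_mem' := fun {a b} ha hb => by
              have := Filter.Tendsto.add ha hb
              rw [add_zero] at this
              refine this.congr fun y => ?_
              rw [star_add, H.eval_add_apply]
            zero_mem' := by
              refine tendsto_const_nhds.congr fun y => ?_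
              rw [star_zero, map_zero]
              rfl
            smul_mem' := fun k a ha => by
              have := Filter.Tendsto.const_smul ha (star k)
              rw [smul_zero] at this
              refine this.congr fun y => ?_
              rw [star_smul, H.eval_smul_apply] } := by
        refine wordSpan_succ_le fun ξ g hg => ?_
        change Filter.Tendsto (fun y : goodSet γ => H.eval (star (opS γ ξ * g)) (pairVec γ i j y))
              (Filter.comap Subtype.val (nhds c)) (nhds 0)
        have hcont : Continuous fun y : K =>
            ‖star (ξ (cographPt γ i y)) - star (ξ (cographPt γ j y))‖ * ‖star g‖ := by fun_prop
        have hlim := (hcont.tendsto c).comp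
          (Filter.tendsto_comap (f := (Subtype.val : goodSet γ → K)) (x := nhds c))
        rw [cographPt_congr hc, sub_self, norm_zero, zero_mul] at hlim
        refine squeeze_zero_norm (fun y => ?_) hlim
        rw [star_mul, H.eval_mul_apply, H.star_opS_pairVec hij, map_smul, norm_smul]
        change _ ≤ ‖star (ξ (cographPt γ i y)) - star (ξ (cographPt γ j y))‖ * ‖star g‖
        gcongr
        refine ((H.eval (star g)).le_opNorm _).trans ?_
        rw [lp.norm_single (by norm_num), norm_one, mul_one]
        exact H.norm_eval_le _
      exact hw hf
    have := ((H.eval e).continuous.tendsto 0).comp key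
    rw [map_zero] at this
    refine this.congr fun y => ?_
    rw [H.eval_mul_apply]
    rfl
  | zero =>
    refine tendsto_const_nhds.congr fun y => ?_
    rw [map_zero]
    rfl
  | add p q _ _ h h' =>
    have := h.add h'
    rw [add_zero] at this
    exact this.congr fun y => (H.eval_add_apply _ _ _).symm
  | smul k p _ h =>
    have := h.const_smul k
    rw [smul_zero] at this
    exact this.congr fun y => (H.eval_smul_apply _ _ _).symm

/-- Test on δ_{γ_i(y)} - δ_{γ_j(y)} as y tends to c with γ_i(c) = γ_j(c) = b. The contribution of T
to the difference of the two coordinates is zero, that of t tends to zero, and that of a is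
a(γ_i(y)) + a(γ_j(y)), with limit 2a(b). The pair vector has norm at most 2 and two coordinates are
used, so 2|a(b)| ≤ 4ε. -/
theorem IsAdmissible.norm_apply_le_of_compress_eq_zero {T : cuntzPimsner γ}
    (hc : ∀ ξ η, star (opS γ ξ) * T * opS γ η = 0) {a : C(K, ℂ)} {t : cuntzPimsner γ}
    (ht : t ∈ posSpan γ) {b : K} (hb : b ∈ branchSet γ) :
    ‖a b‖ ≤ 2 * ‖T - (opI γ a + t)‖ := by
  classical
  obtain ⟨c, i, j, hij, rfl, hbc⟩ := hb
  set ε := ‖T - (opI γ a + t)‖ with hε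
  have hnb : (Filter.comap (Subtype.val : goodSet γ → K) (nhds c)).NeBot :=
    mem_closure_iff_comap_neBot.1 (H.dense c)
  have hlim1 : Filter.Tendsto (fun y : goodSet γ => ‖a (γ i y) + a (γ j y)‖)
      (Filter.comap Subtype.val (nhds c)) (nhds ‖a (γ i c) + a (γ j c)‖) := by
    have hcont : Continuous fun y : K => ‖a (γ i y) + a (γ j y)‖ := by fun_prop
    exact (hcont.tendsto c).comp Filter.tendsto_comap
  have hlim2 : Filter.Tendsto
      (fun y : goodSet γ => 4 * ε + 2 * ‖H.eval t (pairVec γ i j y)‖)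
      (Filter.comap Subtype.val (nhds c)) (nhds (4 * ε + 2 * 0)) := by
    have := (H.tendsto_posSpan_pairVec hij hbc ht).norm
    rw [norm_zero] at this
    exact tendsto_const_nhds.add (this.const_mul 2)
  have hle : ∀ y : goodSet γ, ‖a (γ i y) + a (γ j y)‖ ≤
      4 * ε + 2 * ‖H.eval t (pairVec γ i j y)‖ := by
    intro y
    set f := pairVec γ i j y with hf
    -- With ζ the difference of the two fibre bumps, f = S_ζ δ_y, and this difference of coordinates
    -- is the coefficient at y of S_ζ^* T S_ζ δ_y.
    have hzero : H.eval T f (goodMap γ i y) - H.eval T f (goodMap γ j y) = 0 := by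
      have h1 : f = H.eval (opS γ (fiberBump γ y i - fiberBump γ y j)) (lp.single 2 y (1 : ℂ)) := by
        ext x
        rw [H.eval_opS]
        rcases H.eq_goodMap_or_mem x with hx | ⟨k, z, rfl⟩
        · rw [H.repS_apply_of_mem _ _ hx, hf, pairVec, lp.coeFn_sub, Pi.sub_apply, lp.single_apply,
            lp.single_apply, Pi.single_eq_of_ne, Pi.single_eq_of_ne, sub_zero]
          · rintro rfl
            exact H.map_notMem y.2 j hx
          · rintro rfl
            exact H.map_notMem y.2 i hx
        · rw [H.repS_apply, hf, H.pairVec_apply hij, lp.single_apply, Pi.single_apply]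
          by_cases hz : z = y
          · subst hz
            rw [if_pos rfl, if_pos rfl, mul_one, ContinuousMap.sub_apply,
              H.fiberBump_apply z.2, H.fiberBump_apply z.2]
            by_cases hki : k = i
            · simp [hki, hij]
            · by_cases hkj : k = j <;> simp [hki, hkj, hij.symm]
          · simp [hz]
      have h2 := congrArg (fun X : GoodL2 γ →L[ℂ] GoodL2 γ => X (lp.single 2 y (1 : ℂ)) y)
        (congrArg H.eval (hc (fiberBump γ y i - fiberBump γ y j)
          (fiberBump γ y i - fiberBump γ y j)))
      simp only [H.eval_mul_apply] at h2
      rw [← h1, H.eval_star_opS_apply, map_zero, Finset.sum_eq_add i j hij] at h2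
      · simp only [ContinuousMap.sub_apply, H.fiberBump_apply y.2, if_true, if_neg hij,
          if_neg hij.symm, sub_zero, zero_sub, star_one, star_neg, one_mul, neg_mul] at h2
        rw [sub_eq_add_neg, h2]
        rfl
      · intro k _ hk
        simp [ContinuousMap.sub_apply, H.fiberBump_apply y.2, hk.1, hk.2]
      · simp
      · simp
    have hai : H.eval (opI γ a) f (goodMap γ i y) = a (γ i y) := by
      rw [H.eval_opI, repI_apply, hf, H.pairVec_apply hij, if_pos rfl, if_pos rfl, mul_one]
      rfl
    have haj : H.eval (opI γ a) f (goodMap γ j y) = - a (γ j y) := by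
      rw [H.eval_opI, repI_apply, hf, H.pairVec_apply hij, if_pos rfl, if_neg hij.symm,
        if_pos rfl, mul_neg, mul_one]
      rfl
    have hD : ∀ x, ‖H.eval (T - (opI γ a + t)) f x‖ ≤ 2 * ε := fun x =>
      (H.norm_eval_apply_le _ _ _).trans (by
        rw [← hε, mul_comm]
        gcongr
        exact norm_pairVec_le i j y)
    have ht' : ∀ x, ‖H.eval t f x‖ ≤ ‖H.eval t f‖ := fun x =>
      lp.norm_apply_le_norm (by norm_num) _ x
    have hx : ∀ x, H.eval (T - (opI γ a + t)) f x =
        H.eval T f x - (H.eval (opI γ a) f x + H.eval t f x) := by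
      intro x
      rw [H.eval_sub_apply, H.eval_add_apply]
      rfl
    have e : a (γ i y) + a (γ j y) =
        (H.eval (T - (opI γ a + t)) f (goodMap γ j y) -
          H.eval (T - (opI γ a + t)) f (goodMap γ i y)) +
        (H.eval t f (goodMap γ j y) - H.eval t f (goodMap γ i y)) := by
      rw [hx, hx, hai, haj, sub_eq_zero.1 hzero]
      ring
    rw [e]
    calc _ ≤ (‖H.eval (T - (opI γ a + t)) f (goodMap γ j y)‖ +
          ‖H.eval (T - (opI γ a + t)) f (goodMap γ i y)‖) +
        (‖H.eval t f (goodMap γ j y)‖ + ‖H.eval t f (goodMap γ i y)‖) :=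
          (norm_add_le _ _).trans (add_le_add (norm_sub_le _ _) (norm_sub_le _ _))
      _ ≤ (2 * ε + 2 * ε) + (‖H.eval t f‖ + ‖H.eval t f‖) := by
          gcongr
          · exact hD _
          · exact hD _
          · exact ht' _
          · exact ht' _
      _ = _ := by ring
  have := le_of_tendsto_of_tendsto' hlim1 hlim2 hle
  rw [← hbc, ← two_mul, norm_mul, Complex.norm_ofNat] at this
  linarith

/-- An element of the core all of whose compressions by words of length one vanish is zero. -/
theorem IsAdmissible.eq_zero_of_compress {T : cuntzPimsner γ} (hT : T ∈ core γ)
    (hc : ∀ ξ η, star (opS γ ξ) * T * opS γ η = 0) : T = 0 := by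
  classical
  have hk : ∀ b ∈ branchSet γ, H.Kills b 0 T := by
    intro b hb g hg
    have hb0 : H.eval T g ∈ level γ b 0 := H.core_mem_level hb hT hg
    ext x
    by_cases hx : (x : K) ∈ orbit γ b 0
    · rw [orbit_zero] at hx
      rw [lp.coeFn_zero, Pi.zero_apply, ← norm_le_zero_iff]
      refine le_of_forall_pos_le_add fun ε hε => ?_
      -- At the root T g is the approximation error, at most δ‖g‖, plus a(b) g(b), at most 2δ‖g‖;
      -- hence the factor 3. The added 1 keeps the denominator positive.
      obtain ⟨p, hp, hTp⟩ := exists_coreSpan_near hT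
        (show 0 < ε / (3 * (‖g‖ + 1)) by positivity)
      obtain ⟨a, t, ht, rfl⟩ := exists_add_of_mem_coreSpan hp
      set δ := ‖T - (opI γ a + t)‖ with hδ
      have ha := H.norm_apply_le_of_compress_eq_zero hc (a := a) ht hb
      have e : H.eval T g x = H.eval (T - (opI γ a + t)) g x + a b * g x := by
        rw [H.eval_sub_apply, H.eval_add_apply, H.posSpan_kills hb ht g hg, add_zero,
          lp.coeFn_sub, Pi.sub_apply, H.eval_opI, repI_apply, show (x : K) = b from hx]
        ring
      rw [e, zero_add]
      calc _ ≤ ‖H.eval (T - (opI γ a + t)) g x‖ + ‖a b * g x‖ := norm_add_le _ _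
        _ ≤ δ * ‖g‖ + (2 * δ) * ‖g‖ := by
          rw [norm_mul]
          gcongr
          · exact H.norm_eval_apply_le _ _ _
          · exact lp.norm_apply_le_norm (by norm_num) _ _
        _ = (3 * ‖g‖) * δ := by ring
        _ ≤ (3 * (‖g‖ + 1)) * (ε / (3 * (‖g‖ + 1))) := by
          gcongr
          linarith
        _ = ε := by field_simp
    · exact hb0 x hx
  have hbot : IsClosed ((⊥ : TwoSidedIdeal (core γ)) : Set (core γ)) := by
    rw [TwoSidedIdeal.coe_bot]
    exact isClosed_singleton
  have := H.mem_ambient_of_compress hbot hT hk fun ξ η => by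
    have e : isom γ * star (opS γ ξ) * T * (opS γ η * star (isom γ)) =
        isom γ * (star (opS γ ξ) * T * opS γ η) * star (isom γ) := by
      simp only [mul_assoc]
    rw [e, hc, mul_zero, zero_mul]
    exact zero_mem _
  exact congrArg Subtype.val ((TwoSidedIdeal.mem_bot _).1 this.2)

/-- A compression by words of length one stays in the core, so `eq_zero_of_compress` can be iterated
n times. -/
theorem IsAdmissible.exists_compress_ne_zero (n : ℕ) {T : cuntzPimsner γ} (hT : T ∈ core γ)
    (h0 : T ≠ 0) :
    ∃ ξ η : Fin n → Corr γ, star (opWord γ ξ) * T * opWord γ η ≠ 0 := by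
  induction n generalizing T with
  | zero => exact ⟨Fin.elim0, Fin.elim0, by simpa [opWord_zero] using h0⟩
  | succ n ih =>
    have : ∃ ξ η, star (opS γ ξ) * T * opS γ η ≠ 0 := by
      by_contra hcon
      push Not at hcon
      exact h0 (H.eq_zero_of_compress hT hcon)
    obtain ⟨ξ, η, hne⟩ := this
    obtain ⟨ξ', η', hne'⟩ := ih
      (star_mul_mul_mem_core (opS_mem_wordSpan ξ) hT (opS_mem_wordSpan η)) hne
    refine ⟨Fin.cons ξ ξ', Fin.cons η η', ?_⟩
    rw [opWord_succ, opWord_succ, Fin.cons_zero, Fin.cons_zero, Fin.tail_cons, Fin.tail_cons,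
      star_mul]
    simpa only [mul_assoc] using hne'

end Compression

/-! ### The transfer operator -/

section Transfer

variable {K : Type u} [MetricSpace K] [CompactSpace K] {N : ℕ} {γ : Fin N → C(K, K)}

/-- The transfer operator `(𝓛 a)(y) = ∑ j, a(γ_j(y))`. -/
def transfer (γ : Fin N → C(K, K)) (a : C(K, ℂ)) : C(K, ℂ) := ∑ j, a.comp (γ j)

theorem transfer_iterate_apply (k : ℕ) (a : C(K, ℂ)) (y : K) :
    (transfer γ)^[k] a y = ∑ p : Fin k → Fin N, a (wordMap γ (List.ofFn p) y) := by
  induction k generalizing a with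
  | zero => simp
  | succ k ih =>
    rw [Function.iterate_succ_apply, ih,
      ← (Fin.consEquiv fun _ : Fin (k + 1) => Fin N).sum_comp, Fintype.sum_prod_type,
      Finset.sum_comm]
    refine Finset.sum_congr rfl fun p _ => ?_
    simp [transfer, ContinuousMap.sum_apply, Fin.consEquiv, List.ofFn_succ]

theorem star_opS_one_mul (a : C(K, ℂ)) :
    star (opS γ 1) * opI γ a * opS γ 1 = opI γ (transfer γ a) := by
  rw [mul_assoc, opI_mul_opS, star_opS_mul_opS]
  congr 1
  ext y
  rw [innerA_apply]
  simp [leftAct_apply, transfer, ContinuousMap.sum_apply]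

theorem star_opS_one_pow_mul (k : ℕ) (a : C(K, ℂ)) :
    star (opS γ 1 ^ k) * opI γ a * opS γ 1 ^ k = opI γ ((transfer γ)^[k] a) := by
  induction k generalizing a with
  | zero => simp
  | succ k ih =>
    rw [Function.iterate_succ_apply, ← ih, ← star_opS_one_mul, pow_succ', star_mul]
    simp only [mul_assoc]

theorem opS_pow_mem (ξ : Corr γ) (k : ℕ) : opS γ ξ ^ k ∈ wordSpan γ k := by
  induction k with
  | zero => simpa [opI_one] using opI_mem_wordSpan (γ := γ) 1
  | succ n ih => rw [pow_succ]; exact mul_mem_wordSpan ih (opS_mem_wordSpan ξ)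

theorem opI_smul_one (c : ℂ) : opI γ (c • 1) = c • 1 := by rw [opI_smul, opI_one]

variable {h : C(K, K)} [Nonempty K] (H : IsAdmissible γ h)

include H

/-- Near any point there is a word isometry `u` compressing a given function to an almost constant
function. -/
theorem IsAdmissible.exists_compressing_isometry (a : C(K, ℂ)) (x₀ : K) {ε : ℝ} (hε : 0 < ε) :
    ∃ k, ∃ u ∈ wordSpan γ k, star u * u = 1 ∧ ‖star u * opI γ a * u - a x₀ • 1‖ ≤ ε := by
  have : NeZero N := ⟨H.ne_zero⟩
  obtain ⟨r, hr, hball⟩ := Metric.continuous_iff.1 a.continuous x₀ ε hε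
  obtain ⟨w, hw⟩ := exists_wordMap_subset_ball H.selfSimilar H.toHasInverse x₀ hr
  set k := w.length with hk
  obtain ⟨p₀, hp₀⟩ : ∃ p₀ : Fin k → Fin N, List.ofFn p₀ = w := ⟨w.get, List.ofFn_get w⟩
  have hclosed1 : IsClosed {x | r ≤ dist x x₀} := isClosed_le continuous_const (by fun_prop)
  have hclosed2 : IsClosed (Set.range (wordMap γ w)) :=
    (isCompact_range (continuous_wordMap γ w)).isClosed
  -- f is 1 on the small image of K under w and 0 outside the ball where a is close to a(x₀). Hence
  -- the word w alone contributes 1 to the sum G, so G ≥ 1.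
  obtain ⟨f, h0, h1, hf⟩ := exists_continuous_zero_one_of_isClosed hclosed1 hclosed2
    (Set.disjoint_left.2 fun x hx ⟨y, hy⟩ => absurd (hy ▸ hw y) (not_lt.2 hx))
  have hG : ∀ y, 1 ≤ ∑ p : Fin k → Fin N, f (wordMap γ (List.ofFn p) y) ^ 2 := by
    intro y
    have h2 : f (wordMap γ (List.ofFn p₀) y) = 1 := h1 ⟨y, by rw [hp₀]⟩
    calc (1 : ℝ) = f (wordMap γ (List.ofFn p₀) y) ^ 2 := by rw [h2, one_pow]
      _ ≤ _ := Finset.single_le_sum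
        (f := fun p : Fin k → Fin N => f (wordMap γ (List.ofFn p) y) ^ 2)
        (fun p _ => sq_nonneg _) (Finset.mem_univ p₀)
  have hGc : Continuous fun y => ∑ p : Fin k → Fin N, f (wordMap γ (List.ofFn p) y) ^ 2 :=
    continuous_finsetSum _ fun p _ => (f.continuous.comp (continuous_wordMap γ _)).pow 2
  set G : K → ℝ := fun y => ∑ p : Fin k → Fin N, f (wordMap γ (List.ofFn p) y) ^ 2 with hGdef
  have hG0 : ∀ y, 0 < G y := fun y => zero_lt_one.trans_le (hG y)
  set F : C(K, ℂ) := ⟨fun y => (f y : ℂ), by fun_prop⟩ with hF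
  set R : C(K, ℂ) := ⟨fun y => (((Real.sqrt (G y))⁻¹ : ℝ) : ℂ),
    Complex.continuous_ofReal.comp ((hGc.sqrt).inv₀ fun y => (Real.sqrt_pos.2 (hG0 y)).ne')⟩
    with hR
  have hFs : star F = F := by
    ext y
    simp [hF]
  have hRs : star R = R := by
    ext y
    simp [hR]
  have hRR : ∀ y, R y * R y = ((G y)⁻¹ : ℝ) := by
    intro y
    rw [hR, ContinuousMap.coe_mk, ← Complex.ofReal_mul, ← mul_inv,
      Real.mul_self_sqrt (hG0 y).le]
  -- Compression by F S_1^k yields the k-fold transfer of f² b; the factor R = G^{-1/2} normalises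
  -- it so that u is an isometry.
  set u := opI γ F * opS γ 1 ^ k * opI γ R with hu
  have huu : ∀ b : C(K, ℂ), star u * opI γ b * u =
      opI γ (R * ((transfer γ)^[k] (F * b * F)) * R) := by
    intro b
    rw [opI_mul, opI_mul, ← star_opS_one_pow_mul, opI_mul, opI_mul, hu, star_mul, star_mul,
      ← opI_star, ← opI_star, hFs, hRs]
    simp only [mul_assoc]
  refine ⟨k, u, mul_opI_mem _ (opI_mul_mem _ (opS_pow_mem _ _)), ?_, ?_⟩
  · have := huu 1
    rw [opI_one, mul_one] at this
    rw [this, ← opI_one]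
    congr 1
    ext y
    rw [ContinuousMap.mul_apply, ContinuousMap.mul_apply, transfer_iterate_apply, mul_right_comm,
      hRR]
    have e : ∑ p : Fin k → Fin N, (F * 1 * F) (wordMap γ (List.ofFn p) y) = (G y : ℂ) := by
      rw [hGdef]
      push_cast
      refine Finset.sum_congr rfl fun p _ => ?_
      simp [hF, sq]
    rw [e, ← Complex.ofReal_mul, inv_mul_cancel₀ (hG0 y).ne']
    simp
  · rw [huu, ← opI_smul_one, ← opI_sub]
    refine (norm_opI_le _).trans ((ContinuousMap.norm_le _ hε.le).2 fun y => ?_)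
    rw [ContinuousMap.sub_apply, ContinuousMap.mul_apply, ContinuousMap.mul_apply,
      transfer_iterate_apply, mul_right_comm, hRR, ContinuousMap.smul_apply,
      ContinuousMap.one_apply, smul_eq_mul, mul_one]
    -- The compressed function at y is an average of values of a with weights f²/G of total mass 1,
    -- supported in the ball where |a - a(x₀)| ≤ ε.
    have e : (((G y)⁻¹ : ℝ) : ℂ) * ∑ p : Fin k → Fin N, (F * a * F) (wordMap γ (List.ofFn p) y) -
        a x₀ = (((G y)⁻¹ : ℝ) : ℂ) * ∑ p : Fin k → Fin N,
          ((f (wordMap γ (List.ofFn p) y) ^ 2 : ℝ) : ℂ) *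
            (a (wordMap γ (List.ofFn p) y) - a x₀) := by
      have e1 : a x₀ = (((G y)⁻¹ : ℝ) : ℂ) * ((G y : ℂ) * a x₀) := by
        rw [← mul_assoc, ← Complex.ofReal_mul, inv_mul_cancel₀ (hG0 y).ne', Complex.ofReal_one,
          one_mul]
      conv_lhs => rw [e1]
      rw [← mul_sub, hGdef]
      congr 1
      push_cast
      rw [Finset.sum_mul, ← Finset.sum_sub_distrib]
      refine Finset.sum_congr rfl fun p _ => ?_
      rw [Pi.mul_apply, Pi.mul_apply, hF, ContinuousMap.coe_mk]
      ring
    rw [e, norm_mul, Complex.norm_real, Real.norm_of_nonneg (inv_nonneg.2 (hG0 y).le),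
      inv_mul_le_iff₀ (hG0 y)]
    refine (norm_sum_le _ _).trans ?_
    rw [hGdef, Finset.sum_mul]
    refine Finset.sum_le_sum fun p _ => ?_
    rw [norm_mul, Complex.norm_real, Real.norm_of_nonneg (sq_nonneg _)]
    by_cases hx : r ≤ dist (wordMap γ (List.ofFn p) y) x₀
    · have : f (wordMap γ (List.ofFn p) y) = 0 := h0 hx
      simp [this]
    · gcongr
      rw [← dist_eq_norm]
      exact (hball _ (not_le.1 hx)).le

end Transfer

/-! ### Nonzero closed ideals contain compact operators of some level -/

section NonzeroIdeals

variable {K : Type u} [MetricSpace K] [CompactSpace K] {N : ℕ} {γ : Fin N → C(K, K)}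
  {h : C(K, K)} {I : TwoSidedIdeal (core γ)}

theorem star_mem_coreSpan {t : cuntzPimsner γ} (ht : t ∈ coreSpan γ) : star t ∈ coreSpan γ := by
  induction ht using Submodule.span_induction with
  | mem p hp =>
    obtain ⟨n, e, he, f, hf, rfl⟩ := Set.mem_iUnion.1 hp
    refine Submodule.subset_span (Set.mem_iUnion.2 ⟨n, f, hf, e, he, ?_⟩)
    rw [star_mul, star_star]
  | zero => rw [star_zero]; exact zero_mem _
  | add p q _ _ h h' => rw [star_add]; exact add_mem h h'
  | smul c p _ h => rw [star_smul]; exact Submodule.smul_mem _ _ h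

/-- For n ≥ k, the factor f* of a monomial e f* of length k removes k letters and e restores them.
Finitely many monomials share a common bound. -/
theorem exists_mul_mem_wordSpan {p : cuntzPimsner γ} (hp : p ∈ coreSpan γ) :
    ∃ n₀, ∀ n ≥ n₀, ∀ e ∈ wordSpan γ n, p * e ∈ wordSpan γ n := by
  induction hp using Submodule.span_induction with
  | mem p hp =>
    obtain ⟨k, e, he, f, hf, rfl⟩ := Set.mem_iUnion.1 hp
    refine ⟨k, fun n hn g hg => ?_⟩
    obtain ⟨m, rfl⟩ := Nat.exists_eq_add_of_le hn
    rw [mul_assoc]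
    exact mul_mem_wordSpan he (star_mul_mem hf hg)
  | zero => exact ⟨0, fun n _ e _ => by rw [zero_mul]; exact zero_mem _⟩
  | add p q _ _ h h' =>
    obtain ⟨n₁, h₁⟩ := h
    obtain ⟨n₂, h₂⟩ := h'
    refine ⟨max n₁ n₂, fun n hn e he => ?_⟩
    rw [add_mul]
    exact add_mem (h₁ n ((le_max_left _ _).trans hn) e he)
      (h₂ n ((le_max_right _ _).trans hn) e he)
  | smul c p _ h =>
    obtain ⟨n₁, h₁⟩ := h
    refine ⟨n₁, fun n hn e he => ?_⟩
    rw [smul_mul_assoc]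
    exact Submodule.smul_mem _ _ (h₁ n hn e he)

theorem gauge_closure_wordSpan {n : ℕ} {e : cuntzPimsner γ}
    (he : e ∈ (wordSpan γ n).topologicalClosure) (z : Circle) :
    gauge γ z e = (z : ℂ) ^ n • e := by
  have hcl : IsClosed {e | gauge γ z e = (z : ℂ) ^ n • e} :=
    isClosed_eq (continuous_gauge γ z) (continuous_const_smul _)
  exact closure_minimal (fun e he => gauge_wordSpan he z) hcl he

theorem mul_star_mem_core_of_gauge {n : ℕ} {e f : cuntzPimsner γ}
    (he : ∀ z, gauge γ z e = (z : ℂ) ^ n • e) (hf : ∀ z, gauge γ z f = (z : ℂ) ^ n • f) :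
    e * star f ∈ core γ := by
  intro z
  rw [map_mul, map_star, he, hf, star_smul, smul_mul_smul_comm,
    star_pow, ← mul_pow, mul_star_circle, one_pow, one_smul]

theorem star_mul_mem_core_of_gauge {n : ℕ} {e f : cuntzPimsner γ}
    (he : ∀ z, gauge γ z e = (z : ℂ) ^ n • e) (hf : ∀ z, gauge γ z f = (z : ℂ) ^ n • f) :
    star e * f ∈ core γ := by
  intro z
  rw [map_mul, map_star, he, hf, star_smul, smul_mul_smul_comm,
    star_pow, ← mul_pow, mul_comm (star _), mul_star_circle, one_pow, one_smul]

/-- Words of length n behave as vectors of a module over C(K): on algebraic words e*f is a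
coefficient function, and this passes to closures up to ε. -/
theorem exists_opI_near {n : ℕ} {e f : cuntzPimsner γ}
    (he : e ∈ (wordSpan γ n).topologicalClosure) (hf : f ∈ (wordSpan γ n).topologicalClosure)
    {ε : ℝ} (hε : 0 < ε) : ∃ a, ‖star e * f - opI γ a‖ < ε := by
  have h2 : star e * f ∈ closure (Set.range (opI γ)) :=
    map_mem_closure₂ (f := fun e f : cuntzPimsner γ => star e * f) (by fun_prop) he hf
      fun e he f hf => by
        obtain ⟨a, ha⟩ := mem_wordSpan_zero.1 (star_mul_mem (n := 0) he hf)
        exact ⟨a, ha.symm⟩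
  obtain ⟨_, ⟨a, rfl⟩, ha⟩ := Metric.mem_closure_iff.1 h2 ε hε
  exact ⟨a, by rwa [← dist_eq_norm]⟩

/-- The elements of the core which, together with their adjoints, preserve the closed span of the
words of length `n`. -/
def stabilizer (γ : Fin N → C(K, K)) (n : ℕ) : StarSubalgebra ℝ (cuntzPimsner γ) where
  carrier := {X | X ∈ core γ ∧
    (∀ e ∈ (wordSpan γ n).topologicalClosure, X * e ∈ (wordSpan γ n).topologicalClosure) ∧
    ∀ e ∈ (wordSpan γ n).topologicalClosure, star X * e ∈ (wordSpan γ n).topologicalClosure}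
  mul_mem' := by
    rintro X X' ⟨h0, h1, h2⟩ ⟨h0', h1', h2'⟩
    refine ⟨mul_mem h0 h0', fun e he => ?_, fun e he => ?_⟩
    · rw [mul_assoc]
      exact h1 _ (h1' _ he)
    · rw [star_mul, mul_assoc]
      exact h2' _ (h2 _ he)
  add_mem' := by
    rintro X X' ⟨h0, h1, h2⟩ ⟨h0', h1', h2'⟩
    refine ⟨add_mem h0 h0', fun e he => ?_, fun e he => ?_⟩
    · rw [add_mul]
      exact add_mem (h1 _ he) (h1' _ he)
    · rw [star_add, add_mul]
      exact add_mem (h2 _ he) (h2' _ he)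
  algebraMap_mem' c := by
    have e1 : algebraMap ℝ (cuntzPimsner γ) c = (c : ℂ) • 1 := by
      rw [Algebra.algebraMap_eq_smul_one, Complex.coe_smul]
    refine ⟨?_, fun e he => ?_, fun e he => ?_⟩
    · rw [e1]
      exact (core γ).smul_mem (one_mem _) _
    · rw [e1, smul_mul_assoc, one_mul]
      exact Submodule.smul_mem _ _ he
    · rw [e1, star_smul, star_one, smul_mul_assoc, one_mul]
      exact Submodule.smul_mem _ _ he
  star_mem' := by
    rintro X ⟨h0, h1, h2⟩
    exact ⟨star_mem h0, h2, by rwa [star_star]⟩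

theorem isClosed_stabilizer (n : ℕ) :
    IsClosed (stabilizer γ n : Set (cuntzPimsner γ)) := by
  have hZ : IsClosed ((wordSpan γ n).topologicalClosure : Set (cuntzPimsner γ)) :=
    Submodule.isClosed_topologicalClosure _
  have : (stabilizer γ n : Set (cuntzPimsner γ)) = (core γ : Set (cuntzPimsner γ)) ∩
      ((⋂ e : (wordSpan γ n).topologicalClosure,
        {X | X * (e : cuntzPimsner γ) ∈ (wordSpan γ n).topologicalClosure}) ∩
      ⋂ e : (wordSpan γ n).topologicalClosure,
        {X | star X * (e : cuntzPimsner γ) ∈ (wordSpan γ n).topologicalClosure}) := by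
    ext X
    constructor
    · rintro ⟨h0, h1, h2⟩
      exact ⟨h0, Set.mem_iInter.2 fun e => h1 e.1 e.2, Set.mem_iInter.2 fun e => h2 e.1 e.2⟩
    · rintro ⟨h0, h1, h2⟩
      exact ⟨h0, fun e he => Set.mem_iInter.1 h1 ⟨e, he⟩, fun e he => Set.mem_iInter.1 h2 ⟨e, he⟩⟩
  rw [this]
  refine (isClosed_core γ).inter ((isClosed_iInter fun e => ?_).inter (isClosed_iInter fun e => ?_))
  · exact hZ.preimage (f := fun X => X * (e : cuntzPimsner γ)) (by fun_prop)
  · exact hZ.preimage (f := fun X => star X * (e : cuntzPimsner γ)) (by fun_prop)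

theorem mul_mem_closure_wordSpan {n : ℕ} {p : cuntzPimsner γ}
    (hp : ∀ e ∈ wordSpan γ n, p * e ∈ wordSpan γ n) {e : cuntzPimsner γ}
    (he : e ∈ (wordSpan γ n).topologicalClosure) : p * e ∈ (wordSpan γ n).topologicalClosure :=
  map_mem_closure (f := fun e => p * e) (by fun_prop) he hp

theorem exists_mem_stabilizer {p : cuntzPimsner γ} (hp : p ∈ coreSpan γ) :
    ∃ n, p ∈ stabilizer γ n := by
  obtain ⟨n₁, h₁⟩ := exists_mul_mem_wordSpan hp
  obtain ⟨n₂, h₂⟩ := exists_mul_mem_wordSpan (star_mem_coreSpan hp)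
  exact ⟨max n₁ n₂, coreSpan_le_core hp,
    fun e he => mul_mem_closure_wordSpan (h₁ _ (le_max_left _ _)) he,
    fun e he => mul_mem_closure_wordSpan (h₂ _ (le_max_right _ _)) he⟩

end NonzeroIdeals

/-! ### Numerical estimates for the perturbation argument -/

section Estimates

variable {A : Type*} [CStarAlgebra A]

theorem norm_star_mul_mul_le {z X : A} (hz : ‖z‖ ≤ 1) : ‖star z * X * z‖ ≤ ‖X‖ := by
  calc ‖star z * X * z‖ ≤ ‖star z‖ * ‖X‖ * ‖z‖ :=
        (norm_mul_le _ _).trans (by gcongr; exact norm_mul_le _ _)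
    _ ≤ 1 * ‖X‖ * 1 := by rw [norm_star]; gcongr
    _ = ‖X‖ := by ring

/-- With T = t*t and S = s*s, the identity T - S = t*(t - s) + (t - s)*s gives ‖T - S‖ ≤ 0.07, hence
‖S‖ ≥ 0.93; the same device applied to T² - S² gives at most 0.07 + 0.07·1.07. -/
theorem norm_star_mul_self_near {t s : A} (ht : ‖t‖ = 1) (hts : ‖t - s‖ < 1 / 30) :
    8 / 10 < ‖star s * s‖ ∧
      ‖star t * t * (star t * t) - star s * s * (star s * s)‖ ≤ 15 / 100 := by
  have hs1 : ‖s‖ ≤ 31 / 30 := by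
    have := norm_sub_norm_le s t
    rw [norm_sub_rev] at this
    linarith
  have hTS : ‖star t * t - star s * s‖ ≤ 7 / 100 := by
    have e : star t * t - star s * s = star t * (t - s) + star (t - s) * s := by
      rw [star_sub, mul_sub, sub_mul]
      abel
    rw [e]
    calc _ ≤ ‖star t‖ * ‖t - s‖ + ‖star (t - s)‖ * ‖s‖ :=
          (norm_add_le _ _).trans (add_le_add (norm_mul_le _ _) (norm_mul_le _ _))
      _ ≤ 1 * (1 / 30) + 1 / 30 * (31 / 30) := by
          rw [norm_star, norm_star, ht]
          gcongr
      _ ≤ _ := by norm_num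
  have hT1 : ‖star t * t‖ = 1 := by rw [CStarRing.norm_star_mul_self, ht, one_mul]
  generalize star t * t = T at *
  generalize star s * s = S at *
  have hS1 : ‖S‖ ≤ 107 / 100 := by
    have := norm_sub_norm_le S T
    rw [norm_sub_rev] at this
    linarith
  refine ⟨?_, ?_⟩
  · have := norm_sub_norm_le T S
    linarith
  · have e : T * T - S * S = T * (T - S) + (T - S) * S := by
      rw [mul_sub, sub_mul]
      abel
    rw [e]
    calc _ ≤ ‖T‖ * ‖T - S‖ + ‖T - S‖ * ‖S‖ :=
          (norm_add_le _ _).trans (add_le_add (norm_mul_le _ _) (norm_mul_le _ _))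
      _ ≤ 1 * (7 / 100) + 7 / 100 * (107 / 100) := by
          rw [hT1]
          gcongr
      _ ≤ _ := by norm_num

/-- The first error is 0.15 + 0.05. For the lower bound, ‖Sz‖² ≥ 0.64 loses at most 0.05. The gap
between 0.59 and twice 0.2 is what the later choice of a point needs. -/
theorem norm_compression_near {S X z p : A} (hS : star S = S) (hX : ‖X - S * S‖ ≤ 15 / 100)
    (hz : ‖z‖ = 1) (hSz : 8 / 10 ≤ ‖S * z‖) (hp : ‖star (S * z) * (S * z) - p‖ < 5 / 100) :
    ‖star z * X * z - p‖ ≤ 2 / 10 ∧ 59 / 100 ≤ ‖p‖ := by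
  constructor
  · have e : star z * X * z - p = star z * (X - S * S) * z + (star (S * z) * (S * z) - p) := by
      rw [mul_sub, sub_mul, star_mul, hS]
      simp only [mul_assoc]
      abel
    rw [e]
    have := norm_star_mul_mul_le (X := X - S * S) hz.le
    refine (norm_add_le _ _).trans ?_
    linarith
  · have h1 : 64 / 100 ≤ ‖star (S * z) * (S * z)‖ := by
      rw [CStarRing.norm_star_mul_self]
      nlinarith
    have h2 := norm_sub_norm_le (star (S * z) * (S * z)) p
    linarith

end Estimates


/-! ### From a nonzero ideal to a range projection -/

section NonzeroIdeals

variable {K : Type u} [MetricSpace K] [CompactSpace K] {N : ℕ} {γ : Fin N → C(K, K)}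
  {h : C(K, K)} {I : TwoSidedIdeal (core γ)}

theorem exists_mem_ambient_norm_eq_one (hne : I ≠ ⊥) : ∃ t ∈ ambient I, ‖t‖ = 1 := by
  obtain ⟨T, hT, h0⟩ : ∃ T ∈ I, T ≠ 0 := by
    by_contra hcon
    push Not at hcon
    exact hne (eq_bot_iff.2 fun T hT => (TwoSidedIdeal.mem_bot _).2 (hcon T hT))
  have h1 : ‖(T : cuntzPimsner γ)‖ ≠ 0 := fun hz => h0 (Subtype.ext (norm_eq_zero.1 hz))
  refine ⟨((‖(T : cuntzPimsner γ)‖⁻¹ : ℝ) : ℂ) • (T : cuntzPimsner γ),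
    Submodule.smul_mem _ _ (coe_mem_ambient.2 hT), ?_⟩
  rw [norm_smul, Complex.norm_real, norm_inv, norm_norm, inv_mul_cancel₀ h1]

variable [Nonempty K] (H : IsAdmissible γ h)

include H

/-- Since R ≠ 0, some compression of R by words is nonzero, so R moves some word to a nonzero
vector; its normalisation lies in the range of the cutoff, where S is bounded below. -/
theorem IsAdmissible.exists_unit_vector {n : ℕ} {R S : cuntzPimsner γ} (hR : R ∈ stabilizer γ n)
    (hR0 : R ≠ 0) {c : ℝ} (hRS : ∀ w, c * ‖R * w‖ ≤ ‖S * (R * w)‖) :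
    ∃ z ∈ (wordSpan γ n).topologicalClosure, ‖z‖ = 1 ∧ c ≤ ‖S * z‖ := by
  obtain ⟨ξ, η, hξη⟩ := H.exists_compress_ne_zero n hR.1 hR0
  have hz0 : R * opWord γ η ≠ 0 := fun h0 => hξη (by rw [mul_assoc, h0, mul_zero])
  have hz1 : ‖R * ((((‖R * opWord γ η‖⁻¹ : ℝ) : ℂ)) • opWord γ η)‖ = 1 := by
    rw [mul_smul_comm, norm_smul, Complex.norm_real, norm_inv, norm_norm,
      inv_mul_cancel₀ (norm_ne_zero_iff.2 hz0)]
  refine ⟨_, hR.2.1 _ (Submodule.le_topologicalClosure _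
    (Submodule.smul_mem _ (((‖R * opWord γ η‖⁻¹ : ℝ) : ℂ)) (opWord_mem η))), hz1, ?_⟩
  have := hRS ((((‖R * opWord γ η‖⁻¹ : ℝ) : ℂ)) • opWord γ η)
  rwa [hz1, mul_one] at this

/-- An approximant s of a norm-one t ∈ I acts on closed words of one length n. Compressing (t*t)² by
a word vector z on which s*s is large gives nearly |s*s z|², and such a square is close to a
function. -/
theorem IsAdmissible.exists_compression_near (hne : I ≠ ⊥) :
    ∃ (n : ℕ) (X : cuntzPimsner γ) (a : C(K, ℂ)) (x₀ : K), X ∈ core γ ∧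
      isom γ ^ n * X * star (isom γ ^ n) ∈ ambient I ∧ 2 * ‖X - opI γ a‖ < ‖a x₀‖ := by
  obtain ⟨t, ht, ht1⟩ := exists_mem_ambient_norm_eq_one hne
  have : Nontrivial (cuntzPimsner γ) :=
    ⟨t, 0, fun h0 => by rw [h0, norm_zero] at ht1; exact zero_ne_one ht1⟩
  obtain ⟨s, hs, hts⟩ := exists_coreSpan_near (ambient_le_core ht) (show (0 : ℝ) < 1 / 30 by norm_num)
  obtain ⟨n, hsn⟩ := exists_mem_stabilizer hs
  have hs1 : ‖s‖ ≤ 31 / 30 := by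
    have := norm_sub_norm_le s t
    rw [norm_sub_rev] at this
    linarith
  obtain ⟨hS2, hTS⟩ := norm_star_mul_self_near ht1 hts
  have hSn : star s * s ∈ stabilizer γ n := mul_mem (star_mem hsn) hsn
  obtain ⟨R, hR, hR0, hRS⟩ := exists_spectral_cutoff s (by norm_num) hS2
  -- The cutoff lies in the closed real star algebra generated by s*s, and the stabilizer is a
  -- closed real star algebra containing s*s.
  have hRn : R ∈ stabilizer γ n :=
    StarAlgebra.elemental.le_of_mem (isClosed_stabilizer n) hSn hR
  obtain ⟨z, hzn, hz1, hSz⟩ := H.exists_unit_vector hRn hR0 hRS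
  obtain ⟨a, ha⟩ := exists_opI_near (hSn.2.1 _ hzn) (hSn.2.1 _ hzn)
    (show (0 : ℝ) < 5 / 100 by norm_num)
  have hTI : star t * t * (star t * t) ∈ ambient I :=
    mul_mem_ambient_left (mul_mem (star_mem (ambient_le_core ht)) (ambient_le_core ht))
      (mul_mem_ambient_left (star_mem (ambient_le_core ht)) ht)
  obtain ⟨hXa, hal⟩ := norm_compression_near (by rw [star_mul, star_star]) hTS hz1 hSz ha
  -- The norm of a is at least 0.59, so a exceeds 0.4 somewhere, twice the error 0.2 of the
  -- compression.
  obtain ⟨x₀, hx₀⟩ : ∃ x₀, 4 / 10 < ‖a x₀‖ := by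
    by_contra hcon
    push Not at hcon
    have := (ContinuousMap.norm_le a (show (0 : ℝ) ≤ 4 / 10 by norm_num)).2 hcon
    have := norm_opI_le (γ := γ) a
    linarith
  have hzg := gauge_closure_wordSpan hzn
  refine ⟨n, star z * (star t * t * (star t * t)) * z, a, x₀, ?_, ?_, by linarith⟩
  · rw [mul_assoc]
    refine star_mul_mem_core_of_gauge hzg fun ζ => ?_
    rw [map_mul, ambient_le_core hTI ζ, hzg, mul_smul_comm]
  · have e : isom γ ^ n * (star z * (star t * t * (star t * t)) * z) * star (isom γ ^ n) =
        (isom γ ^ n * star z) * (star t * t * (star t * t)) * (z * star (isom γ ^ n)) := by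
      simp only [mul_assoc]
    rw [e]
    have hv := gauge_wordSpan (isom_pow_mem (γ := γ) n)
    exact mul_mem_ambient_right (mul_mem_ambient_left (mul_star_mem_core_of_gauge hv hzg) hTI)
      (mul_star_mem_core_of_gauge hzg hv)

-- The Neumann series is taken inside the core, which is itself a C*-algebra, so the inverse does
-- not leave it.
omit [Nonempty K] H in
theorem exists_right_inverse_of_near {Q : cuntzPimsner γ} (hQ : Q ∈ core γ) {c : ℂ}
    (hc : ‖Q - c • 1‖ < ‖c‖) : ∃ R ∈ core γ, Q * R = 1 := by
  have hc0 : c ≠ 0 := fun h0 => by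
    rw [h0, norm_zero] at hc
    exact absurd hc (not_lt.2 (norm_nonneg _))
  set Q' : core γ := ⟨Q, hQ⟩
  have hlt : ‖1 - c⁻¹ • Q'‖ < 1 := by
    have e : ((1 - c⁻¹ • Q' : core γ) : cuntzPimsner γ) = -(c⁻¹ • (Q - c • 1)) := by
      rw [smul_sub, smul_smul, inv_mul_cancel₀ hc0, one_smul, neg_sub]
      rfl
    change ‖((1 - c⁻¹ • Q' : core γ) : cuntzPimsner γ)‖ < 1
    rwa [e, norm_neg, norm_smul, norm_inv, inv_mul_lt_iff₀ (norm_pos_iff.2 hc0), mul_one]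
  have hu := isUnit_one_sub_of_norm_lt_one hlt
  rw [sub_sub_cancel] at hu
  obtain ⟨R, hR⟩ := hu.exists_right_inv
  refine ⟨((c⁻¹ • R : core γ) : cuntzPimsner γ), (c⁻¹ • R : core γ).2, ?_⟩
  rw [smul_mul_assoc, ← mul_smul_comm] at hR
  exact congrArg Subtype.val hR

/-- A nonzero closed ideal of the core contains the range projection of a power of the isometry. -/
theorem IsAdmissible.exists_isom_pow_mem (hne : I ≠ ⊥) :
    ∃ M, isom γ ^ M * star (isom γ ^ M) ∈ ambient I := by
  obtain ⟨n, X, a, x₀, hX, hXI, hXa⟩ := H.exists_compression_near hne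
  have ha0 : 0 < ‖a x₀‖ := by
    have := norm_nonneg (X - opI γ a)
    linarith
  obtain ⟨k, u, hu, huu, hua⟩ := H.exists_compressing_isometry a x₀
    (show 0 < ‖a x₀‖ / 4 by positivity)
  have hu1 : ‖u‖ ≤ 1 := by
    have h1 : ‖u‖ * ‖u‖ ≤ 1 := by
      rw [← CStarRing.norm_star_mul_self, huu, ← opI_one]
      exact (norm_opI_le _).trans ((ContinuousMap.norm_le _ zero_le_one).2 fun x => by simp)
    nlinarith [norm_nonneg u]
  have hQ : star u * X * u ∈ core γ := star_mul_mul_mem_core hu hX hu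
  have hlt : ‖star u * X * u - a x₀ • 1‖ < ‖a x₀‖ := by
    have e : star u * X * u - a x₀ • 1 =
        star u * (X - opI γ a) * u + (star u * opI γ a * u - a x₀ • 1) := by
      rw [mul_sub, sub_mul]
      abel
    rw [e]
    have := norm_star_mul_mul_le (X := X - opI γ a) hu1
    refine (norm_add_le _ _).trans_lt ?_
    linarith
  obtain ⟨R, hR, hQR⟩ := exists_right_inverse_of_near hQ hlt
  have hvn := star_isom_pow_mul_isom_pow (γ := γ) H.ne_zero n
  have hvM := star_isom_pow_mul_isom_pow (γ := γ) H.ne_zero (n + k)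
  refine ⟨n + k, ?_⟩
  set v := isom γ ^ n with hv
  set V := isom γ ^ (n + k) with hV
  have hVm : V ∈ wordSpan γ (n + k) := isom_pow_mem _
  have hvu : v * u ∈ wordSpan γ (n + k) := mul_mem_wordSpan (isom_pow_mem _) hu
  -- With Q = u* X u and Q R = 1, the right-hand side collapses to V Q R V*; its middle factor v X
  -- v* is in the ideal and the others are balanced.
  have key : V * star V = V * star (v * u) * (v * X * star v) * ((v * u) * star V) *
      (V * R * star V) := by
    have e : V * star (v * u) * (v * X * star v) * ((v * u) * star V) * (V * R * star V) =
        V * (star u * (star v * v) * X * (star v * v) * u * (star V * V) * R) * star V := by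
      rw [star_mul]
      simp only [mul_assoc]
    rw [e, hvn, hvM, mul_one, mul_one, mul_one, hQR, mul_one]
  rw [key]
  exact mul_mem_ambient_right (mul_mem_ambient_right (mul_mem_ambient_left
    (mul_star_mem_core hVm hvu) hXI) (mul_star_mem_core hvu hVm))
    (mul_mul_star_mem_core hVm hR hVm)

end NonzeroIdeals

/-! ### Closed ideals are intersections of level ideals -/

section Classification

variable {K : Type u} [MetricSpace K] [CompactSpace K] {N : ℕ} {γ : Fin N → C(K, K)}
  {h : C(K, K)} {I : TwoSidedIdeal (core γ)}

/-- The ideal of all `R` with `v R v* ∈ I`. -/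
def shiftIdeal (hN : N ≠ 0) (I : TwoSidedIdeal (core γ)) : TwoSidedIdeal (core γ) :=
  TwoSidedIdeal.mk' {R : core γ | isom γ * R * star (isom γ) ∈ ambient I}
    (by
      change isom γ * 0 * star (isom γ) ∈ ambient I
      rw [mul_zero, zero_mul]
      exact zero_mem _)
    (fun {R R'} hR hR' => by
      change isom γ * (R.1 + R'.1) * star (isom γ) ∈ ambient I
      rw [mul_add, add_mul]
      exact add_mem hR hR')
    (fun {R} hR => by
      change isom γ * (-R.1) * star (isom γ) ∈ ambient I
      rw [mul_neg, neg_mul]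
      exact neg_mem hR)
    (fun {X R} hR => by
      change isom γ * (X.1 * R.1) * star (isom γ) ∈ ambient I
      have e : isom γ * (X.1 * R.1) * star (isom γ) =
          isom γ * X.1 * star (isom γ) * (isom γ * R.1 * star (isom γ)) := by
        simp only [mul_assoc]
        rw [← mul_assoc (star (isom γ)) (isom γ), star_isom_mul_isom hN, one_mul]
      rw [e]
      exact mul_mem_ambient_left (mul_mul_star_mem_core isom_mem X.2 isom_mem) hR)
    (fun {R X} hR => by
      change isom γ * (R.1 * X.1) * star (isom γ) ∈ ambient I
      have e : isom γ * (R.1 * X.1) * star (isom γ) =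
          isom γ * R.1 * star (isom γ) * (isom γ * X.1 * star (isom γ)) := by
        simp only [mul_assoc]
        rw [← mul_assoc (star (isom γ)) (isom γ), star_isom_mul_isom hN, one_mul]
      rw [e]
      exact mul_mem_ambient_right hR (mul_mul_star_mem_core isom_mem X.2 isom_mem))

theorem mem_shiftIdeal {hN : N ≠ 0} {R : core γ} :
    R ∈ shiftIdeal hN I ↔ isom γ * R * star (isom γ) ∈ ambient I :=
  TwoSidedIdeal.mem_mk' _ _ _ _ _ _ _

theorem isClosed_shiftIdeal {hN : N ≠ 0} (hI : IsClosed (I : Set (core γ))) :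
    IsClosed (shiftIdeal hN I : Set (core γ)) := by
  have : (shiftIdeal hN I : Set (core γ)) =
      (fun R : core γ => isom γ * R * star (isom γ)) ⁻¹' ambient I := by
    ext R
    exact mem_shiftIdeal
  rw [this]
  exact (isClosed_ambient hI).preimage (by fun_prop)

theorem mem_ambient_shiftIdeal {hN : N ≠ 0} {R : cuntzPimsner γ} :
    R ∈ ambient (shiftIdeal hN I) ↔ R ∈ core γ ∧ isom γ * R * star (isom γ) ∈ ambient I :=
  ⟨fun ⟨h, h'⟩ => ⟨h, mem_shiftIdeal.1 h'⟩, fun ⟨h, h'⟩ => ⟨h, mem_shiftIdeal.2 h'⟩⟩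

variable [Nonempty K] (H : IsAdmissible γ h)

open Classical in
/-- The value of an operator at the root `b`. -/
def IsAdmissible.rootValue {b : K} (hb : b ∈ branchSet γ) : cuntzPimsner γ →ₗ[ℂ] ℂ where
  toFun T := H.eval T (lp.single 2 ⟨b, branchSet_subset_goodSet hb⟩ 1)
    ⟨b, branchSet_subset_goodSet hb⟩
  map_add' T T' := by
    rw [H.eval_add_apply]
    rfl
  map_smul' c T := by
    rw [H.eval_smul_apply]
    rfl

theorem IsAdmissible.rootValue_opI_mul {b : K} (hb : b ∈ branchSet γ) (a : C(K, ℂ))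
    (T : cuntzPimsner γ) : H.rootValue hb (opI γ a * T) = a b * H.rootValue hb T := by
  change H.eval (opI γ a * T) _ _ = _
  rw [H.eval_mul_apply, H.eval_opI, repI_apply]
  rfl

/-- The level O_{b,0} = {b} is one-dimensional and invariant under the core, so T acts there by a
single scalar. -/
theorem IsAdmissible.kills_zero_iff {b : K} (hb : b ∈ branchSet γ) {T : cuntzPimsner γ}
    (hT : T ∈ core γ) : H.Kills b 0 T ↔ H.rootValue hb T = 0 := by
  classical
  constructor
  · intro hk
    change H.eval T _ _ = 0
    rw [hk _ (single_mem_level hb)]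
    rfl
  · intro h0 g hg
    have hg1 : g = g ⟨b, branchSet_subset_goodSet hb⟩ •
        (lp.single 2 ⟨b, branchSet_subset_goodSet hb⟩ 1 : GoodL2 γ) := by
      ext x
      rw [lp.coeFn_smul, Pi.smul_apply, lp.single_apply]
      by_cases hx : x = ⟨b, branchSet_subset_goodSet hb⟩
      · subst hx
        simp
      · rw [Pi.single_eq_of_ne hx, smul_zero, hg x]
        rw [orbit_zero]
        exact fun hxb => hx (Subtype.ext hxb)
    ext x
    by_cases hx : x = ⟨b, branchSet_subset_goodSet hb⟩
    · subst hx
      rw [hg1, map_smul, lp.coeFn_smul, Pi.smul_apply]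
      change _ • H.rootValue hb T = _
      rw [h0, smul_zero]
      rfl
    · refine H.core_mem_level hb hT hg x ?_
      rw [orbit_zero]
      exact fun hxb => hx (Subtype.ext hxb)

include H

/-- Either all of I vanishes at the root, and then T does too, or some element of I has a nonzero
value there and can be rescaled. -/
theorem IsAdmissible.exists_rootValue_eq {b : K} (hb : b ∈ branchSet γ) {T : cuntzPimsner γ}
    (hT : T ∈ core γ) (hk : I ≤ H.levelIdeal hb 0 → H.Kills b 0 T) :
    ∃ Q ∈ ambient I, H.rootValue hb Q = H.rootValue hb T := by
  by_cases hle : I ≤ H.levelIdeal hb 0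
  · exact ⟨0, zero_mem _, by rw [map_zero, (H.kills_zero_iff hb hT).1 (hk hle)]⟩
  · obtain ⟨R, hR, hRk⟩ : ∃ R ∈ I, R ∉ H.levelIdeal hb 0 := by
      by_contra hcon
      push Not at hcon
      exact hle hcon
    have hne : H.rootValue hb R ≠ 0 := fun h0 =>
      hRk ((H.mem_levelIdeal hb).2 ((H.kills_zero_iff hb R.2).2 h0))
    refine ⟨(H.rootValue hb T / H.rootValue hb R) • (R : cuntzPimsner γ),
      Submodule.smul_mem _ _ (coe_mem_ambient.2 hR), ?_⟩
    rw [map_smul, smul_eq_mul, div_mul_cancel₀ _ hne]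

/-- The roots are finitely many, and multiplying by bump functions corrects the value at each one
without affecting the others. -/
theorem IsAdmissible.exists_kills_sub {T : cuntzPimsner γ} (hT : T ∈ core γ)
    (hk : ∀ b (hb : b ∈ branchSet γ), I ≤ H.levelIdeal hb 0 → H.Kills b 0 T) :
    ∃ Q ∈ ambient I, ∀ b ∈ branchSet γ, H.Kills b 0 (T - Q) := by
  classical
  choose f h1 h0 _ using fun b : K => exists_bump H.finite b
  choose Q hQ hQv using fun b : branchSet γ => H.exists_rootValue_eq b.2 hT (hk b b.2)
  have := H.finite.fintype
  have hQc : ∑ b : branchSet γ, opI γ (f b) * Q b ∈ ambient I :=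
    sum_mem fun b _ => mul_mem_ambient_left (fun z => gauge_opI γ z _) (hQ b)
  refine ⟨_, hQc, fun b hb => ?_⟩
  rw [H.kills_zero_iff hb (sub_mem hT (ambient_le_core hQc)), map_sub, map_sum,
    Finset.sum_eq_single ⟨b, hb⟩]
  · rw [H.rootValue_opI_mul, h1, one_mul, sub_eq_zero]
    exact (hQv ⟨b, hb⟩).symm
  · intro b' _ hne
    rw [H.rootValue_opI_mul, h0 b' b hb fun e => hne (Subtype.ext e.symm), zero_mul]
  · simp

/-- For M = 0 the ideal contains 1. In the step, the compressions of T belong to the shifted ideal,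
which contains v^M v^{*M}. Once the root values have been removed by an element of I,
`mem_ambient_of_compress` applies. -/
theorem IsAdmissible.mem_ambient_of_forall_kills (M : ℕ) (hI : IsClosed (I : Set (core γ)))
    (hM : isom γ ^ M * star (isom γ ^ M) ∈ ambient I) {T : cuntzPimsner γ} (hT : T ∈ core γ)
    (hk : ∀ b (hb : b ∈ branchSet γ) r, I ≤ H.levelIdeal hb r → H.Kills b r T) :
    T ∈ ambient I := by
  induction M generalizing I T with
  | zero =>
    rw [pow_zero, star_one, mul_one] at hM
    simpa using mul_mem_ambient_left hT hM
  | succ M ih =>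
    have hcomp : ∀ ξ η, star (opS γ ξ) * T * opS γ η ∈ ambient (shiftIdeal H.ne_zero I) := by
      intro ξ η
      refine ih (isClosed_shiftIdeal hI) (mem_ambient_shiftIdeal.2
        ⟨mul_star_mem_core (isom_pow_mem M) (isom_pow_mem M), ?_⟩)
        (star_mul_mul_mem_core (opS_mem_wordSpan ξ) hT (opS_mem_wordSpan η))
        fun b hb r hle => ?_
      · rw [pow_succ', star_mul] at hM
        simpa only [mul_assoc] using hM
      -- If the shifted ideal vanishes on level r, then I vanishes on level r + 1, because
      -- compressions of elements of I belong to the shifted ideal.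
      · refine (H.kills_succ_iff hb hT).1 (hk b hb (r + 1) fun R hR => ?_) ξ η
        refine (H.mem_levelIdeal hb).2 ((H.kills_succ_iff hb R.2).2 fun ξ' η' => ?_)
        have hRc := star_mul_mul_mem_core (opS_mem_wordSpan ξ') R.2 (opS_mem_wordSpan η')
        refine (H.mem_levelIdeal hb).1 (hle (x := ⟨_, hRc⟩) (mem_shiftIdeal.2 ?_))
        have e : isom γ * (star (opS γ ξ') * R * opS γ η') * star (isom γ) =
            isom γ * star (opS γ ξ') * R * (opS γ η' * star (isom γ)) := by
          simp only [mul_assoc]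
        rw [e]
        exact mul_mem_ambient_right (mul_mem_ambient_left
          (mul_star_mem_core isom_mem (opS_mem_wordSpan ξ')) (coe_mem_ambient.2 hR))
          (mul_star_mem_core (opS_mem_wordSpan η') isom_mem)
    -- Subtracting Q ∈ I makes all root values zero while the compressions, transported by v, remain
    -- in I.
    obtain ⟨Q, hQ, hQk⟩ := H.exists_kills_sub hT fun b hb => hk b hb 0
    have hTQ : T - Q ∈ ambient I := by
      refine H.mem_ambient_of_compress hI (sub_mem hT (ambient_le_core hQ)) hQk fun ξ η => ?_
      have h1 := (mem_ambient_shiftIdeal.1 (hcomp ξ η)).2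
      have e : isom γ * star (opS γ ξ) * (T - Q) * (opS γ η * star (isom γ)) =
          isom γ * (star (opS γ ξ) * T * opS γ η) * star (isom γ) -
          isom γ * star (opS γ ξ) * Q * (opS γ η * star (isom γ)) := by
        rw [mul_sub, sub_mul]
        simp only [mul_assoc]
      rw [e]
      exact sub_mem h1 (mul_mem_ambient_right (mul_mem_ambient_left
          (mul_star_mem_core isom_mem (opS_mem_wordSpan ξ)) hQ)
          (mul_star_mem_core (opS_mem_wordSpan η) isom_mem))
    simpa using add_mem hTQ hQ

/-- v^M maps level k isometrically into level k + M, and v^M v^{*M} fixes its range; so it cannot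
vanish on a level r ≥ M. -/
theorem IsAdmissible.lt_of_kills_isom_pow {b : K} (hb : b ∈ branchSet γ) {r M : ℕ}
    (hk : H.Kills b r (isom γ ^ M * star (isom γ ^ M))) : r < M := by
  classical
  by_contra hle
  obtain ⟨k, rfl⟩ := Nat.exists_eq_add_of_le' (not_lt.1 hle)
  have : NeZero N := ⟨H.ne_zero⟩
  obtain ⟨x, hx⟩ := nonempty_orbit (γ := γ) b k
  set y : goodSet γ := ⟨x, orbit_subset_goodSet hb k hx⟩
  have hg : (lp.single 2 y 1 : GoodL2 γ) ∈ level γ b k := by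
    intro z hz
    rw [lp.single_apply, Pi.single_eq_of_ne]
    rintro rfl
    exact hz hx
  have h1 := hk _ (H.word_mem_level (isom_pow_mem M) hg)
  have h2 := congrArg (H.eval (star (isom γ ^ M))) h1
  have hv := star_isom_pow_mul_isom_pow (γ := γ) H.ne_zero M
  rw [← H.eval_mul_apply, ← H.eval_mul_apply, map_zero] at h2
  have e : star (isom γ ^ M) * (isom γ ^ M * star (isom γ ^ M)) * isom γ ^ M = 1 := by
    rw [← mul_assoc, hv, one_mul, hv]
  rw [e, map_one] at h2
  have h3 := congrArg (fun g : GoodL2 γ => g y) h2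
  simp [lp.single_apply] at h3

/-- A nonzero closed ideal of the core is a finite intersection of level ideals. -/
theorem IsAdmissible.exists_finset_of_ne_bot (hI : IsClosed (I : Set (core γ))) (hne : I ≠ ⊥) :
    ∃ s : Finset (K × ℕ), (∀ q ∈ s, q.1 ∈ branchSet γ) ∧
      ∀ T : core γ, T ∈ I ↔ ∀ q ∈ s, H.Kills q.1 q.2 T := by
  obtain ⟨M, hM⟩ := H.exists_isom_pow_mem hne
  -- A level kernel containing I contains v^M v^{*M}, hence has r < M, and the branch set is finite.
  have hfin : {q : K × ℕ | ∃ hb : q.1 ∈ branchSet γ, I ≤ H.levelIdeal hb q.2}.Finite := by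
    refine (H.finite.prod (Set.finite_Iio M)).subset ?_
    rintro ⟨b, r⟩ ⟨hb, hle⟩
    exact ⟨hb, H.lt_of_kills_isom_pow hb ((H.mem_levelIdeal hb).1 (hle hM.2))⟩
  refine ⟨hfin.toFinset, fun q hq => (hfin.mem_toFinset.1 hq).1, fun T => ⟨fun hT q hq => ?_,
    fun hT => ?_⟩⟩
  · obtain ⟨hb, hle⟩ := hfin.mem_toFinset.1 hq
    exact (H.mem_levelIdeal hb).1 (hle hT)
  · exact coe_mem_ambient.1 (H.mem_ambient_of_forall_kills M hI hM T.2
      fun b hb r hle => hT (b, r) (hfin.mem_toFinset.2 ⟨hb, hle⟩))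

theorem IsAdmissible.exists_ideal {s : Finset (K × ℕ)} (hs : ∀ q ∈ s, q.1 ∈ branchSet γ) :
    ∃ I : TwoSidedIdeal (core γ), IsClosed (I : Set (core γ)) ∧
      ∀ T : core γ, T ∈ I ↔ ∀ q ∈ s, H.Kills q.1 q.2 T := by
  have hmem : ∀ T : core γ, T ∈ ⨅ q : s, H.levelIdeal (hs q q.2) q.1.2 ↔
      ∀ q ∈ s, H.Kills q.1 q.2 T := by
    intro T
    rw [TwoSidedIdeal.mem_iInf]
    exact ⟨fun hT q hq => (H.mem_levelIdeal (hs q hq)).1 (hT ⟨q, hq⟩),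
      fun hT q => (H.mem_levelIdeal (hs q q.2)).2 (hT q q.2)⟩
  refine ⟨_, ?_, hmem⟩
  have : ((⨅ q : s, H.levelIdeal (hs q q.2) q.1.2 : TwoSidedIdeal (core γ)) : Set (core γ)) =
      ⋂ q : s, (H.levelIdeal (hs q q.2) q.1.2 : Set (core γ)) := by
    ext T
    rw [Set.mem_iInter]
    exact TwoSidedIdeal.mem_iInf _
  rw [this]
  exact isClosed_iInter fun q => H.isClosed_levelIdeal _ _

/-! ### Zero sets -/

theorem IsAdmissible.kills_opI_iff {b : K} (hb : b ∈ branchSet γ) {r : ℕ} {a : C(K, ℂ)} :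
    H.Kills b r (opI γ a) ↔ ∀ x ∈ orbit γ b r, a x = 0 := by
  classical
  constructor
  · intro hk x hx
    set y : goodSet γ := ⟨x, orbit_subset_goodSet hb r hx⟩
    have hg : (lp.single 2 y 1 : GoodL2 γ) ∈ level γ b r := by
      intro z hz
      rw [lp.single_apply, Pi.single_eq_of_ne]
      rintro rfl
      exact hz hx
    have := congrArg (fun g : GoodL2 γ => g y) (hk _ hg)
    simpa [H.eval_opI, repI_apply, lp.single_apply] using this
  · intro h0 g hg
    ext y
    rw [H.eval_opI, repI_apply]
    by_cases hy : (y : K) ∈ orbit γ b r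
    · rw [h0 y hy, zero_mul]
      rfl
    · rw [hg y hy, mul_zero]
      rfl

omit H [Nonempty K] [CompactSpace K] in
theorem finite_iUnion_orbit (s : Finset (K × ℕ)) : (⋃ q ∈ s, orbit γ q.1 q.2).Finite :=
  s.finite_toSet.biUnion fun q _ => finite_orbit q.1 q.2

/-- On level O_{b,r} a function acts by multiplication, so membership in I means vanishing on the
union of orbits. That union is finite, and a bump function detects every point outside it. -/
theorem IsAdmissible.zeroSet_eq {s : Finset (K × ℕ)} (hs : ∀ q ∈ s, q.1 ∈ branchSet γ)
    (hI : ∀ T : core γ, T ∈ I ↔ ∀ q ∈ s, H.Kills q.1 q.2 T) :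
    zeroSet γ I = ⋃ q ∈ s, orbit γ q.1 q.2 := by
  classical
  have hmem : ∀ a, coreI γ a ∈ I ↔ ∀ x ∈ ⋃ q ∈ s, orbit γ q.1 q.2, a x = 0 := by
    intro a
    rw [hI]
    constructor
    · intro hk x hx
      obtain ⟨q, hq, hx⟩ := Set.mem_iUnion₂.1 hx
      exact (H.kills_opI_iff (hs q hq)).1 (hk q hq) x hx
    · intro h0 q hq
      exact (H.kills_opI_iff (hs q hq)).2 fun x hx => h0 x (Set.mem_iUnion₂.2 ⟨q, hq, hx⟩)
  ext x
  refine ⟨fun hx => ?_, fun hx a ha => (hmem a).1 ha x hx⟩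
  by_contra hxF
  obtain ⟨f, h1, h0, _⟩ := exists_bump (finite_iUnion_orbit (γ := γ) s) x
  refine one_ne_zero (h1.symm.trans (hx f ((hmem f).2 fun y hy => h0 y hy ?_)))
  rintro rfl
  exact hxF hy

/-- C(K) acts faithfully by multiplication on ℓ² of the good set because that set is dense. -/
theorem IsAdmissible.zeroSet_bot : zeroSet γ (⊥ : TwoSidedIdeal (core γ)) = Set.univ := by
  classical
  refine Set.eq_univ_of_forall fun x a ha => ?_
  have h0 : opI γ a = 0 := congrArg Subtype.val ((TwoSidedIdeal.mem_bot _).1 ha)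
  have hY : Set.EqOn a 0 (goodSet γ) := by
    intro y hy
    have := congrArg (fun T => H.eval T (lp.single 2 (⟨y, hy⟩ : goodSet γ) 1) ⟨y, hy⟩) h0
    simpa [H.eval_opI, repI_apply, lp.single_apply] using this
  exact congrFun (Continuous.ext_on H.dense a.continuous continuous_zero hY) x

/-- Orbits are nonempty and disjoint for distinct indices, so one point of an orbit identifies its
index. -/
theorem IsAdmissible.iUnion_orbit_subset_iff {s s' : Finset (K × ℕ)}
    (hs : ∀ q ∈ s, q.1 ∈ branchSet γ) (hs' : ∀ q ∈ s', q.1 ∈ branchSet γ)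
    (hss : (⋃ q ∈ s, orbit γ q.1 q.2) = ⋃ q ∈ s', orbit γ q.1 q.2) : s ⊆ s' := by
  intro q hq
  have : NeZero N := ⟨H.ne_zero⟩
  obtain ⟨x, hx⟩ := nonempty_orbit (γ := γ) q.1 q.2
  have hx' : x ∈ ⋃ q ∈ s', orbit γ q.1 q.2 := hss ▸ Set.mem_iUnion₂.2 ⟨q, hq, hx⟩
  obtain ⟨q', hq', hx'⟩ := Set.mem_iUnion₂.1 hx'
  obtain ⟨h1, h2⟩ := H.orbit_disjoint (hs q hq) (hs' q' hq') hx hx'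
  rwa [Prod.ext h1 h2]

theorem IsAdmissible.iUnion_orbit_ne_univ (s : Finset (K × ℕ)) :
    (⋃ q ∈ s, orbit γ q.1 q.2) ≠ Set.univ := fun hu => by
  have := H.infinite H.two_le
  exact Set.infinite_univ (hu ▸ finite_iUnion_orbit (γ := γ) s)

/-- A closed ideal of the core is determined by its zero set. -/
theorem IsAdmissible.eq_of_zeroSet_eq {I' : TwoSidedIdeal (core γ)}
    (hI : IsClosed (I : Set (core γ))) (hI' : IsClosed (I' : Set (core γ)))
    (hz : zeroSet γ I = zeroSet γ I') : I = I' := by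
  by_cases hb : I = ⊥ <;> by_cases hb' : I' = ⊥
  · rw [hb, hb']
  · obtain ⟨s, hs, hsI⟩ := H.exists_finset_of_ne_bot hI' hb'
    rw [hb, H.zeroSet_bot, H.zeroSet_eq hs hsI] at hz
    exact absurd hz.symm (H.iUnion_orbit_ne_univ s)
  · obtain ⟨s, hs, hsI⟩ := H.exists_finset_of_ne_bot hI hb
    rw [hb', H.zeroSet_bot, H.zeroSet_eq hs hsI] at hz
    exact absurd hz (H.iUnion_orbit_ne_univ s)
  · obtain ⟨s, hs, hsI⟩ := H.exists_finset_of_ne_bot hI hb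
    obtain ⟨s', hs', hsI'⟩ := H.exists_finset_of_ne_bot hI' hb'
    rw [H.zeroSet_eq hs hsI, H.zeroSet_eq hs' hsI'] at hz
    obtain rfl : s = s' := Finset.Subset.antisymm (H.iUnion_orbit_subset_iff hs hs' hz)
      (H.iUnion_orbit_subset_iff hs' hs hz.symm)
    ext T
    rw [hsI, hsI']

end Classification

/-! ### The matrix representations and the model ideals -/

section ModelIdeals

variable {K : Type u} [MetricSpace K] {N : ℕ} {γ : Fin N → C(K, K)}

theorem map_tailPt {n : ℕ} (p : Fin n → Fin N) (k : Fin n) (x : K) :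
    γ (p k) (tailPt γ p (k + 1) x) = tailPt γ p k x := by
  rw [tailPt, tailPt, List.drop_eq_getElem_cons (i := k) (by simp), wordMap_cons]
  simp

theorem tailPt_tail {n : ℕ} (p : Fin (n + 1) → Fin N) (k : ℕ) (x : K) :
    tailPt γ (Fin.tail p) k x = tailPt γ p (k + 1) x := by
  rw [tailPt, tailPt, List.ofFn_succ, List.drop_succ_cons]
  rfl

theorem wordMap_mem_goodSet (w : List (Fin N)) {x : K} (hx : x ∈ goodSet γ) :
    wordMap γ w x ∈ goodSet γ := by
  induction w with
  | nil => exact hx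
  | cons j w ih => exact map_mem_goodSet ih j

theorem mem_orbit_iff_tailPt {b x : K} {n : ℕ} :
    x ∈ orbit γ b n ↔ ∃ p : Fin n → Fin N, tailPt γ p 0 b = x := by
  constructor
  · rintro ⟨w, rfl, rfl⟩
    exact ⟨w.get, by rw [tailPt, List.drop_zero, List.ofFn_get]⟩
  · rintro ⟨p, rfl⟩
    exact ⟨List.ofFn p, List.length_ofFn, rfl⟩

/-- Words of equal length act freely on good points, so equality of the tail points encodes equality
of the letters after the first r. -/
theorem HasInverse.tailPt_eq_iff {h : C(K, K)} (H : HasInverse γ h) {n : ℕ} {y : K}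
    (hy : y ∈ goodSet γ) (p q : Fin n → Fin N) (r : ℕ) :
    tailPt γ p r y = tailPt γ q r y ↔ ∀ k : Fin n, r ≤ k → p k = q k := by
  have hlist : (List.ofFn p).drop r = (List.ofFn q).drop r ↔ ∀ k : Fin n, r ≤ k → p k = q k := by
    constructor
    · intro hd k hk
      have := congrArg (fun l => l[(k - r : ℕ)]?) hd
      simpa [List.getElem?_drop, Nat.add_sub_cancel' hk, List.getElem?_ofFn] using this
    · intro hpq
      refine List.ext_getElem (by simp) fun i h1 h2 => ?_
      simp only [List.getElem_drop, List.getElem_ofFn]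
      exact hpq _ (Nat.le_add_right r i)
  rw [← hlist]
  constructor
  · intro he
    exact H.wordMap_injective hy (by simp) he
  · intro he
    rw [tailPt, tailPt, he]

/-- The point `γ_{p_{k+1}} ∘ ⋯ ∘ γ_{p_n}(y)`, as a point of the good set. -/
def goodTail (γ : Fin N → C(K, K)) {n : ℕ} (p : Fin n → Fin N) (k : ℕ) (y : goodSet γ) :
    goodSet γ := ⟨tailPt γ p k y, wordMap_mem_goodSet _ y.2⟩

theorem goodTail_tail {n : ℕ} (p : Fin (n + 1) → Fin N) (k : ℕ) (y : goodSet γ) :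
    goodTail γ (Fin.tail p) k y = goodTail γ p (k + 1) y := Subtype.ext (tailPt_tail p k _)

theorem goodMap_goodTail {n : ℕ} (p : Fin (n + 1) → Fin N) (y : goodSet γ) :
    goodMap γ (p 0) (goodTail γ p 1 y) = goodTail γ p 0 y := Subtype.ext (map_tailPt p 0 _)

variable [CompactSpace K]

theorem tensorCoord_succ {n r : ℕ} (hr : r + 1 ≤ n + 1) (ξ : Fin (r + 1) → Corr γ)
    (p : Fin (n + 1) → Fin N) (x : K) :
    tensorCoord γ hr ξ p x = ξ 0 (cographPt γ (p 0) (tailPt γ p 1 x)) *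
      tensorCoord γ (Nat.le_of_succ_le_succ hr) (Fin.tail ξ) (Fin.tail p) x := by
  rw [tensorCoord, Fin.prod_univ_succ, tensorCoord]
  congr 1
  refine Finset.prod_congr rfl fun k _ => ?_
  rw [tailPt_tail]
  rfl

variable [Nonempty K] {h : C(K, K)} (H : IsAdmissible γ h)

include H

open Classical in
theorem IsAdmissible.star_opS_single (ξ : Corr γ) (j : Fin N) (y : goodSet γ) :
    H.eval (star (opS γ ξ)) (lp.single 2 (goodMap γ j y) (1 : ℂ)) =
      star (ξ (cographPt γ j y)) • lp.single 2 y (1 : ℂ) := by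
  ext z
  rw [H.eval_star_opS_apply, lp.coeFn_smul, Pi.smul_apply, Finset.sum_eq_single j]
  · rw [lp.single_apply, lp.single_apply]
    by_cases hz : z = y
    · subst hz
      simp
    · rw [Pi.single_eq_of_ne hz, Pi.single_eq_of_ne, mul_zero, smul_zero]
      exact fun he => hz (Subtype.ext (H.map_injective (congrArg Subtype.val he)))
  · intro k _ hk
    rw [lp.single_apply, Pi.single_eq_of_ne, mul_zero]
    intro he
    have h1 : γ k z = γ j y := congrArg Subtype.val he
    have h2 := H.map_injective h1
    rw [h2] at h1
    exact hk (H.index_injective y.2 h1)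
  · simp

/-- Each factor S_{ξ_k} contributes the value of ξ_k on one edge (x_{k-1}, x_k) of the path from x_0
back to x_r. -/
theorem IsAdmissible.opWord_apply {n r : ℕ} (hr : r ≤ n) (ξ : Fin r → Corr γ)
    (p : Fin n → Fin N) (y : goodSet γ) (g : GoodL2 γ) :
    H.eval (opWord γ ξ) g (goodTail γ p 0 y) = tensorCoord γ hr ξ p y * g (goodTail γ p r y) := by
  induction r generalizing n with
  | zero =>
    rw [opWord_zero, map_one, tensorCoord, Finset.univ_eq_empty, Finset.prod_empty, one_mul]
    rfl
  | succ r ih =>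
    obtain ⟨n, rfl⟩ : ∃ m, n = m + 1 := ⟨n - 1, by omega⟩
    rw [opWord_succ, H.eval_mul_apply, H.eval_opS, ← goodMap_goodTail, H.repS_apply,
      tensorCoord_succ, ← goodTail_tail, ih (Nat.le_of_succ_le_succ hr), goodTail_tail, mul_assoc]
    rw [goodTail_tail]
    rfl

open Classical in
theorem IsAdmissible.star_opWord_single {n r : ℕ} (hr : r ≤ n) (ξ : Fin r → Corr γ)
    (p : Fin n → Fin N) (y : goodSet γ) :
    H.eval (star (opWord γ ξ)) (lp.single 2 (goodTail γ p 0 y) (1 : ℂ)) =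
      star (tensorCoord γ hr ξ p y) • lp.single 2 (goodTail γ p r y) (1 : ℂ) := by
  induction r generalizing n with
  | zero =>
    rw [opWord_zero, star_one, map_one, tensorCoord, Finset.univ_eq_empty, Finset.prod_empty,
      star_one, one_smul]
    rfl
  | succ r ih =>
    obtain ⟨n, rfl⟩ : ∃ m, n = m + 1 := ⟨n - 1, by omega⟩
    rw [opWord_succ, star_mul, H.eval_mul_apply, ← goodMap_goodTail, H.star_opS_single, map_smul,
      ← goodTail_tail, ih (Nat.le_of_succ_le_succ hr), tensorCoord_succ, goodTail_tail,
      goodTail_tail, star_mul, smul_smul, mul_comm (star _)]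
    rfl

omit [Nonempty K] H in
theorem elemOp_mem_core {r : ℕ} (ξ η : Fin r → Corr γ) (a : C(K, ℂ)) :
    elemOp γ ξ η a ∈ core γ := mul_star_mem_core (opWord_mul_opI_mem ξ a) (opWord_mem η)

omit [Nonempty K] H in
theorem elemOp_mem_compactLevel {r : ℕ} (ξ η : Fin r → Corr γ) (a : C(K, ℂ)) :
    elemOp γ ξ η a ∈ compactLevel γ r :=
  Submodule.le_topologicalClosure _ (Submodule.subset_span ⟨ξ, η, a, rfl⟩)

omit [Nonempty K] H in
theorem elemOp_mem_matrixGraph {n r : ℕ} (hr : r ≤ n) (ξ η : Fin r → Corr γ) (a : C(K, ℂ)) :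
    (elemOp γ ξ η a, matrixOf γ hr ξ η a) ∈ matrixGraph γ n :=
  Submodule.le_topologicalClosure _ (Submodule.subset_span ⟨r, hr, ξ, η, a, rfl⟩)

open Classical in
/-- The matrix representation computes the matrix coefficients at the points
`γ_{p_1} ∘ ⋯ ∘ γ_{p_n}(y)`. -/
theorem IsAdmissible.eval_eq_of_mem_matrixGraph {n : ℕ}
    {P : cuntzPimsner γ × C(K, Matrix (Fin n → Fin N) (Fin n → Fin N) ℂ)}
    (hP : P ∈ matrixGraph γ n) (y : goodSet γ) (p q : Fin n → Fin N) :
    H.eval P.1 (lp.single 2 (goodTail γ q 0 y) 1) (goodTail γ p 0 y) = P.2 y p q := by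
  have hcl : IsClosed {P : cuntzPimsner γ × C(K, Matrix (Fin n → Fin N) (Fin n → Fin N) ℂ) |
      H.eval P.1 (lp.single 2 (goodTail γ q 0 y) 1) (goodTail γ p 0 y) = P.2 y p q} := by
    refine isClosed_eq ?_ ?_
    · have hc : Continuous fun g : GoodL2 γ => g (goodTail γ p 0 y) :=
        (continuous_apply _).comp lp.uniformContinuous_coe.continuous
      exact hc.comp ((H.continuous_eval_apply _).comp continuous_fst)
    · have hc : Continuous fun M : Matrix (Fin n → Fin N) (Fin n → Fin N) ℂ => M p q :=
        continuous_id.matrix_elem p q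
      exact hc.comp ((continuous_eval_const (y : K)).comp continuous_snd)
  refine closure_minimal (fun P hP => ?_) hcl hP
  induction hP using Submodule.span_induction with
  | mem P hP =>
    obtain ⟨r, hr, ξ, η, a, rfl⟩ := hP
    change H.eval (elemOp γ ξ η a) _ _ = if _ then _ else _
    rw [elemOp, H.eval_mul_apply, H.eval_mul_apply, H.star_opWord_single hr, H.opWord_apply hr,
      H.eval_opI, repI_apply, lp.coeFn_smul, Pi.smul_apply, lp.single_apply, Pi.single_apply]
    -- The Kronecker delta in Π^{(n)} is the orthogonality of the vectors at the two tail points.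
    have hiff : goodTail γ p r y = goodTail γ q r y ↔ ∀ k : Fin n, r ≤ k.val → p k = q k :=
      Subtype.ext_iff.trans (H.tailPt_eq_iff y.2 p q r)
    by_cases hpq : ∀ k : Fin n, r ≤ k.val → p k = q k
    · rw [if_pos hpq, if_pos (hiff.2 hpq), smul_eq_mul, mul_one, mul_assoc]
      rfl
    · rw [if_neg hpq, if_neg fun he => hpq (hiff.1 he), smul_zero, mul_zero, mul_zero]
  | zero =>
    change H.eval 0 _ _ = 0
    rw [map_zero]
    rfl
  | add P Q _ _ h h' =>
    change H.eval (P.1 + Q.1) _ _ = P.2 y p q + Q.2 y p q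
    rw [H.eval_add_apply, ← h, ← h']
    rfl
  | smul c P _ h =>
    change H.eval (c • P.1) _ _ = c * P.2 y p q
    rw [H.eval_smul_apply, ← h]
    rfl

omit [Nonempty K] H in
theorem mem_core_of_mem_matrixGraph {n : ℕ}
    {P : cuntzPimsner γ × C(K, Matrix (Fin n → Fin N) (Fin n → Fin N) ℂ)}
    (hP : P ∈ matrixGraph γ n) : P.1 ∈ core γ := by
  refine closure_minimal (fun P hP => ?_) ((isClosed_core γ).preimage continuous_fst) hP
  induction hP using Submodule.span_induction with
  | mem P hP =>
    obtain ⟨r, hr, ξ, η, a, rfl⟩ := hP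
    exact elemOp_mem_core ξ η a
  | zero => exact zero_mem (core γ)
  | add P Q _ _ h h' => exact add_mem (S := StarSubalgebra ℂ (cuntzPimsner γ)) h h'
  | smul c P _ h => exact (core γ).smul_mem h c

omit H in
/-- The subspace of the operators which vanish on a level. -/
def IsAdmissible.killSubmodule (H : IsAdmissible γ h) (b : K) (r : ℕ) :
    Submodule ℂ (cuntzPimsner γ) where
  carrier := {T | H.Kills b r T}
  add_mem' {T T'} hT hT' g hg := by rw [H.eval_add_apply, hT g hg, hT' g hg, add_zero]
  zero_mem' g _ := by rw [map_zero]; rfl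
  smul_mem' c T hT g hg := by rw [H.eval_smul_apply, hT g hg, smul_zero]

theorem IsAdmissible.compactLevel_le {b : K} (hb : b ∈ branchSet γ) {n k : ℕ} (hk : n < k) :
    compactLevel γ k ≤ H.killSubmodule b n := by
  refine Submodule.topologicalClosure_minimal _ (Submodule.span_le.2 ?_) (H.isClosed_kills b n)
  rintro _ ⟨ξ, η, a, rfl⟩ g hg
  rw [elemOp, H.eval_mul_apply, H.star_word_level_eq_zero hb (opWord_mem η) hk hg, map_zero]

open Classical in
omit H [Nonempty K] in
theorem single_goodTail_mem_level {b : K} (hb : b ∈ branchSet γ) {n : ℕ} (q : Fin n → Fin N) :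
    (lp.single 2 (goodTail γ q 0 ⟨b, branchSet_subset_goodSet hb⟩) 1 : GoodL2 γ) ∈
      level γ b n := by
  intro z hz
  rw [lp.single_apply, Pi.single_eq_of_ne]
  rintro rfl
  exact hz (mem_orbit_iff_tailPt.2 ⟨q, rfl⟩)

/-- The vectors at the points γ_{q_1} ∘ ⋯ ∘ γ_{q_n}(b) form an orthonormal basis of the level, and
Π^{(n)}(T)(b) is the matrix of T in this basis. -/
theorem IsAdmissible.modelBase_le {b : K} (hb : b ∈ branchSet γ) (n : ℕ) :
    modelBase γ b n ≤ H.killSubmodule b n := by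
  classical
  rintro T ⟨M, hTM, hM⟩ g hg
  have hT : T ∈ core γ := mem_core_of_mem_matrixGraph hTM
  set y : goodSet γ := ⟨b, branchSet_subset_goodSet hb⟩ with hy
  have hsum : g = ∑ q : Fin n → Fin N, g (goodTail γ q 0 y) •
      (lp.single 2 (goodTail γ q 0 y) 1 : GoodL2 γ) := by
    have hinj : ∀ p q : Fin n → Fin N, goodTail γ p 0 y = goodTail γ q 0 y ↔ p = q := fun p q =>
      Subtype.ext_iff.trans ((H.tailPt_eq_iff y.2 p q 0).trans
        ⟨fun hpq => funext fun k => hpq k (Nat.zero_le _), fun hpq k _ => hpq ▸ rfl⟩)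
    ext x
    rw [lp.coeFn_sum, Finset.sum_apply]
    by_cases hx : (x : K) ∈ orbit γ b n
    · obtain ⟨p, hp⟩ := mem_orbit_iff_tailPt.1 hx
      obtain rfl : goodTail γ p 0 y = x := Subtype.ext hp
      rw [Finset.sum_eq_single p]
      · simp [lp.single_apply]
      · intro q _ hq
        rw [lp.coeFn_smul, Pi.smul_apply, lp.single_apply, Pi.single_eq_of_ne, smul_zero]
        exact fun he => hq ((hinj p q).1 he).symm
      · simp
    · rw [hg x hx, eq_comm]
      refine Finset.sum_eq_zero fun q _ => ?_
      rw [lp.coeFn_smul, Pi.smul_apply, single_goodTail_mem_level hb q x hx, smul_zero]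
  ext x
  by_cases hx : (x : K) ∈ orbit γ b n
  · obtain ⟨p, hp⟩ := mem_orbit_iff_tailPt.1 hx
    obtain rfl : goodTail γ p 0 y = x := Subtype.ext hp
    rw [hsum, map_sum, lp.coeFn_sum, Finset.sum_apply]
    refine Finset.sum_eq_zero fun q _ => ?_
    have := H.eval_eq_of_mem_matrixGraph hTM y p q
    rw [map_smul, lp.coeFn_smul, Pi.smul_apply, this, hy]
    change _ • M b p q = 0
    rw [hM, Matrix.zero_apply, smul_zero]
  · exact H.core_mem_level hb hT hg x hx

theorem IsAdmissible.modelIdeal_subset {b : K} (hb : b ∈ branchSet γ) (n : ℕ) :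
    modelIdeal γ b n ⊆ {T | H.Kills b n T} := by
  refine closure_minimal (Set.iUnion₂_subset fun m _ => ?_) (H.isClosed_kills b n)
  have : modelLevel γ b n m ≤ H.killSubmodule b n :=
    sup_le (H.modelBase_le hb n) (iSup₂_le fun k hk => H.compactLevel_le hb (Finset.mem_Ioc.1 hk).1)
  exact this

omit [Nonempty K] H in
theorem mul_star_mem_of_elemOp_mem {k : ℕ} {P : Submodule ℂ (cuntzPimsner γ)}
    (hP : ∀ (ξ η : Fin k → Corr γ) a, elemOp γ ξ η a ∈ P) {e f : cuntzPimsner γ}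
    (he : e ∈ wordSpan γ k) (hf : f ∈ wordSpan γ k) : e * star f ∈ P := by
  induction he using Submodule.span_induction with
  | mem e he =>
    obtain ⟨ξ, a, rfl⟩ := he
    induction hf using Submodule.span_induction with
    | mem f hf =>
      obtain ⟨η, a', rfl⟩ := hf
      have := hP ξ η (a * star a')
      rw [elemOp, opI_mul, opI_star] at this
      rw [star_mul]
      simpa only [mul_assoc] using this
    | zero => rw [star_zero, mul_zero]; exact zero_mem _
    | add f g _ _ h h' => rw [star_add, mul_add]; exact add_mem h h'
    | smul c f _ h => rw [star_smul, mul_smul_comm]; exact Submodule.smul_mem _ _ h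
  | zero => rw [zero_mul]; exact zero_mem _
  | add e g _ _ h h' => rw [add_mul]; exact add_mem h h'
  | smul c e _ h => rw [smul_mul_assoc]; exact Submodule.smul_mem _ _ h

-- Monomials of length at most n carry a matrix function, and the longer ones are compact operators
-- of some level in (n, m].
omit [Nonempty K] H in
theorem exists_decomposition (n : ℕ) {S : cuntzPimsner γ} (hS : S ∈ coreSpan γ) :
    ∃ m > n, ∃ P ∈ matrixGraph γ n, ∃ S' ∈ ⨆ k ∈ Finset.Ioc n m, compactLevel γ k,
      S = P.1 + S' := by
  induction hS using Submodule.span_induction with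
  | mem S hS =>
    obtain ⟨k, e, he, f, hf, rfl⟩ := Set.mem_iUnion.1 hS
    rcases le_or_gt k n with hk | hk
    · obtain ⟨P, hP, hPe⟩ := mul_star_mem_of_elemOp_mem
        (P := (matrixGraph γ n).map (LinearMap.fst ℂ (cuntzPimsner γ)
          C(K, Matrix (Fin n → Fin N) (Fin n → Fin N) ℂ)))
        (fun ξ η a => Submodule.mem_map.2 ⟨(elemOp γ ξ η a, matrixOf γ hk ξ η a),
          elemOp_mem_matrixGraph hk ξ η a, rfl⟩) he hf
      -- The second summand is zero; n + 1 only serves the strict bound m > n.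
      exact ⟨n + 1, Nat.lt_succ_self n, P, hP, 0, zero_mem _, by rw [add_zero]; exact hPe.symm⟩
    · refine ⟨k, hk, 0, zero_mem _, e * star f, ?_, (zero_add _).symm⟩
      exact Submodule.mem_iSup_of_mem k (Submodule.mem_iSup_of_mem (Finset.mem_Ioc.2 ⟨hk, le_rfl⟩)
        (mul_star_mem_of_elemOp_mem elemOp_mem_compactLevel he hf))
  | zero =>
    exact ⟨n + 1, Nat.lt_succ_self n, 0, zero_mem _, 0, zero_mem _, (zero_add _).symm⟩
  | add S R _ _ h h' =>
    obtain ⟨m, hm, P, hP, S', hS', rfl⟩ := h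
    obtain ⟨m', hm', P', hP', R', hR', rfl⟩ := h'
    have hmono : ∀ m₁ ≤ max m m', ⨆ k ∈ Finset.Ioc n m₁, compactLevel γ k ≤
        ⨆ k ∈ Finset.Ioc n (max m m'), compactLevel γ k := fun m₁ hm₁ =>
      biSup_mono fun k hk => Finset.Ioc_subset_Ioc_right hm₁ hk
    refine ⟨max m m', hm.trans_le (le_max_left _ _), P + P', add_mem hP hP', S' + R',
      add_mem (hmono m (le_max_left _ _) hS') (hmono m' (le_max_right _ _) hR'), ?_⟩
    rw [Prod.fst_add]
    abel
  | smul c S _ h =>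
    obtain ⟨m, hm, P, hP, S', hS', rfl⟩ := h
    exact ⟨m, hm, c • P, Submodule.smul_mem _ _ hP, c • S', Submodule.smul_mem _ _ hS',
      smul_add _ _ _⟩

omit [Nonempty K] in
/-- Words whose tensor coordinates at a given good point are matrix units. -/
theorem IsAdmissible.exists_dual_words {y : K} (hy : y ∈ goodSet γ) (n : ℕ) :
    ∃ ξ : (Fin n → Fin N) → Fin n → Corr γ, ∀ p q,
      tensorCoord γ le_rfl (ξ p) q y = if p = q then 1 else 0 := by
  classical
  choose f h1 h0 _ using fun (p : Fin n → Fin N) (k : Fin n) =>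
    exists_bump (Set.finite_range fun q : Fin n → Fin N => tailPt γ q k y) (tailPt γ p k y)
  refine ⟨fun p k => fstPull γ (f p k), fun p q => ?_⟩
  have e : tensorCoord γ le_rfl (fun k => fstPull γ (f p k)) q y =
      ∏ k : Fin n, f p k (tailPt γ q k y) := by
    refine Finset.prod_congr rfl fun k _ => ?_
    rw [fstPull_cographPt]
    exact congrArg _ (map_tailPt q k y)
  rw [e]
  by_cases hpq : p = q
  · subst hpq
    rw [if_pos rfl]
    exact Finset.prod_eq_one fun k _ => h1 p k
  · rw [if_neg hpq]
    have hn : 0 < n := by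
      rcases Nat.eq_zero_or_pos n with rfl | hn
      · exact absurd (Subsingleton.elim p q) hpq
      · exact hn
    -- The factor k = 0 already vanishes, since the point x_0 determines the whole word.
    refine Finset.prod_eq_zero (Finset.mem_univ ⟨0, hn⟩) (h0 p _ _ ⟨q, rfl⟩ fun he => hpq ?_)
    exact funext fun k => ((H.tailPt_eq_iff hy q p 0).1 he k (Nat.zero_le _)).symm

/-- Approximate T by S₁ + S₂ with S₁ in ℱ^{(n)} and S₂ of longer words. Since T and S₂ vanish on the
level, the matrix of S₁ at b is no larger, entry by entry, than the error; it is removed by a small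
combination D of matrix units. -/
theorem IsAdmissible.mem_modelIdeal_of_kills {b : K} (hb : b ∈ branchSet γ) {n : ℕ}
    {T : cuntzPimsner γ} (hT : T ∈ core γ) (hk : H.Kills b n T) : T ∈ modelIdeal γ b n := by
  classical
  obtain ⟨ξ, hξ⟩ := H.exists_dual_words (branchSet_subset_goodSet hb) n
  set C : ℝ := ∑ p, ∑ q, ‖elemOp γ (ξ p) (ξ q) 1‖ with hC
  have hC0 : 0 ≤ C := Finset.sum_nonneg fun p _ => Finset.sum_nonneg fun q _ => norm_nonneg _
  refine Metric.mem_closure_iff.2 fun ε hε => ?_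
  -- C bounds the cost of the matrix units, so the total error is at most (1 + C) times the first
  -- one.
  obtain ⟨S, hS, hTS⟩ := exists_coreSpan_near hT (show 0 < ε / (1 + C) by positivity)
  obtain ⟨m, hm, ⟨S₁, M⟩, hP, S₂, hS₂, rfl⟩ := exists_decomposition n hS
  have hS₂k : H.Kills b n S₂ := by
    have : ⨆ k ∈ Finset.Ioc n m, compactLevel γ k ≤ H.killSubmodule b n :=
      iSup₂_le fun k hk => H.compactLevel_le hb (Finset.mem_Ioc.1 hk).1
    exact this hS₂
  have hMn : ∀ p q, ‖M b p q‖ ≤ ‖T - (S₁ + S₂)‖ := by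
    intro p q
    have hs := single_goodTail_mem_level hb q
    have h1 := H.eval_eq_of_mem_matrixGraph hP ⟨b, branchSet_subset_goodSet hb⟩ p q
    set s : GoodL2 γ := lp.single 2 (goodTail γ q 0 ⟨b, branchSet_subset_goodSet hb⟩) 1 with hsdef
    have hsn : ‖s‖ = 1 := by rw [hsdef, lp.norm_single (by norm_num)]; simp
    have h2 := H.norm_eval_apply_le (T - (S₁ + S₂)) s
      (goodTail γ p 0 ⟨b, branchSet_subset_goodSet hb⟩)
    rw [H.eval_sub_apply, H.eval_add_apply, hk s hs, hS₂k s hs, add_zero, zero_sub,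
      lp.coeFn_neg, Pi.neg_apply, h1, norm_neg, hsn, mul_one] at h2
    exact h2
  set D : cuntzPimsner γ := ∑ p, ∑ q, M b p q • elemOp γ (ξ p) (ξ q) 1 with hD
  set M' : C(K, Matrix (Fin n → Fin N) (Fin n → Fin N) ℂ) :=
    ∑ p, ∑ q, M b p q • matrixOf γ le_rfl (ξ p) (ξ q) 1 with hM'
  have hDM : (D, M') ∈ matrixGraph γ n := by
    have e : (D, M') = ∑ p, ∑ q, M b p q •
        (elemOp γ (ξ p) (ξ q) 1, matrixOf γ le_rfl (ξ p) (ξ q) 1) := by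
      refine Prod.ext ?_ ?_
      · simp only [Prod.fst_sum, Prod.smul_fst, hD]
      · simp only [Prod.snd_sum, Prod.smul_snd, hM']
    rw [e]
    exact sum_mem fun p _ => sum_mem fun q _ => Submodule.smul_mem _ _
      (elemOp_mem_matrixGraph le_rfl _ _ _)
  have hM'b : M' b = M b := by
    ext p q
    have e : ∀ p' q', matrixOf γ le_rfl (ξ p') (ξ q') 1 b p q =
        if p' = p then (if q' = q then 1 else 0) else 0 := by
      intro p' q'
      change (if _ then _ else _) = _
      rw [if_pos fun k hk => absurd k.2 (not_lt.2 hk), hξ, hξ]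
      by_cases h1 : p' = p <;> by_cases h2 : q' = q <;> simp [h1, h2]
    rw [hM', ContinuousMap.sum_apply, Matrix.sum_apply, Finset.sum_eq_single p]
    · rw [ContinuousMap.sum_apply, Matrix.sum_apply, Finset.sum_eq_single q]
      · rw [ContinuousMap.smul_apply, Matrix.smul_apply, e, if_pos rfl, if_pos rfl, smul_eq_mul,
          mul_one]
      · intro q' _ hq'
        rw [ContinuousMap.smul_apply, Matrix.smul_apply, e, if_pos rfl, if_neg hq', smul_zero]
      · simp
    · intro p' _ hp'
      rw [ContinuousMap.sum_apply, Matrix.sum_apply]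
      refine Finset.sum_eq_zero fun q' _ => ?_
      rw [ContinuousMap.smul_apply, Matrix.smul_apply, e, if_neg hp', smul_zero]
    · simp
  have hDn : ‖D‖ ≤ ‖T - (S₁ + S₂)‖ * C := by
    rw [hD, hC, Finset.mul_sum]
    refine norm_sum_le_of_le _ fun p _ => ?_
    rw [Finset.mul_sum]
    refine norm_sum_le_of_le _ fun q _ => ?_
    rw [norm_smul]
    gcongr
    exact hMn p q
  refine ⟨S₁ - D + S₂, Set.mem_iUnion₂.2 ⟨m, hm, Submodule.add_mem_sup ?_ hS₂⟩, ?_⟩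
  · refine ⟨M - M', sub_mem hP hDM, ?_⟩
    rw [ContinuousMap.sub_apply, hM'b, sub_self]
  · have e : T - (S₁ - D + S₂) = (T - (S₁ + S₂)) + D := by abel
    rw [dist_eq_norm, e]
    calc _ ≤ ‖T - (S₁ + S₂)‖ + ‖T - (S₁ + S₂)‖ * C :=
          (norm_add_le _ _).trans (add_le_add le_rfl hDn)
      _ = ‖T - (S₁ + S₂)‖ * (1 + C) := by ring
      _ < ε / (1 + C) * (1 + C) := by gcongr
      _ = ε := by field_simp

theorem IsAdmissible.mem_modelIdeal_iff {b : K} (hb : b ∈ branchSet γ) {n : ℕ}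
    {T : cuntzPimsner γ} (hT : T ∈ core γ) : T ∈ modelIdeal γ b n ↔ H.Kills b n T :=
  ⟨fun h => H.modelIdeal_subset hb n h, H.mem_modelIdeal_of_kills hb hT⟩

end ModelIdeals

end SelfSimilarCore

end

/-! ### Main theorem -/

theorem mainTheorem1 {K : Type u} [MetricSpace K] [CompactSpace K] [Nonempty K] {N : ℕ}
    (hN : 2 ≤ N) (γ : Fin N → C(K, K)) (hγ : IsSelfSimilarMap γ) (hB : AssumptionB γ) :
    -- a closed ideal of the core is determined by its intersection with `C(K)`,
    -- equivalently by the closed set `F_0^I`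
    (∀ I I' : TwoSidedIdeal (core γ), IsClosed (I : Set (core γ)) → IsClosed (I' : Set (core γ)) →
      (∀ a : C(K, ℂ), coreI γ a ∈ I ↔ coreI γ a ∈ I') → I = I') ∧
    (∀ I I' : TwoSidedIdeal (core γ), IsClosed (I : Set (core γ)) → IsClosed (I' : Set (core γ)) →
      zeroSet γ I = zeroSet γ I' → I = I') ∧
    -- the closed sets which arise
    {F : Set K | ∃ I : TwoSidedIdeal (core γ), IsClosed (I : Set (core γ)) ∧ zeroSet γ I = F} =
      {∅, Set.univ} ∪ {F : Set K | ∃ s : Finset (K × ℕ), (∀ q ∈ s, q.1 ∈ branchSet γ) ∧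
        F = ⋃ q ∈ s, orbit γ q.1 q.2} ∧
    -- the corresponding ideals
    (∀ I : TwoSidedIdeal (core γ), IsClosed (I : Set (core γ)) →
      (zeroSet γ I = ∅ ↔ I = ⊤) ∧
      (zeroSet γ I = Set.univ ↔ I = ⊥) ∧
      ∀ s : Finset (K × ℕ), (∀ q ∈ s, q.1 ∈ branchSet γ) →
        (zeroSet γ I = ⋃ q ∈ s, orbit γ q.1 q.2 ↔
          (I : Set (core γ)) = {T : core γ | ∀ q ∈ s, (T : cuntzPimsner γ) ∈ modelIdeal γ q.1 q.2})) := by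
  obtain ⟨h, hh⟩ := hB.hasInverse hγ
  have : NeZero N := ⟨by omega⟩
  have H : IsAdmissible γ h :=
    { toHasInverse := hh, dense := dense_goodSet hγ hh, selfSimilar := hγ, two_le := hN }
  have hempty : ∀ I : TwoSidedIdeal (core γ), IsClosed (I : Set (core γ)) →
      (zeroSet γ I = ∅ ↔ I = ⊤) := by
    have htop : zeroSet γ (⊤ : TwoSidedIdeal (core γ)) = ∅ :=
      Set.eq_empty_of_forall_notMem fun x hx => one_ne_zero (hx 1 (TwoSidedIdeal.mem_top _))
    intro I hI
    refine ⟨fun hz => H.eq_of_zeroSet_eq hI ?_ (hz.trans htop.symm), fun hI => hI ▸ htop⟩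
    rw [TwoSidedIdeal.coe_top]
    exact isClosed_univ
  have hbot : IsClosed ((⊥ : TwoSidedIdeal (core γ)) : Set (core γ)) := by
    rw [TwoSidedIdeal.coe_bot]
    exact isClosed_singleton
  refine ⟨fun I I' hI hI' hII => H.eq_of_zeroSet_eq hI hI' ?_,
    fun I I' hI hI' => H.eq_of_zeroSet_eq hI hI', ?_, fun I hI => ⟨hempty I hI, ?_, ?_⟩⟩
  · ext x
    exact forall_congr' fun a => imp_congr_left (hII a)
  · ext F
    constructor
    · rintro ⟨I, hI, rfl⟩
      by_cases hne : I = ⊥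
      · exact Or.inl (Or.inr (by rw [hne, H.zeroSet_bot]; rfl))
      · obtain ⟨s, hs, hsI⟩ := H.exists_finset_of_ne_bot hI hne
        exact Or.inr ⟨s, hs, H.zeroSet_eq hs hsI⟩
    · have hs : ∀ s : Finset (K × ℕ), (∀ q ∈ s, q.1 ∈ branchSet γ) →
          ∃ I : TwoSidedIdeal (core γ), IsClosed (I : Set (core γ)) ∧
            zeroSet γ I = ⋃ q ∈ s, orbit γ q.1 q.2 := fun s hs => by
        obtain ⟨I, hI, hsI⟩ := H.exists_ideal hs
        exact ⟨I, hI, H.zeroSet_eq hs hsI⟩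
      rintro ((rfl | rfl) | ⟨s, hsB, rfl⟩)
      · simpa using hs ∅ (by simp)
      · exact ⟨⊥, hbot, H.zeroSet_bot⟩
      · exact hs s hsB
  · exact ⟨fun hz => H.eq_of_zeroSet_eq hI hbot (hz.trans H.zeroSet_bot.symm),
      fun h0 => h0 ▸ H.zeroSet_bot⟩
  · intro s hs
    -- Within the core, belonging to a model ideal means vanishing on the corresponding level, so
    -- the claim becomes one about level kernels.
    have hmodel : (I : Set (core γ)) =
        {T : core γ | ∀ q ∈ s, (T : cuntzPimsner γ) ∈ modelIdeal γ q.1 q.2} ↔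
        ∀ T : core γ, T ∈ I ↔ ∀ q ∈ s, H.Kills q.1 q.2 T := by
      rw [Set.ext_iff]
      exact forall_congr' fun T => iff_congr Iff.rfl
        (forall₂_congr fun q hq => H.mem_modelIdeal_iff (hs q hq) T.2)
    rw [hmodel]
    refine ⟨fun hz => ?_, H.zeroSet_eq hs⟩
    -- The intersection of the level kernels is a closed ideal with the same zero set, so uniqueness
    -- identifies it with I.
    obtain ⟨I', hI', hsI'⟩ := H.exists_ideal hs
    rwa [H.eq_of_zeroSet_eq hI hI' (hz.trans (H.zeroSet_eq hs hsI').symm)]
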